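/- Let $a,k$ be nonzero real numbers. Consider the telegraph equation $$u_{tt}+k u_t=a^2\Big[\tfrac1r (r u_r)_r+\tfrac1{r^2}u_{xx}+u_{yy}\Big]\qquad(\ast)$$ for functions $u(r,x,y,t)$ on $r>0$, $(x,y,t)\in\mathbb R^3$. A smooth vector field $V=\xi_1\partial_r+\xi_2\partial_x+\xi_3\partial_y+\xi_4\partial_t+\eta\,\partial_u$ on $M=\{(r,x,y,t,u)\in\mathbb R^5: r>0\}$ is called an (infinitesimal) Lie point symmetry of $(\ast)$ if its second prolongation $V^{(2)}=\sum_i\xi_i\partial_{x_i}+\sum_{\#J\le 2}\varphi^J\partial_{u_J}$, $\varphi^J=D_J\big(\eta-\sum_i\xi_iu_i\big)+\sum_i\xi_iu_{J,i}$ (with $D_J$ the total derivatives and $(x_1,x_2,x_3,x_4)=(r,x,y,t)$), annihilates the equation $(\ast)$ at every jet that satisfies $(\ast)$. **(1) Determining equations.** A smooth vector field $V$ on $M$ is a Lie point symmetry of $(\ast)$ if and only if its coefficients satisfy on $M$ the following 27 equations (subscripts are partial derivatives): $\xi_{2,u}=0$, $\xi_{2,yy}=0$, $\xi_{3,y}=0$,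 $\xi_{3,u}=0$, $\xi_{4,t}=0$, $\xi_{4,u}=0$, $\xi_{4,rr}=0$, $\xi_{4,xy}=0$, $\xi_{4,yy}=0$, $\xi_{4,ry}=0$, $\eta_{tu}=0$, $\eta_{uu}=0$, $k\xi_{4,r}+2\eta_{ru}=0$, $\xi_1+r\xi_{2,x}=0$, $\xi_{2,x}+r\xi_{2,rx}=0$, $\xi_{2,y}+r\xi_{2,ry}=0$, $\xi_{2,xx}-r\xi_{2,r}=0$, $k\xi_{4,y}+2\eta_{yu}=0$, $2\xi_{2,r}+r\xi_{2,rr}=0$, $\xi_{3,r}-r\xi_{2,xy}=0$, $\xi_{3,x}+r^2\xi_{2,y}=0$, $\xi_{3,t}-a^2\xi_{4,y}=0$, $\xi_{4,x}-r\xi_{4,rx}=0$, $\xi_{4,xx}+r\xi_{4,r}=0$, $r^2\xi_{2,t}-a^2\xi_{4,x}=0$, $k\xi_{4,x}+2\eta_{ux}=0$, and $a^2r^2\eta_{rr}-kr^2\eta_t+a^2r\eta_r+a^2r^2\eta_{yy}-r^2\eta_{tt}+a^2\eta_{xx}=0$. **(2) The symmetry algebra.** Up to the trivial symmetries $\beta(r,x,y,t)\,\partial_u$,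 with $\beta$ a smooth solution of $(\ast)$ on $r>0$ (they express that $(\ast)$ is linear), the Lie point symmetries of $(\ast)$ are spanned by eleven vector fields: a vector field on $M$ is a Lie point symmetry if and only if it is the sum of a real linear combination of $$\begin{aligned} &v_1=\partial_x,\quad v_2=\partial_y,\quad v_3=\partial_t,\quad v_4=u\partial_u,\quad v_5=2a^2t\,\partial_y+2y\,\partial_t-kyu\,\partial_u,\\ &v_6=\sin x\,\partial_r+r^{-1}\cos x\,\partial_x,\qquad v_7=-\cos x\,\partial_r+r^{-1}\sin x\,\partial_x,\\ &v_8=-y\cos x\,\partial_r+r^{-1}y\sin x\,\partial_x+r\cos x\,\partial_y,\\ &v_9=-y\sin x\,\partial_r-r^{-1}y\cos x\,\partial_x+r\sin x\,\partial_y,\\ &v_{10}=2a^2t\sin x\,\partial_r+2a^2tr^{-1}\cos x\,\partial_x+2r\sin x\,\partial_t-kru\sin x\,\partial_u,\\ &v_{11}=-2a^2t\cos x\,\partial_r+2a^2tr^{-1}\sin x\,\partial_x-2r\cos x\,\partial_t+kru\cos x\,\partial_u \end{aligned}$$ and a field $\beta\,\partial_u$, with $\beta$ a smooth solution of $(\ast)$.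 The fields $v_1,\dots,v_{11}$ are linearly independent, and their span meets the space of the fields $\beta\,\partial_u$ only in $0$. **(3) Commutators.** On $M$, with $w=2v_3-kv_4$, the Lie brackets $[v_i,v_j]$ with $i<j$ are $[v_1,v_6]=-v_7$, $[v_1,v_7]=v_6$, $[v_1,v_8]=-v_9$, $[v_1,v_9]=v_8$, $[v_1,v_{10}]=-v_{11}$, $[v_1,v_{11}]=v_{10}$, $[v_2,v_5]=w$, $[v_2,v_8]=v_7$, $[v_2,v_9]=-v_6$, $[v_3,v_5]=2a^2v_2$, $[v_3,v_{10}]=2a^2v_6$, $[v_3,v_{11}]=2a^2v_7$, $[v_5,v_8]=v_{11}$, $[v_5,v_9]=-v_{10}$, $[v_5,v_{10}]=-4a^2v_9$, $[v_5,v_{11}]=4a^2v_8$, $[v_6,v_9]=v_2$, $[v_6,v_{10}]=w$, $[v_7,v_8]=-v_2$, $[v_7,v_{11}]=w$, $[v_8,v_9]=-v_1$, $[v_8,v_{11}]=v_5$, $[v_9,v_{10}]=-v_5$, $[v_{10},v_{11}]=4a^2v_1$, all others with $i<j$ being $0$; the brackets with $i\ge j$ follow by antisymmetry. **(4) One-parameter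 groups.** Put $X=r\cos x$, $Y=r\sin x$, $C=\cosh 2as$, $S=\sinh 2as$, and for $(X',Y')\ne(0,0)$ let $P(X',Y')=(r',x')$ be the polar coordinates $r'=\sqrt{X'^2+Y'^2}$, $x'=x+\arg\big((X'+iY')e^{-ix}\big)$, $\arg\in(-\pi,\pi]$. The (local) one-parameter groups $g_i$, with parameter $s$, generated by the $v_i$ send $(r,x,y,t,u)$ to: $g_1:(r,x+s,y,t,u)$; $g_2:(r,x,y+s,t,u)$; $g_3:(r,x,y,t+s,u)$; $g_4:(r,x,y,t,e^su)$; $g_5:(r,x,\,yC+atS,\,t',\,e^{-k(t'-t)/2}u)$ with $t'=tC+a^{-1}yS$; $g_6:(P(X,Y+s),y,t,u)$; $g_7:(P(X-s,Y),y,t,u)$; $g_8:(P(X\cos s-y\sin s,\,Y),\,y\cos s+X\sin s,\,t,u)$; $g_9:(P(X,\,Y\cos s-y\sin s),\,y\cos s+Y\sin s,\,t,u)$; $g_{10}:(P(X,\,YC+atS),\,y,\,t',\,e^{-k(t'-t)/2}u)$ with $t'=tC+a^{-1}YS$; $g_{11}:(P(XC-atS,\,Y),\,y,\,t',\,e^{-k(t'-t)/2}u)$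 with $t'=tC-a^{-1}XS$. That is, for every point $p\in M$, $g_i$ at parameter $0$ fixes $p$, and $s\mapsto g_i(s)p$ is an integral curve of $v_i$ as long as $r'$ has not vanished between parameter $0$ and $s$. -/

import Mathlib

open scoped ContDiff

noncomputable section

namespace Telegraph

/-! Coordinates: index `0, 1, 2, 3` stands for `r, x, y, t`. -/

/-- The space of independent variables `z = (r, x, y, t)`. -/
abbrev Base := Fin 4 → ℝ

/-- The space of independent and dependent variables `(z, u)`. -/
abbrev Total := Base × ℝ

/-- The domain `r > 0` of the independent variables. -/
def baseDomain : Set Base := {z | 0 < z 0}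

/-- The domain `r > 0` of the independent and dependent variables. -/
def domain : Set Total := {p | 0 < p.1 0}

/-- A function of `(r, x, y, t, u)` as a function on the total space. -/
def ofCoords {α : Type*} (f : ℝ → ℝ → ℝ → ℝ → ℝ → α) (p : Total) : α :=
  f (p.1 0) (p.1 1) (p.1 2) (p.1 3) p.2

/-- Partial derivative of a function of the independent variables. -/
def pd (i : Fin 4) (f : Base → ℝ) (z : Base) : ℝ := fderiv ℝ f z (Pi.single i 1)

/-- Classical smooth solutions on `r > 0` of
`u_tt + k u_t = a² ((1/r) (r u_r)_r + (1/r²) u_xx + u_yy)`. -/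
def IsSolution (a k : ℝ) (f : Base → ℝ) : Prop :=
  ContDiffOn ℝ ∞ f baseDomain ∧ ∀ z ∈ baseDomain,
    pd 3 (pd 3 f) z + k * pd 3 f z =
      a ^ 2 * (1 / z 0 * pd 0 (fun w => w 0 * pd 0 f w) z
        + 1 / z 0 ^ 2 * pd 1 (pd 1 f) z + pd 2 (pd 2 f) z)

/-! ### Jets, total derivatives and prolongations -/

/-- Jets `(z, U)`: the coordinate `u_J` is `U J`, a multi-index `J` being a multiset of indices;
so `U 0` is `u`, `U {3}` is `u_t`, `U {0, 0}` is `u_rr`. -/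
abbrev Jet := Base × (Multiset (Fin 4) → ℝ)

/-- The partial derivative of a function on jet space in the direction of the `i`-th
independent variable, all jet coordinates being kept fixed. -/
def jetDz (i : Fin 4) (F : Jet → ℝ) (j : Jet) : ℝ :=
  deriv (fun s => F (Function.update j.1 i s, j.2)) (j.1 i)

/-- The partial derivative of a function on jet space with respect to `u_J`. -/
def jetDu (J : Multiset (Fin 4)) (F : Jet → ℝ) (j : Jet) : ℝ :=
  deriv (fun s => F (j.1, Function.update j.2 J s)) (j.2 J)

/-- The total derivative `D_i = ∂_i + ∑_J u_{J,i} ∂_{u_J}`; on a function of finite order only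
finitely many terms of the sum are nonzero. -/
def totalD (i : Fin 4) (F : Jet → ℝ) (j : Jet) : ℝ :=
  jetDz i F j + ∑ᶠ J : Multiset (Fin 4), j.2 (i ::ₘ J) * jetDu J F j

/-- The iterated total derivative `D_J`. -/
def totalDMulti (J : Multiset (Fin 4)) (F : Jet → ℝ) : Jet → ℝ :=
  (totalD 0)^[J.count 0] ((totalD 1)^[J.count 1]
    ((totalD 2)^[J.count 2] ((totalD 3)^[J.count 3] F)))

/-- The coefficient `ξ_i` of the vector field `V = ∑ ξ_i ∂_i + η ∂_u`
(`i = 0, 1, 2, 3` for `r, x, y, t`). -/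
def xi (V : Total → Total) (i : Fin 4) (p : Total) : ℝ := (V p).1 i

/-- The coefficient `η` of the vector field `V = ∑ ξ_i ∂_i + η ∂_u`. -/
def eta (V : Total → Total) (p : Total) : ℝ := (V p).2

/-- The characteristic `Q = η - ∑ ξ_i u_i` of a vector field. -/
def characteristic (V : Total → Total) (j : Jet) : ℝ :=
  eta V (j.1, j.2 0) - ∑ i, xi V i (j.1, j.2 0) * j.2 {i}

/-- The prolongation coefficient `φ^J = D_J Q + ∑ ξ_i u_{J,i}`. -/
def prolongCoeff (V : Total → Total) (J : Multiset (Fin 4)) (j : Jet) : ℝ :=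
  totalDMulti J (characteristic V) j + ∑ i, xi V i (j.1, j.2 0) * j.2 (i ::ₘ J)

/-- The `n`-th prolongation of a vector field,
`∑ ξ_i ∂_i + ∑_{#J ≤ n} φ^J ∂_{u_J}`, acting on functions on jet space. -/
def prolong (n : ℕ) (V : Total → Total) (F : Jet → ℝ) (j : Jet) : ℝ :=
  ∑ i, xi V i (j.1, j.2 0) * jetDz i F j
    + ∑ᶠ (J : Multiset (Fin 4)) (_ : J.card ≤ n), prolongCoeff V J j * jetDu J F j

/-- The telegraph equation as a function on jet space, with `(1/r) (r u_r)_r` written as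
`u_rr + (1/r) u_r`. -/
def telegraph (a k : ℝ) (j : Jet) : ℝ :=
  j.2 {3, 3} + k * j.2 {3}
    - a ^ 2 * (j.2 {0, 0} + 1 / j.1 0 * j.2 {0} + 1 / j.1 0 ^ 2 * j.2 {1, 1} + j.2 {2, 2})

/-- `V` is a smooth vector field on `r > 0` generating a Lie point symmetry of the telegraph
equation: its second prolongation annihilates the equation wherever the equation holds. -/
def IsPointSymmetry (a k : ℝ) (V : Total → Total) : Prop :=
  ContDiffOn ℝ ∞ V domain ∧
    ∀ j : Jet, j.1 ∈ baseDomain → telegraph a k j = 0 → prolong 2 V (telegraph a k) j = 0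

/-! ### The determining equations -/

/-- Partial derivative in an independent variable of a function of `(r, x, y, t, u)`. -/
def dz (i : Fin 4) (F : Total → ℝ) (p : Total) : ℝ := fderiv ℝ F p (Pi.single i 1, 0)

/-- Partial derivative in `u` of a function of `(r, x, y, t, u)`. -/
def du (F : Total → ℝ) (p : Total) : ℝ := fderiv ℝ F p (0, 1)

/-- The determining equations, for given coefficients, at a point. -/
def DeterminingAt (a k : ℝ) (ξ₁ ξ₂ ξ₃ ξ₄ η : Total → ℝ) (p : Total) : Prop :=
  let r := p.1 0
  du ξ₂ p = 0 ∧
  dz 2 (dz 2 ξ₂) p = 0 ∧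
  dz 2 ξ₃ p = 0 ∧
  du ξ₃ p = 0 ∧
  dz 3 ξ₄ p = 0 ∧
  du ξ₄ p = 0 ∧
  dz 0 (dz 0 ξ₄) p = 0 ∧
  dz 1 (dz 2 ξ₄) p = 0 ∧
  dz 2 (dz 2 ξ₄) p = 0 ∧
  dz 0 (dz 2 ξ₄) p = 0 ∧
  dz 3 (du η) p = 0 ∧
  du (du η) p = 0 ∧
  k * dz 0 ξ₄ p + 2 * dz 0 (du η) p = 0 ∧
  ξ₁ p + r * dz 1 ξ₂ p = 0 ∧
  dz 1 ξ₂ p + r * dz 0 (dz 1 ξ₂) p = 0 ∧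
  dz 2 ξ₂ p + r * dz 0 (dz 2 ξ₂) p = 0 ∧
  dz 1 (dz 1 ξ₂) p - r * dz 0 ξ₂ p = 0 ∧
  k * dz 2 ξ₄ p + 2 * dz 2 (du η) p = 0 ∧
  2 * dz 0 ξ₂ p + r * dz 0 (dz 0 ξ₂) p = 0 ∧
  dz 0 ξ₃ p - r * dz 1 (dz 2 ξ₂) p = 0 ∧
  dz 1 ξ₃ p + r ^ 2 * dz 2 ξ₂ p = 0 ∧
  dz 3 ξ₃ p - a ^ 2 * dz 2 ξ₄ p = 0 ∧
  dz 1 ξ₄ p - r * dz 0 (dz 1 ξ₄) p = 0 ∧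
  dz 1 (dz 1 ξ₄) p + r * dz 0 ξ₄ p = 0 ∧
  r ^ 2 * dz 3 ξ₂ p - a ^ 2 * dz 1 ξ₄ p = 0 ∧
  k * dz 1 ξ₄ p + 2 * dz 1 (du η) p = 0 ∧
  a ^ 2 * r ^ 2 * dz 0 (dz 0 η) p - k * r ^ 2 * dz 3 η p + a ^ 2 * r * dz 0 η p
    + a ^ 2 * r ^ 2 * dz 2 (dz 2 η) p - r ^ 2 * dz 3 (dz 3 η) p + a ^ 2 * dz 1 (dz 1 η) p = 0

/-- The 27 determining equations for the coefficients of a vector field on `r > 0`. -/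
def DeterminingEquations (a k : ℝ) (V : Total → Total) : Prop :=
  ∀ p ∈ domain, DeterminingAt a k (xi V 0) (xi V 1) (xi V 2) (xi V 3) (eta V) p

/-! ### The generators, their commutators and their flows -/

open Real in
/-- The eleven vector fields `v₁, …, v₁₁` (numbered from `0`). -/
def gen (a k : ℝ) : Fin 11 → Total → Total := ![
  ofCoords fun _ _ _ _ _ => (![0, 1, 0, 0], 0),
  ofCoords fun _ _ _ _ _ => (![0, 0, 1, 0], 0),
  ofCoords fun _ _ _ _ _ => (![0, 0, 0, 1], 0),
  ofCoords fun _ _ _ _ u => (![0, 0, 0, 0], u),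
  ofCoords fun _ _ y t u => (![0, 0, 2 * a ^ 2 * t, 2 * y], -k * y * u),
  ofCoords fun r x _ _ _ => (![sin x, r⁻¹ * cos x, 0, 0], 0),
  ofCoords fun r x _ _ _ => (![-cos x, r⁻¹ * sin x, 0, 0], 0),
  ofCoords fun r x y _ _ => (![-y * cos x, r⁻¹ * y * sin x, r * cos x, 0], 0),
  ofCoords fun r x y _ _ => (![-y * sin x, -r⁻¹ * y * cos x, r * sin x, 0], 0),
  ofCoords fun r x _ t u =>
    (![2 * a ^ 2 * t * sin x, 2 * a ^ 2 * t * r⁻¹ * cos x, 0, 2 * r * sin x],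
      -k * r * u * sin x),
  ofCoords fun r x _ t u =>
    (![-2 * a ^ 2 * t * cos x, 2 * a ^ 2 * t * r⁻¹ * sin x, 0, -2 * r * cos x],
      k * r * u * cos x)]

/-- The vector field `β(r, x, y, t) ∂_u`. -/
def superposition (β : Base → ℝ) (p : Total) : Total := (0, β p.1)

/-- The commutator table: the entry in row `i` and column `j` is `[vᵢ, vⱼ]`, where the arguments
`v₁, …, v₁₁` are any eleven vectors in a real vector space. -/
def commutatorTable (a k : ℝ) {W : Type*} [AddCommGroup W] [Module ℝ W] (v : Fin 11 → W) :
    Fin 11 → Fin 11 → W :=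
  let v₁ := v 0
  let v₂ := v 1
  let v₃ := v 2
  let v₄ := v 3
  let v₅ := v 4
  let v₆ := v 5
  let v₇ := v 6
  let v₈ := v 7
  let v₉ := v 8
  let v₁₀ := v 9
  let v₁₁ := v 10
  let c : ℝ := 2 * a ^ 2
  let d : ℝ := 4 * a ^ 2
  let w : W := (2 : ℝ) • v₃ - k • v₄
  ![![0, 0, 0, 0, 0, -v₇, v₆, -v₉, v₈, -v₁₁, v₁₀],
    ![0, 0, 0, 0, w, 0, 0, v₇, -v₆, 0, 0],
    ![0, 0, 0, 0, c • v₂, 0, 0, 0, 0, c • v₆, c • v₇],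
    ![0, 0, 0, 0, 0, 0, 0, 0, 0, 0, 0],
    ![0, -w, -c • v₂, 0, 0, 0, 0, v₁₁, -v₁₀, -d • v₉, d • v₈],
    ![v₇, 0, 0, 0, 0, 0, 0, 0, v₂, w, 0],
    ![-v₆, 0, 0, 0, 0, 0, 0, -v₂, 0, 0, w],
    ![v₉, -v₇, 0, 0, -v₁₁, 0, v₂, 0, -v₁, 0, v₅],
    ![-v₈, v₆, 0, 0, v₁₀, -v₂, 0, v₁, 0, -v₅, 0],
    ![v₁₁, 0, -c • v₆, 0, d • v₉, -w, 0, 0, v₅, 0, d • v₁],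
    ![-v₁₀, 0, -c • v₇, 0, -d • v₈, 0, -w, -v₅, 0, -d • v₁, 0]]

/-- The point whose polar coordinates `(r, x)` are those of the point `(X, Y)` of the plane, the
angle being chosen in the half-open interval of length `2π` around the given angle `x`. -/
def polar (x X Y y t u : ℝ) : Total :=
  (![Real.sqrt (X ^ 2 + Y ^ 2),
      x + Complex.arg ((X + Y * Complex.I) * Complex.exp (-(x * Complex.I))), y, t], u)

open Real in
/-- The one-parameter (local) groups generated by `v₁, …, v₁₁` (numbered from `0`), with group
parameter `s`. -/
def flow (a k : ℝ) (i : Fin 11) (s : ℝ) : Total → Total :=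
  let C := cosh (2 * a * s)
  let S := sinh (2 * a * s)
  ![ofCoords fun r x y t u => (![r, x + s, y, t], u),
    ofCoords fun r x y t u => (![r, x, y + s, t], u),
    ofCoords fun r x y t u => (![r, x, y, t + s], u),
    ofCoords fun r x y t u => (![r, x, y, t], exp s * u),
    ofCoords fun r x y t u =>
      let t' := t * C + y / a * S
      (![r, x, y * C + a * t * S, t'], exp (-(k / 2) * (t' - t)) * u),
    ofCoords fun r x y t u => polar x (r * cos x) (r * sin x + s) y t u,
    ofCoords fun r x y t u => polar x (r * cos x - s) (r * sin x) y t u,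
    ofCoords fun r x y t u =>
      polar x (r * cos x * cos s - y * sin s) (r * sin x) (y * cos s + r * cos x * sin s) t u,
    ofCoords fun r x y t u =>
      polar x (r * cos x) (r * sin x * cos s - y * sin s) (y * cos s + r * sin x * sin s) t u,
    ofCoords fun r x y t u =>
      let t' := t * C + r * sin x / a * S
      polar x (r * cos x) (r * sin x * C + a * t * S) y t' (exp (-(k / 2) * (t' - t)) * u),
    ofCoords fun r x y t u =>
      let t' := t * C - r * cos x / a * S
      polar x (r * cos x * C - a * t * S) (r * sin x) y t' (exp (-(k / 2) * (t' - t)) * u)] i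

end Telegraph

end

/-! ### Differential algebra of polar coordinates; Killing equations and the determining equations
-/

noncomputable section
namespace Telegraph

/-! In the coordinates `X = r cos x`, `Y = r sin x`, `y`, `t` the equation is the damped wave
equation for the flat metric `dX² + dY² + dy² - a² dt²`. At a point the symmetry condition is a
polynomial in the derivatives of `u`, with `u_tt` eliminated by the equation. Its coefficients say
that the `ξ_i` do not depend on `u`, that `η_uu = 0`, that `ξ` is a conformal Killing field with
factor `f = ∂_t ξ₄`, that `η` solves the equation, and that the gradient of `η_u` is given by the
telegraph operator `L` on the components of `ξ` (`Condition.Xᵤ_eq_zero`, `Condition.conformal`,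
`Conformal.condition`).

Damping removes the proper conformal fields. The flat conformal identities (`L_components`) turn the
gradient equations into the constancy of `2 η_u + 2 f + k ξ₄`. Applying `L`, with `L η_u = 0`, `L f
= k r² f_t` and `L ξ₄ = r² (-2 f_t + k f)`, leaves `k² r² f = 0`, so `f = 0`
(`IsConformal.factor_eq_zero`). What remains is a Killing field with `2 η_u + k ξ₄` constant; the
determining equations are equivalent to this system by differentiation and elimination.

A flat Killing field is affine: its second derivatives are symmetric in two indices and skew in two,
hence vanish (`killing_second_deriv`). The six constants of its linear part, the four of its
translation part and the constant in `η_u` are the eleven parameters; `β = η - u η_u` is the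
superposition term (`IsKilling.exists_isCombination`).

All this uses only commuting derivations, a few relations between coordinate functions and the
constancy of functions with zero derivative, so it is carried out in an abstract `PolarCalculus`, of
which the smooth functions on `r > 0` are an instance. The brackets are algebraic identities in `cos
x`, `sin x`, `r`. For the flows through `polar`, the motion in the `(X, Y)` plane stays on a
horizontal or vertical line; the chosen branch of the angle could fail only on the ray opposite to
the starting point, which such a path cannot reach without meeting the origin
(`rotated_mem_slitPlane`). -/

/-- A differential algebra modelled on the smooth functions of `(r, x, y, t, u)` on `r > 0`:
commuting derivations `∂_r, ∂_x, ∂_y, ∂_t` (numbered from `0`) and `∂_u`, the coordinate functions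
`r, y, t, u` together with `1 / r`, `cos x` and `sin x`, and no constants but the real ones. -/
structure PolarCalculus (R : Type*) [CommRing R] [Algebra ℝ R] where
  D : Fin 4 → Derivation ℝ R R
  Du : Derivation ℝ R R
  r : R
  ri : R
  cs : R
  sn : R
  y : R
  t : R
  u : R
  comm : ∀ i j f, D i (D j f) = D j (D i f)
  comm_u : ∀ i f, Du (D i f) = D i (Du f)
  D_r : ∀ i, D i r = if i = 0 then 1 else 0
  D_cs : ∀ i, D i cs = if i = 1 then -sn else 0
  D_sn : ∀ i, D i sn = if i = 1 then cs else 0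
  D_y : ∀ i, D i y = if i = 2 then 1 else 0
  D_t : ∀ i, D i t = if i = 3 then 1 else 0
  D_u : ∀ i, D i u = 0
  Du_r : Du r = 0
  Du_cs : Du cs = 0
  Du_sn : Du sn = 0
  Du_y : Du y = 0
  Du_t : Du t = 0
  Du_u : Du u = 1
  r_mul_ri : r * ri = 1
  cs_sq_add_sn_sq : cs ^ 2 + sn ^ 2 = 1
  exists_const : ∀ f, (∀ i, D i f = 0) → Du f = 0 → ∃ c : ℝ, f = algebraMap ℝ R c

namespace PolarCalculus

variable {R : Type*} [CommRing R] [Algebra ℝ R] (C : PolarCalculus R)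

/-- Instances of `C.comm` oriented so that the smaller index ends up outside; as rewrite rules they
terminate and give iterated derivatives a normal form. -/
lemma comm10 (f : R) : C.D 1 (C.D 0 f) = C.D 0 (C.D 1 f) := C.comm _ _ _
lemma comm20 (f : R) : C.D 2 (C.D 0 f) = C.D 0 (C.D 2 f) := C.comm _ _ _
lemma comm30 (f : R) : C.D 3 (C.D 0 f) = C.D 0 (C.D 3 f) := C.comm _ _ _
lemma comm21 (f : R) : C.D 2 (C.D 1 f) = C.D 1 (C.D 2 f) := C.comm _ _ _
lemma comm31 (f : R) : C.D 3 (C.D 1 f) = C.D 1 (C.D 3 f) := C.comm _ _ _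
lemma comm32 (f : R) : C.D 3 (C.D 2 f) = C.D 2 (C.D 3 f) := C.comm _ _ _

include C in
lemma r_cancel {f : R} (h : C.r * f = 0) : f = 0 := by
  linear_combination C.ri * h - f * C.r_mul_ri

lemma D_ri (i : Fin 4) : C.D i C.ri = if i = 0 then -C.ri ^ 2 else 0 := by
  have h := congrArg (C.D i) C.r_mul_ri
  simp only [Derivation.leibniz, smul_eq_mul, Derivation.map_one_eq_zero, C.D_r] at h
  split_ifs at h ⊢
  · linear_combination C.ri * h - C.D i C.ri * C.r_mul_ri
  · linear_combination C.ri * h - C.D i C.ri * C.r_mul_ri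

lemma Du_ri : C.Du C.ri = 0 := by
  have h := congrArg C.Du C.r_mul_ri
  simp only [Derivation.leibniz, smul_eq_mul, Derivation.map_one_eq_zero, C.Du_r] at h
  linear_combination C.ri * h - C.Du C.ri * C.r_mul_ri

end PolarCalculus

lemma algebraMap_cancel {R : Type*} [CommRing R] [Algebra ℝ R] {c : ℝ} (hc : c ≠ 0) {f : R}
    (h : algebraMap ℝ R c * f = 0) : f = 0 := by
  have h1 : algebraMap ℝ R c⁻¹ * algebraMap ℝ R c = 1 := by
    rw [← map_mul, inv_mul_cancel₀ hc, map_one]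
  linear_combination algebraMap ℝ R c⁻¹ * h - f * h1

lemma two_cancel {R : Type*} [CommRing R] [Algebra ℝ R] {f : R} (h : 2 * f = 0) : f = 0 :=
  algebraMap_cancel (c := 2) two_ne_zero (by rwa [map_ofNat])

section systems

variable {R : Type*} [CommRing R] [Algebra ℝ R] (C : PolarCalculus R) (a k : ℝ)
  (ξ₁ ξ₂ ξ₃ ξ₄ η : R)

/-- The telegraph operator multiplied by `r ^ 2`. -/
def PolarCalculus.L (f : R) : R :=
  C.r ^ 2 * C.D 3 (C.D 3 f) + algebraMap ℝ R k * C.r ^ 2 * C.D 3 f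
    - algebraMap ℝ R (a ^ 2) * (C.r ^ 2 * C.D 0 (C.D 0 f) + C.r * C.D 0 f + C.D 1 (C.D 1 f)
      + C.r ^ 2 * C.D 2 (C.D 2 f))

/-- The first-order equations of conformal type, with conformal factor `∂_t ξ₄`. -/
structure IsConformalField : Prop where
  u1 : C.Du ξ₁ = 0
  u2 : C.Du ξ₂ = 0
  u3 : C.Du ξ₃ = 0
  u4 : C.Du ξ₄ = 0
  d11 : C.D 0 ξ₁ = C.D 3 ξ₄
  d22 : ξ₁ + C.r * C.D 1 ξ₂ = C.r * C.D 3 ξ₄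
  d33 : C.D 2 ξ₃ = C.D 3 ξ₄
  d12 : C.r ^ 2 * C.D 0 ξ₂ + C.D 1 ξ₁ = 0
  d13 : C.D 2 ξ₁ + C.D 0 ξ₃ = 0
  d23 : C.r ^ 2 * C.D 2 ξ₂ + C.D 1 ξ₃ = 0
  d14 : C.D 3 ξ₁ = algebraMap ℝ R (a ^ 2) * C.D 0 ξ₄
  d24 : C.r ^ 2 * C.D 3 ξ₂ = algebraMap ℝ R (a ^ 2) * C.D 1 ξ₄
  d34 : C.D 3 ξ₃ = algebraMap ℝ R (a ^ 2) * C.D 2 ξ₄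

/-- The equations obtained by comparing coefficients in the symmetry condition. -/
structure IsConformal : Prop extends IsConformalField C a ξ₁ ξ₂ ξ₃ ξ₄ where
  uu : C.Du (C.Du η) = 0
  e1 : algebraMap ℝ R (a ^ 2) * (-2 * C.r ^ 2 * C.D 0 (C.Du η) + ξ₁ - 2 * C.r * C.D 3 ξ₄)
    = C.L a k ξ₁
  e2 : -2 * algebraMap ℝ R (a ^ 2) * C.D 1 (C.Du η) = C.L a k ξ₂
  e3 : -2 * algebraMap ℝ R (a ^ 2) * C.r ^ 2 * C.D 2 (C.Du η) = C.L a k ξ₃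
  e4 : C.r ^ 2 * (2 * C.D 3 (C.Du η) + 2 * algebraMap ℝ R k * C.D 3 ξ₄) = C.L a k ξ₄
  e5 : C.L a k η = 0

/-- The equations of Killing type, to which the symmetry condition reduces. -/
structure IsKilling : Prop where
  u1 : C.Du ξ₁ = 0
  u2 : C.Du ξ₂ = 0
  u3 : C.Du ξ₃ = 0
  u4 : C.Du ξ₄ = 0
  d11 : C.D 0 ξ₁ = 0
  d22 : ξ₁ + C.r * C.D 1 ξ₂ = 0
  d33 : C.D 2 ξ₃ = 0
  d44 : C.D 3 ξ₄ = 0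
  d12 : C.r ^ 2 * C.D 0 ξ₂ + C.D 1 ξ₁ = 0
  d13 : C.D 2 ξ₁ + C.D 0 ξ₃ = 0
  d23 : C.r ^ 2 * C.D 2 ξ₂ + C.D 1 ξ₃ = 0
  d14 : C.D 3 ξ₁ = algebraMap ℝ R (a ^ 2) * C.D 0 ξ₄
  d24 : C.r ^ 2 * C.D 3 ξ₂ = algebraMap ℝ R (a ^ 2) * C.D 1 ξ₄
  d34 : C.D 3 ξ₃ = algebraMap ℝ R (a ^ 2) * C.D 2 ξ₄
  uu : C.Du (C.Du η) = 0
  e : ∀ i, algebraMap ℝ R k * C.D i ξ₄ + 2 * C.D i (C.Du η) = 0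
  e5 : C.L a k η = 0

/-- The 27 determining equations in a differential algebra. -/
def Determining : Prop :=
  C.Du ξ₂ = 0 ∧
  C.D 2 (C.D 2 ξ₂) = 0 ∧
  C.D 2 ξ₃ = 0 ∧
  C.Du ξ₃ = 0 ∧
  C.D 3 ξ₄ = 0 ∧
  C.Du ξ₄ = 0 ∧
  C.D 0 (C.D 0 ξ₄) = 0 ∧
  C.D 1 (C.D 2 ξ₄) = 0 ∧
  C.D 2 (C.D 2 ξ₄) = 0 ∧
  C.D 0 (C.D 2 ξ₄) = 0 ∧
  C.D 3 (C.Du η) = 0 ∧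
  C.Du (C.Du η) = 0 ∧
  algebraMap ℝ R k * C.D 0 ξ₄ + 2 * C.D 0 (C.Du η) = 0 ∧
  ξ₁ + C.r * C.D 1 ξ₂ = 0 ∧
  C.D 1 ξ₂ + C.r * C.D 0 (C.D 1 ξ₂) = 0 ∧
  C.D 2 ξ₂ + C.r * C.D 0 (C.D 2 ξ₂) = 0 ∧
  C.D 1 (C.D 1 ξ₂) - C.r * C.D 0 ξ₂ = 0 ∧
  algebraMap ℝ R k * C.D 2 ξ₄ + 2 * C.D 2 (C.Du η) = 0 ∧
  2 * C.D 0 ξ₂ + C.r * C.D 0 (C.D 0 ξ₂) = 0 ∧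
  C.D 0 ξ₃ - C.r * C.D 1 (C.D 2 ξ₂) = 0 ∧
  C.D 1 ξ₃ + C.r ^ 2 * C.D 2 ξ₂ = 0 ∧
  C.D 3 ξ₃ - algebraMap ℝ R (a ^ 2) * C.D 2 ξ₄ = 0 ∧
  C.D 1 ξ₄ - C.r * C.D 0 (C.D 1 ξ₄) = 0 ∧
  C.D 1 (C.D 1 ξ₄) + C.r * C.D 0 ξ₄ = 0 ∧
  C.r ^ 2 * C.D 3 ξ₂ - algebraMap ℝ R (a ^ 2) * C.D 1 ξ₄ = 0 ∧
  algebraMap ℝ R k * C.D 1 ξ₄ + 2 * C.D 1 (C.Du η) = 0 ∧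
  C.L a k η = 0

variable {C a k ξ₁ ξ₂ ξ₃ ξ₄ η}

/-- The second-order entries of the list are integrability conditions: one differentiation of the
Killing equations suffices, followed by elimination and cancellation of `r`, `2` or `a ^ 2`. -/
lemma IsKilling.determining (ha : a ≠ 0) (h : IsKilling C a k ξ₁ ξ₂ ξ₃ ξ₄ η) :
    Determining C a k ξ₁ ξ₂ ξ₃ ξ₄ η := by
  have ha2 : a ^ 2 ≠ 0 := pow_ne_zero 2 ha
  have hd : ∀ (i : Fin 4) {f g : R}, f = g → C.D i f = C.D i g := fun i _ _ h => congrArg _ h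
  have h0_11 := hd 3 h.d11
  have h1_11 := hd 1 h.d11
  have h2_11 := hd 2 h.d11
  have h0_22 := hd 0 h.d22
  have h1_22 := hd 1 h.d22
  have h2_22 := hd 2 h.d22
  have h3_22 := hd 3 h.d22
  have h1_33 := hd 1 h.d33
  have h3_33 := hd 3 h.d33
  have h0_12 := hd 0 h.d12
  have h2_12 := hd 2 h.d12
  have h3_12 := hd 3 h.d12
  have h1_13 := hd 1 h.d13
  have h3_13 := hd 3 h.d13
  have h0_23 := hd 0 h.d23
  have h2_23 := hd 2 h.d23
  have h3_23 := hd 3 h.d23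
  have h0_14 := hd 0 h.d14
  have h1_14 := hd 1 h.d14
  have h2_14 := hd 2 h.d14
  have h0_24 := hd 0 h.d24
  have h1_24 := hd 1 h.d24
  have h2_24 := hd 2 h.d24
  have h0_34 := hd 0 h.d34
  have h1_34 := hd 1 h.d34
  have h2_34 := hd 2 h.d34
  simp only [map_add, Derivation.leibniz, Derivation.leibniz_pow, smul_eq_mul, map_zero, C.D_r,
    Derivation.map_algebraMap, C.comm10, C.comm20, C.comm30, C.comm21, C.comm31, C.comm32,
    Fin.isValue, Fin.reduceEq, if_true, if_false, one_ne_zero, nsmul_eq_mul, mul_zero,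
    Nat.cast_ofNat, Nat.add_one_sub_one, pow_one, mul_one, add_zero] at *
  refine ⟨h.u2, ?_, h.d33, h.u3, h.d44, h.u4, ?_, ?_, ?_, ?_, ?_, h.uu, h.e 0, h.d22, ?_, ?_, ?_,
    h.e 2, ?_, ?_, ?_, ?_, ?_, ?_, ?_, h.e 1, h.e5⟩
  · apply C.r_cancel; apply C.r_cancel
    linear_combination h2_23 - h1_33
  · apply algebraMap_cancel ha2
    linear_combination -h0_14 + h0_11
  · apply two_cancel; apply algebraMap_cancel ha2
    linear_combination -h2_24 - h1_34 + h3_23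
  · apply algebraMap_cancel ha2
    linear_combination -h2_34 + h3_33
  · apply two_cancel; apply algebraMap_cancel ha2
    linear_combination -h2_14 - h0_34 + h3_13
  · have := h.e 3
    rw [h.d44] at this
    exact two_cancel (by linear_combination this)
  · linear_combination h0_22 - h.d11
  · apply C.r_cancel; apply two_cancel
    linear_combination h0_23 - h1_13 + h2_12
  · apply C.r_cancel
    linear_combination h1_22 - h.d12
  · apply C.r_cancel
    linear_combination h0_12 - h1_11
  · linear_combination h.d13 - h2_22
  · linear_combination h.d23
  · linear_combination h.d34
  · apply two_cancel; apply algebraMap_cancel ha2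
    linear_combination -2 * h.d24 + C.r * h0_24 - C.r * h3_12 + C.r * h1_14
  · apply algebraMap_cancel ha2
    linear_combination -h1_24 + C.r * h3_22 - C.r * h.d14
  · linear_combination h.d24

/-- The list contains `ξ₁` only through `ξ₁ = -r ∂_x ξ₂`. Differentiating this relation in every
direction transfers the equations for `ξ₂` to the missing ones for `ξ₁`. -/
lemma Determining.isKilling (h : Determining C a k ξ₁ ξ₂ ξ₃ ξ₄ η) :
    IsKilling C a k ξ₁ ξ₂ ξ₃ ξ₄ η := by
  obtain ⟨u2, -, d33, u3, d44, u4, -, -, -, -, h11, uu, e0, d22, h15, h16, h17, e2, h19, h20, h21,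
    h22, h23, h24, h25, e1, e5⟩ := h
  have hd : ∀ (i : Fin 4) {f g : R}, f = g → C.D i f = C.D i g := fun i _ _ h => congrArg _ h
  have k0 := hd 0 d22
  have k1 := hd 1 d22
  have k2 := hd 2 d22
  have k3 := hd 3 d22
  have ku := congrArg C.Du d22
  have k25 := hd 1 h25
  simp only [map_add, map_sub, Derivation.leibniz, Derivation.leibniz_pow, smul_eq_mul, map_zero,
    C.D_r, C.Du_r, C.comm_u, u2,
    Derivation.map_algebraMap, C.comm21, C.comm31,
    Fin.isValue, Fin.reduceEq, if_true, if_false, one_ne_zero, nsmul_eq_mul, mul_zero,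
    Nat.cast_ofNat, Nat.add_one_sub_one, pow_one, mul_one, add_zero] at k0 k1 k2 k3 ku k25
  refine ⟨ku, u2, u3, u4, ?_, d22, d33, d44, ?_, ?_, ?_, ?_, ?_, ?_, uu, ?_, e5⟩
  · linear_combination k0 - h15
  · linear_combination k1 - C.r * h17
  · linear_combination k2 + h20
  · linear_combination h21
  -- `r ∂_t ξ₁ = -r² ∂_x ∂_t ξ₂ = -a² ∂_x² ξ₄ = a² r ∂_r ξ₄`.
  · apply sub_eq_zero.1; apply C.r_cancel
    linear_combination C.r * k3 - k25 - algebraMap ℝ R (a ^ 2) * h24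
  · linear_combination h25
  · linear_combination h22
  · intro i
    fin_cases i
    · exact e0
    · exact e1
    · exact e2
    · simp only [Fin.reduceFinMk, h11, d44]; ring

end systems
end Telegraph
end

/-! ### Vanishing of the conformal factor -/

noncomputable section
namespace Telegraph
set_option linter.unusedSimpArgs false

section systems

variable {R : Type*} [CommRing R] [Algebra ℝ R] {C : PolarCalculus R} {a : ℝ} (k : ℝ)
  {ξ₁ ξ₂ ξ₃ ξ₄ η : R}

/-- The telegraph operator on the components of a field of conformal type. -/
lemma IsConformalField.L_components (h : IsConformalField C a ξ₁ ξ₂ ξ₃ ξ₄) :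
    C.L a k ξ₁ = algebraMap ℝ R (a ^ 2) * (C.r ^ 2 * (2 * C.D 0 (C.D 3 ξ₄)
      + algebraMap ℝ R k * C.D 0 ξ₄) + ξ₁ - 2 * C.r * C.D 3 ξ₄) ∧
    C.L a k ξ₂ = algebraMap ℝ R (a ^ 2) * (2 * C.D 1 (C.D 3 ξ₄) + algebraMap ℝ R k * C.D 1 ξ₄) ∧
    C.L a k ξ₃ = algebraMap ℝ R (a ^ 2) * C.r ^ 2 * (2 * C.D 2 (C.D 3 ξ₄)
      + algebraMap ℝ R k * C.D 2 ξ₄) ∧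
    C.L a k ξ₄ = C.r ^ 2 * (-2 * C.D 3 (C.D 3 ξ₄) + algebraMap ℝ R k * C.D 3 ξ₄) := by
  obtain ⟨-, -, -, -, d11, d22, d33, d12, d13, d23, d14, d24, d34⟩ := h
  have hd : ∀ (i : Fin 4) {f g : R}, f = g → C.D i f = C.D i g := fun i _ _ h => congrArg _ h
  have h0_11 := hd 0 d11
  have h1_11 := hd 1 d11
  have h2_11 := hd 2 d11
  have h3_11 := hd 3 d11
  have h0_22 := hd 0 d22
  have h1_22 := hd 1 d22
  have h2_22 := hd 2 d22
  have h3_22 := hd 3 d22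
  have h0_33 := hd 0 d33
  have h1_33 := hd 1 d33
  have h2_33 := hd 2 d33
  have h3_33 := hd 3 d33
  have h0_12 := hd 0 d12
  have h1_12 := hd 1 d12
  have h0_13 := hd 0 d13
  have h2_13 := hd 2 d13
  have h1_23 := hd 1 d23
  have h2_23 := hd 2 d23
  have h0_14 := hd 0 d14
  have h3_14 := hd 3 d14
  have h1_24 := hd 1 d24
  have h3_24 := hd 3 d24
  have h2_34 := hd 2 d34
  have h3_34 := hd 3 d34
  simp only [PolarCalculus.L]
  simp only [map_add, map_sub, Derivation.leibniz, Derivation.leibniz_pow, smul_eq_mul, map_zero,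
    C.D_r, Derivation.map_algebraMap, C.comm10, C.comm20, C.comm30, C.comm21, C.comm31, C.comm32,
    Fin.isValue, Fin.reduceEq, if_true, if_false, one_ne_zero, nsmul_eq_mul, mul_zero, zero_add,
    Nat.cast_ofNat, Nat.add_one_sub_one, pow_one, mul_one, add_zero] at *
  -- This is the flat identity `□ ξ_j = (2 - n) ∂_j f` with `n = 4`, in polar form: each `∂_i² ξ_j`
  -- is traded for `∂_j ∂_i ξ_i` by an off-diagonal equation, and the diagonal equations turn the
  -- latter into `∂_j f`.
  refine ⟨?_, ?_, ?_, ?_⟩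
  · linear_combination C.r ^ 2 * h3_14 + algebraMap ℝ R k * C.r ^ 2 * d14
      - algebraMap ℝ R (a ^ 2) * (C.r ^ 2 * h0_11 + C.r * d11 + h1_12 - C.r * h0_22 + C.r * d11
        + d22 + C.r ^ 2 * (h2_13 - h0_33))
  · apply sub_eq_zero.1; apply C.r_cancel
    linear_combination C.r * h3_24 + algebraMap ℝ R k * C.r * d24
      - algebraMap ℝ R (a ^ 2) * (C.r * (h0_12 - h1_11) + h1_22 - d12 + C.r * (h2_23 - h1_33))
  · linear_combination C.r ^ 2 * h3_34 + algebraMap ℝ R k * C.r ^ 2 * d34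
      - algebraMap ℝ R (a ^ 2) * (C.r ^ 2 * h2_33 + C.r ^ 2 * (h0_13 - h2_11) + h1_23
        - C.r * h2_22 + C.r * d13)
  · linear_combination C.r ^ 2 * h0_14 - C.r ^ 2 * h3_11 + h1_24 - C.r * h3_22 + C.r * d14
      + C.r ^ 2 * h2_34 - C.r ^ 2 * h3_33

/-- The factor `f` of a flat conformal field in dimension at least three is affine. Only `f_tt = 0`
and the undamped wave equation for `f` are extracted here, so that the damping term is all that
remains of `L f`. -/
lemma IsConformalField.L_factor (h : IsConformalField C a ξ₁ ξ₂ ξ₃ ξ₄) :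
    C.L a k (C.D 3 ξ₄) = algebraMap ℝ R k * C.r ^ 2 * C.D 3 (C.D 3 ξ₄) := by
  obtain ⟨-, -, -, -, d11, d22, d33, d12, d13, d23, d14, d24, d34⟩ := h
  have hd : ∀ (i : Fin 4) {f g : R}, f = g → C.D i f = C.D i g := fun i _ _ h => congrArg _ h
  have h00_33 := hd 0 (hd 0 d33)
  have h33_33 := hd 3 (hd 3 d33)
  have h33_11 := hd 3 (hd 3 d11)
  have h22_11 := hd 2 (hd 2 d11)
  have h33_22 := hd 3 (hd 3 d22)
  have h02_13 := hd 0 (hd 2 d13)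
  have h03_14 := hd 0 (hd 3 d14)
  have h13_24 := hd 1 (hd 3 d24)
  have h23_34 := hd 2 (hd 3 d34)
  have h3_14 := hd 3 d14
  simp only [PolarCalculus.L]
  simp only [map_add, map_sub, Derivation.leibniz, Derivation.leibniz_pow, smul_eq_mul, map_zero,
    C.D_r, Derivation.map_algebraMap, C.comm10, C.comm20, C.comm30, C.comm21, C.comm31, C.comm32,
    Fin.isValue, Fin.reduceEq, if_true, if_false, one_ne_zero, nsmul_eq_mul, mul_zero, zero_add,
    Nat.cast_ofNat, Nat.add_one_sub_one, pow_one, mul_one, add_zero] at *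
  -- In the `(r, y, t)` block, `f_tt = a² f_rr = a² f_yy`, whereas `f_rr + f_yy = 0`.
  have htt : C.D 3 (C.D 3 (C.D 3 ξ₄)) = 0 := by
    apply two_cancel
    linear_combination -h33_11 + h03_14 - h33_33 + h23_34
      + algebraMap ℝ R (a ^ 2) * (h02_13 - h22_11 - h00_33)
  linear_combination h13_24 - C.r * h33_22 + C.r * h3_14
    + C.r ^ 2 * (-h33_11 + h03_14 - h33_33 + h23_34) - 2 * C.r ^ 2 * htt

lemma PolarCalculus.Du_L (f : R) : C.Du (C.L a k f) = C.L a k (C.Du f) := by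
  simp only [PolarCalculus.L, map_add, map_sub, Derivation.leibniz, Derivation.leibniz_pow,
    smul_eq_mul, Derivation.map_algebraMap, C.Du_r, C.comm_u, nsmul_eq_mul, mul_zero, add_zero]

lemma PolarCalculus.L_add (f g : R) : C.L a k (f + g) = C.L a k f + C.L a k g := by
  simp only [PolarCalculus.L, map_add]; ring

lemma PolarCalculus.L_algebraMap_mul (c : ℝ) (f : R) :
    C.L a k (algebraMap ℝ R c * f) = algebraMap ℝ R c * C.L a k f := by
  simp only [PolarCalculus.L, Derivation.leibniz, smul_eq_mul, Derivation.map_algebraMap, mul_zero,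
    add_zero]
  ring

lemma PolarCalculus.L_eq_zero {f : R} (h : ∀ i, C.D i f = 0) : C.L a k f = 0 := by
  simp only [PolarCalculus.L, h, map_zero]; ring

variable {k}

/-- Compatibility of the gradient equations for `η_u` with `L η_u = 0` forces `k² r² f = 0`. For `k
= 0` this argument gives nothing, in accordance with the larger conformal symmetry of the wave
equation. -/
lemma IsConformal.factor_eq_zero (ha : a ≠ 0) (hk : k ≠ 0)
    (h : IsConformal C a k ξ₁ ξ₂ ξ₃ ξ₄ η) :
    C.D 3 ξ₄ = 0 ∧ ∀ i, algebraMap ℝ R k * C.D i ξ₄ + 2 * C.D i (C.Du η) = 0 := by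
  have ha2 : a ^ 2 ≠ 0 := pow_ne_zero 2 ha
  obtain ⟨l1, l2, l3, l4⟩ := h.L_components k
  -- Comparing `e1`–`e4` with `L_components`, the two expressions for `L ξ_i` agree exactly when `2
  -- η_u + 2 f + k ξ₄` has zero gradient.
  have F : ∀ i, C.D i (algebraMap ℝ R 2 * C.Du η + (algebraMap ℝ R 2 * C.D 3 ξ₄
      + algebraMap ℝ R k * ξ₄)) = 0 := by
    intro i
    simp only [map_add, Derivation.leibniz, smul_eq_mul, Derivation.map_algebraMap, mul_zero,
      add_zero]
    rw [map_ofNat]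
    match i with
    | 0 =>
      apply C.r_cancel; apply C.r_cancel; apply algebraMap_cancel ha2
      linear_combination -h.e1 - l1
    | 1 =>
      apply algebraMap_cancel ha2
      linear_combination -h.e2 - l2
    | 2 =>
      apply C.r_cancel; apply C.r_cancel; apply algebraMap_cancel ha2
      linear_combination -h.e3 - l3
    | 3 =>
      apply C.r_cancel; apply C.r_cancel
      linear_combination h.e4 + l4
  have hL : C.L a k (C.Du η) = 0 := by
    rw [← PolarCalculus.Du_L, h.e5, map_zero]
  have hF := C.L_eq_zero (a := a) k F
  -- The terms `2 k r² f_t` from `2 L f` and `-2 k r² f_t` from `k L ξ₄` cancel, leaving `k² r² f`.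
  rw [C.L_add, C.L_add, C.L_algebraMap_mul, C.L_algebraMap_mul, C.L_algebraMap_mul, hL, l4,
    h.L_factor k, map_ofNat] at hF
  have hf : C.D 3 ξ₄ = 0 := by
    apply C.r_cancel; apply C.r_cancel; apply algebraMap_cancel hk; apply algebraMap_cancel hk
    linear_combination hF
  refine ⟨hf, fun i => ?_⟩
  have := F i
  simp only [hf, map_add, Derivation.leibniz, smul_eq_mul, Derivation.map_algebraMap, mul_zero,
    map_zero, add_zero, zero_add] at this
  rw [map_ofNat] at this
  linear_combination this

lemma isConformal_iff_isKilling (ha : a ≠ 0) (hk : k ≠ 0) :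
    IsConformal C a k ξ₁ ξ₂ ξ₃ ξ₄ η ↔ IsKilling C a k ξ₁ ξ₂ ξ₃ ξ₄ η := by
  constructor
  · intro h
    obtain ⟨hf, e⟩ := h.factor_eq_zero ha hk
    exact ⟨h.u1, h.u2, h.u3, h.u4, h.d11.trans hf, by rw [h.d22, hf, mul_zero], h.d33.trans hf, hf,
      h.d12, h.d13, h.d23, h.d14, h.d24, h.d34, h.uu, e, h.e5⟩
  · intro h
    have hc : IsConformalField C a ξ₁ ξ₂ ξ₃ ξ₄ :=
      ⟨h.u1, h.u2, h.u3, h.u4, h.d11.trans h.d44.symm, by rw [h.d22, h.d44, mul_zero],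
        h.d33.trans h.d44.symm, h.d12, h.d13, h.d23, h.d14, h.d24, h.d34⟩
    obtain ⟨l1, l2, l3, l4⟩ := hc.L_components k
    simp only [h.d44, map_zero, mul_zero, sub_zero, zero_add] at l1 l2 l3 l4
    refine ⟨hc, h.uu, ?_, ?_, ?_, ?_, h.e5⟩
    · rw [h.d44]
      linear_combination -l1 - algebraMap ℝ R (a ^ 2) * C.r ^ 2 * h.e 0
    · linear_combination -l2 - algebraMap ℝ R (a ^ 2) * h.e 1
    · linear_combination -l3 - algebraMap ℝ R (a ^ 2) * C.r ^ 2 * h.e 2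
    · have := h.e 3
      rw [h.d44] at this ⊢
      linear_combination -l4 + C.r ^ 2 * this

lemma isKilling_iff_determining (ha : a ≠ 0) :
    IsKilling C a k ξ₁ ξ₂ ξ₃ ξ₄ η ↔ Determining C a k ξ₁ ξ₂ ξ₃ ξ₄ η :=
  ⟨fun h => h.determining ha, fun h => h.isKilling⟩

end systems
end Telegraph
end

/-! ### Cartesian derivations and the flat Killing equation -/

noncomputable section
namespace Telegraph
set_option linter.unusedSimpArgs false

/-- Killing fields for a constant metric are affine. -/
lemma killing_second_deriv {R ι : Type*} [CommRing R] [Algebra ℝ R] (d : ι → Derivation ℝ R R)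
    (ζ : ι → R) (hcomm : ∀ i j f, d i (d j f) = d j (d i f))
    (h : ∀ i j, d i (ζ j) + d j (ζ i) = 0) (i j l : ι) : d i (d j (ζ l)) = 0 := by
  -- `d i (d j (ζ l))` is symmetric in `i, j` and, by `e`, skew in `j, l`; alternating the two
  -- symmetries gives the tensor equal to its negative.
  have e (i j l) : d i (d j (ζ l)) + d i (d l (ζ j)) = 0 := by rw [← map_add, h, map_zero]
  apply two_cancel
  linear_combination e i j l - hcomm i l (ζ j) - e l i j + hcomm l j (ζ i) + e j l i
    - hcomm j i (ζ l)

section systems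

variable {R : Type*} [CommRing R] [Algebra ℝ R] (C : PolarCalculus R)

/-- The derivations with respect to `r cos x`, `r sin x`, `y` and `t`. -/
def PolarCalculus.cart (C : PolarCalculus R) : Fin 4 → Derivation ℝ R R :=
  ![C.cs • C.D 0 - (C.sn * C.ri) • C.D 1, C.sn • C.D 0 + (C.cs * C.ri) • C.D 1, C.D 2, C.D 3]

lemma PolarCalculus.cart0 (f : R) : C.cart 0 f = C.cs * C.D 0 f - C.sn * C.ri * C.D 1 f := rfl
lemma PolarCalculus.cart1 (f : R) : C.cart 1 f = C.sn * C.D 0 f + C.cs * C.ri * C.D 1 f := rfl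
lemma PolarCalculus.cart2 (f : R) : C.cart 2 f = C.D 2 f := rfl
lemma PolarCalculus.cart3 (f : R) : C.cart 3 f = C.D 3 f := rfl

lemma fin_four_symm_induction {P : Fin 4 → Fin 4 → Prop} (hs : ∀ i j, P i j → P j i)
    (hd : ∀ i, P i i) (h01 : P 0 1) (h02 : P 0 2) (h03 : P 0 3) (h12 : P 1 2) (h13 : P 1 3)
    (h23 : P 2 3) (i j : Fin 4) : P i j := by
  fin_cases i <;> fin_cases j <;> first | exact hd _ | assumption | (apply hs; assumption)

lemma PolarCalculus.cart_comm (i j : Fin 4) (f : R) :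
    C.cart i (C.cart j f) = C.cart j (C.cart i f) := by
  refine fin_four_symm_induction (P := fun i j => C.cart i (C.cart j f) = C.cart j (C.cart i f))
    (fun i j => Eq.symm) (fun i => rfl) ?_ ?_ ?_ ?_ ?_ (C.comm _ _ _) i j
  · simp only [C.cart0, C.cart1, map_add, map_sub, Derivation.leibniz, smul_eq_mul, C.D_r, C.D_ri,
      C.D_cs, C.D_sn, C.comm10, Fin.isValue, Fin.reduceEq, if_true, if_false, one_ne_zero,
      zero_ne_one]
    ring
  · simp only [C.cart0, C.cart2, map_add, map_sub, Derivation.leibniz, smul_eq_mul, C.D_r, C.D_ri,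
      C.D_cs, C.D_sn, C.comm20, C.comm21, Fin.isValue, Fin.reduceEq, if_true, if_false, one_ne_zero,
      zero_ne_one]
    ring
  · simp only [C.cart0, C.cart3, map_add, map_sub, Derivation.leibniz, smul_eq_mul, C.D_r, C.D_ri,
      C.D_cs, C.D_sn, C.comm30, C.comm31, Fin.isValue, Fin.reduceEq, if_true, if_false, one_ne_zero,
      zero_ne_one]
    ring
  · simp only [C.cart1, C.cart2, map_add, map_sub, Derivation.leibniz, smul_eq_mul, C.D_r, C.D_ri,
      C.D_cs, C.D_sn, C.comm20, C.comm21, Fin.isValue, Fin.reduceEq, if_true, if_false, one_ne_zero,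
      zero_ne_one]
    ring
  · simp only [C.cart1, C.cart3, map_add, map_sub, Derivation.leibniz, smul_eq_mul, C.D_r, C.D_ri,
      C.D_cs, C.D_sn, C.comm30, C.comm31, Fin.isValue, Fin.reduceEq, if_true, if_false, one_ne_zero,
      zero_ne_one]
    ring

lemma PolarCalculus.Du_cart (i : Fin 4) (f : R) : C.Du (C.cart i f) = C.cart i (C.Du f) := by
  match i with
  | 0 => simp only [C.cart0, map_sub, Derivation.leibniz, smul_eq_mul, C.Du_ri, C.Du_cs, C.Du_sn,
      C.comm_u, mul_zero, add_zero]
  | 1 => simp only [C.cart1, map_add, Derivation.leibniz, smul_eq_mul, C.Du_ri, C.Du_cs, C.Du_sn,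
      C.comm_u, mul_zero, add_zero]
  | 2 => exact C.comm_u _ _
  | 3 => exact C.comm_u _ _

/-- The rotation of the frame is invertible, by `cs ^ 2 + sn ^ 2 = 1` and `r * ri = 1`, so the polar
derivations are recovered from the Cartesian ones. -/
lemma PolarCalculus.exists_const_of_cart {f : R} (h : ∀ i, C.cart i f = 0) (hu : C.Du f = 0) :
    ∃ c : ℝ, f = algebraMap ℝ R c := by
  have h0 := h 0
  have h1 := h 1
  rw [C.cart0] at h0
  rw [C.cart1] at h1
  refine C.exists_const f (fun i => ?_) hu
  match i with
  | 0 => linear_combination C.cs * h0 + C.sn * h1 - C.D 0 f * C.cs_sq_add_sn_sq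
  | 1 => linear_combination C.r * (-C.sn * h0 + C.cs * h1) - C.D 1 f * C.cs_sq_add_sn_sq
      - C.D 1 f * (C.cs ^ 2 + C.sn ^ 2) * C.r_mul_ri
  | 2 => exact h 2
  | 3 => exact h 3

/-- The factor `2` is the normalisation of the `∂_t` components of the boosts `v₅`, `v₁₀`, `v₁₁`,
and of `2 η_u + k ξ₄`. -/
lemma PolarCalculus.exists_two_mul_const_of_cart {f : R} (h : ∀ i, C.cart i f = 0)
    (hu : C.Du f = 0) : ∃ c : ℝ, f = 2 * algebraMap ℝ R c := by
  obtain ⟨c, hc⟩ := C.exists_const_of_cart h hu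
  refine ⟨c / 2, ?_⟩
  rw [hc, ← map_ofNat (algebraMap ℝ R), ← map_mul, mul_div_cancel₀ _ two_ne_zero]

/-- The vector with components
`r cos x * ... ` of a field in the coordinates `(r cos x, r sin x, y, t)`, the last one lowered. -/
def PolarCalculus.lower (a : ℝ) (ξ₁ ξ₂ ξ₃ ξ₄ : R) : Fin 4 → R :=
  ![C.cs * ξ₁ - C.r * C.sn * ξ₂, C.sn * ξ₁ + C.r * C.cs * ξ₂, ξ₃, -(algebraMap ℝ R (a ^ 2) * ξ₄)]

variable {C} {a k : ℝ} {ξ₁ ξ₂ ξ₃ ξ₄ η : R}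

lemma PolarCalculus.lower0 : C.lower a ξ₁ ξ₂ ξ₃ ξ₄ 0 = C.cs * ξ₁ - C.r * C.sn * ξ₂ := rfl
lemma PolarCalculus.lower1 : C.lower a ξ₁ ξ₂ ξ₃ ξ₄ 1 = C.sn * ξ₁ + C.r * C.cs * ξ₂ := rfl
lemma PolarCalculus.lower2 : C.lower a ξ₁ ξ₂ ξ₃ ξ₄ 2 = ξ₃ := rfl
lemma PolarCalculus.lower3 : C.lower a ξ₁ ξ₂ ξ₃ ξ₄ 3 = -(algebraMap ℝ R (a ^ 2) * ξ₄) := rfl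

/-- The Killing operator is tensorial: each Cartesian equation is the combination of polar equations
given by the frame coefficients. The minus sign and the factor `a ^ 2` in the last lowered component
come from the metric coefficient `-a ^ 2` of `dt²`. -/
lemma IsKilling.cart_lower (h : IsKilling C a k ξ₁ ξ₂ ξ₃ ξ₄ η) (i j : Fin 4) :
    C.cart i (C.lower a ξ₁ ξ₂ ξ₃ ξ₄ j) + C.cart j (C.lower a ξ₁ ξ₂ ξ₃ ξ₄ i) = 0 := by
  have hr := C.r_mul_ri
  have hr2 : C.r ^ 2 * C.ri = C.r := by linear_combination C.r * hr
  obtain ⟨u1, u2, u3, u4, d11, d22, d33, d44, d12, d13, d23, d14, d24, d34, -, -, -⟩ := h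
  revert i j
  apply fin_four_symm_induction
  · intro i j h
    rw [add_comm, h]
  · intro i
    match i with
    | 0 =>
      simp only [C.cart0, C.lower0, map_add, map_sub, map_neg,
      Derivation.leibniz, smul_eq_mul, C.D_r, C.D_cs, C.D_sn, Derivation.map_algebraMap,
          Fin.isValue,
      Fin.reduceEq, if_true, if_false, one_ne_zero, zero_ne_one]
      linear_combination 2 * (C.cs ^ 2 * d11 - C.cs * C.sn * C.ri * d12 + C.sn ^ 2 * C.ri * d22
        + C.cs * C.sn * C.D 0 ξ₂ * hr2 + C.cs * C.sn * ξ₂ * hr)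
    | 1 =>
      simp only [C.cart1, C.lower1, map_add, map_sub, map_neg,
      Derivation.leibniz, smul_eq_mul, C.D_r, C.D_cs, C.D_sn, Derivation.map_algebraMap,
          Fin.isValue,
      Fin.reduceEq, if_true, if_false, one_ne_zero, zero_ne_one]
      linear_combination 2 * (C.sn ^ 2 * d11 + C.cs * C.sn * C.ri * d12 + C.cs ^ 2 * C.ri * d22
        - C.cs * C.sn * C.D 0 ξ₂ * hr2 - C.cs * C.sn * ξ₂ * hr)
    | 2 =>
      simp only [C.lower2, C.cart2]
      linear_combination 2 * d33
    | 3 =>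
      simp only [C.cart3, C.lower3, map_add, map_sub, map_neg,
      Derivation.leibniz, smul_eq_mul, C.D_r, C.D_cs, C.D_sn, Derivation.map_algebraMap,
          Fin.isValue,
      Fin.reduceEq, if_true, if_false, one_ne_zero, zero_ne_one]
      linear_combination -2 * algebraMap ℝ R (a ^ 2) * d44
  · simp only [C.cart0, C.lower0, C.cart1, C.lower1, map_add, map_sub, map_neg,
      Derivation.leibniz, smul_eq_mul, C.D_r, C.D_cs, C.D_sn, Derivation.map_algebraMap,
          Fin.isValue,
      Fin.reduceEq, if_true, if_false, one_ne_zero, zero_ne_one]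
    linear_combination 2 * C.cs * C.sn * (d11 - C.ri * d22) + (C.cs ^ 2 - C.sn ^ 2) * (C.ri * d12
      - C.D 0 ξ₂ * hr2 - ξ₂ * hr)
  · simp only [C.cart0, C.lower0, C.cart2, C.lower2, map_add, map_sub, map_neg,
      Derivation.leibniz, smul_eq_mul, C.D_r, C.D_cs, C.D_sn, Derivation.map_algebraMap,
          Fin.isValue,
      Fin.reduceEq, if_true, if_false, one_ne_zero, zero_ne_one]
    linear_combination C.cs * d13 - C.sn * C.ri * d23 + C.sn * C.D 2 ξ₂ * hr2
  · simp only [C.cart0, C.lower0, C.cart3, C.lower3, map_add, map_sub, map_neg,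
      Derivation.leibniz, smul_eq_mul, C.D_r, C.D_cs, C.D_sn, Derivation.map_algebraMap,
          Fin.isValue,
      Fin.reduceEq, if_true, if_false, one_ne_zero, zero_ne_one]
    linear_combination C.cs * d14 - C.sn * C.ri * d24 + C.sn * C.D 3 ξ₂ * hr2
  · simp only [C.cart1, C.lower1, C.cart2, C.lower2, map_add, map_sub, map_neg,
      Derivation.leibniz, smul_eq_mul, C.D_r, C.D_cs, C.D_sn, Derivation.map_algebraMap,
          Fin.isValue,
      Fin.reduceEq, if_true, if_false, one_ne_zero, zero_ne_one]
    linear_combination C.sn * d13 + C.cs * C.ri * d23 - C.cs * C.D 2 ξ₂ * hr2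
  · simp only [C.cart1, C.lower1, C.cart3, C.lower3, map_add, map_sub, map_neg,
      Derivation.leibniz, smul_eq_mul, C.D_r, C.D_cs, C.D_sn, Derivation.map_algebraMap,
          Fin.isValue,
      Fin.reduceEq, if_true, if_false, one_ne_zero, zero_ne_one]
    linear_combination C.sn * d14 + C.cs * C.ri * d24 - C.cs * C.D 3 ξ₂ * hr2
  · simp only [C.cart2, C.lower2, C.cart3, C.lower3, map_add, map_sub, map_neg,
      Derivation.leibniz, smul_eq_mul, C.D_r, C.D_cs, C.D_sn, Derivation.map_algebraMap,
          Fin.isValue,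
      Fin.reduceEq, if_true, if_false, one_ne_zero, zero_ne_one]
    linear_combination d34

end systems
end Telegraph
end

/-! ### Integration of the Killing equations -/

noncomputable section
namespace Telegraph
set_option linter.unusedSimpArgs false

section systems

variable {R : Type*} [CommRing R] [Algebra ℝ R] (C : PolarCalculus R) (a k : ℝ)
  (ξ₁ ξ₂ ξ₃ ξ₄ η : R)

/-- The components are those of a linear combination of the eleven generators and a field
`β ∂_u` with `β` a solution. -/
def IsCombination (c : Fin 11 → R) (β : R) : Prop :=
  ξ₁ = c 5 * C.sn - c 6 * C.cs - c 7 * C.y * C.cs - c 8 * C.y * C.sn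
    + 2 * algebraMap ℝ R (a ^ 2) * C.t * (c 9 * C.sn - c 10 * C.cs) ∧
  ξ₂ = c 0 + C.ri * (c 5 * C.cs + c 6 * C.sn + c 7 * C.y * C.sn - c 8 * C.y * C.cs
    + 2 * algebraMap ℝ R (a ^ 2) * C.t * (c 9 * C.cs + c 10 * C.sn)) ∧
  ξ₃ = c 1 + 2 * algebraMap ℝ R (a ^ 2) * c 4 * C.t + C.r * (c 7 * C.cs + c 8 * C.sn) ∧
  ξ₄ = c 2 + 2 * c 4 * C.y + 2 * C.r * (c 9 * C.sn - c 10 * C.cs) ∧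
  η = C.u * (c 3 - algebraMap ℝ R k * (c 4 * C.y + C.r * (c 9 * C.sn - c 10 * C.cs))) + β

variable {C a k ξ₁ ξ₂ ξ₃ ξ₄ η}

lemma PolarCalculus.cart_algebraMap_mul (i : Fin 4) (c : ℝ) (f : R) :
    C.cart i (algebraMap ℝ R c * f) = algebraMap ℝ R c * C.cart i f := by
  rw [Derivation.leibniz, Derivation.map_algebraMap, smul_zero, add_zero, smul_eq_mul]

lemma PolarCalculus.Du_algebraMap_mul (c : ℝ) (f : R) :
    C.Du (algebraMap ℝ R c * f) = algebraMap ℝ R c * C.Du f := by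
  rw [Derivation.leibniz, Derivation.map_algebraMap, smul_zero, add_zero, smul_eq_mul]

lemma PolarCalculus.cart_X (i : Fin 4) : C.cart i (C.r * C.cs) = if i = 0 then 1 else 0 := by
  match i with
  | 0 =>
    simp [C.cart0, C.D_r, C.D_cs]
    linear_combination C.cs_sq_add_sn_sq + C.sn ^ 2 * C.r_mul_ri
  | 1 =>
    simp [C.cart1, C.D_r, C.D_cs]
    linear_combination -C.cs * C.sn * C.r_mul_ri
  | 2 => simp [C.cart2, C.D_r, C.D_cs]
  | 3 => simp [C.cart3, C.D_r, C.D_cs]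

lemma PolarCalculus.cart_Y (i : Fin 4) : C.cart i (C.r * C.sn) = if i = 1 then 1 else 0 := by
  match i with
  | 0 =>
    simp [C.cart0, C.D_r, C.D_sn]
    linear_combination -C.cs * C.sn * C.r_mul_ri
  | 1 =>
    simp [C.cart1, C.D_r, C.D_sn]
    linear_combination C.cs_sq_add_sn_sq + C.cs ^ 2 * C.r_mul_ri
  | 2 => simp [C.cart2, C.D_r, C.D_sn]
  | 3 => simp [C.cart3, C.D_r, C.D_sn]

lemma PolarCalculus.cart_y (i : Fin 4) : C.cart i C.y = if i = 2 then 1 else 0 := by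
  match i with
  | 0 => simp [C.cart0, C.D_y]
  | 1 => simp [C.cart1, C.D_y]
  | 2 => simp [C.cart2, C.D_y]
  | 3 => simp [C.cart3, C.D_y]

lemma PolarCalculus.cart_t (i : Fin 4) : C.cart i C.t = if i = 3 then 1 else 0 := by
  match i with
  | 0 => simp [C.cart0, C.D_t]
  | 1 => simp [C.cart1, C.D_t]
  | 2 => simp [C.cart2, C.D_t]
  | 3 => simp [C.cart3, C.D_t]

lemma PolarCalculus.L_u_mul (f : R) : C.L a k (C.u * f) = C.u * C.L a k f := by
  simp only [PolarCalculus.L, Derivation.leibniz, smul_eq_mul, C.D_u, mul_zero, add_zero]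
  ring

/-- Six constants describe the skew matrix of first derivatives. Subtracting the linear part it
generates from each component leaves the four translation constants, and `2 η_u + k ξ₄` supplies the
last one. -/
lemma IsKilling.exists_isCombination (ha : a ≠ 0) (h : IsKilling C a k ξ₁ ξ₂ ξ₃ ξ₄ η) :
    ∃ c : Fin 11 → ℝ, ∃ β, C.Du β = 0 ∧ C.L a k β = 0 ∧
      IsCombination C a k ξ₁ ξ₂ ξ₃ ξ₄ η (fun i => algebraMap ℝ R (c i)) β := by
  have ha2 : a ^ 2 ≠ 0 := pow_ne_zero 2 ha
  have hζ := h.cart_lower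
  have hdd := killing_second_deriv C.cart (C.lower a ξ₁ ξ₂ ξ₃ ξ₄) C.cart_comm hζ
  have hu1 : C.Du (C.lower a ξ₁ ξ₂ ξ₃ ξ₄ 0) = 0 := by
    simp only [C.lower0, map_sub, Derivation.leibniz, smul_eq_mul, C.Du_r, C.Du_cs, C.Du_sn, h.u1,
      h.u2, mul_zero, add_zero, sub_zero]
  have hu2 : C.Du (C.lower a ξ₁ ξ₂ ξ₃ ξ₄ 1) = 0 := by
    simp only [C.lower1, map_add, Derivation.leibniz, smul_eq_mul, C.Du_r, C.Du_cs, C.Du_sn, h.u1,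
      h.u2, mul_zero, add_zero]
  have hdu (i : Fin 4) {f : R} (hf : C.Du f = 0) : C.Du (C.cart i f) = 0 := by
    rw [C.Du_cart, hf, map_zero]
  have h4 (i j : Fin 4) : C.cart i (C.cart j ξ₄) = 0 := by
    apply algebraMap_cancel ha2
    have := hdd i j 3
    simp only [C.lower3, map_neg, Derivation.leibniz, smul_eq_mul, Derivation.map_algebraMap,
      mul_zero, add_zero] at this
    linear_combination -this
  -- The independent entries of the skew matrix: `c0`, `c7`, `c8` for the spatial rotations, `c10`,
  -- `c9`, `c4` for the boosts along `X`, `Y`, `y`.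
  obtain ⟨c0, h0⟩ := C.exists_const_of_cart (fun i => hdd i 0 1) (hdu 0 hu2)
  obtain ⟨c7, h7⟩ := C.exists_const_of_cart (fun i => hdd i 0 2) (hdu 0 h.u3)
  obtain ⟨c8, h8⟩ := C.exists_const_of_cart (fun i => hdd i 1 2) (hdu 1 h.u3)
  obtain ⟨c10, h10⟩ := C.exists_two_mul_const_of_cart (f := -C.cart 0 ξ₄)
    (fun i => by rw [map_neg, h4, neg_zero]) (by rw [map_neg, hdu 0 h.u4, neg_zero])
  obtain ⟨c9, h9⟩ := C.exists_two_mul_const_of_cart (fun i => h4 i 1) (hdu 1 h.u4)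
  obtain ⟨c4, h44⟩ := C.exists_two_mul_const_of_cart (fun i => h4 i 2) (hdu 2 h.u4)
  have e00 := hζ 0 0
  have e01 := hζ 0 1
  have e02 := hζ 0 2
  have e03 := hζ 0 3
  have e11 := hζ 1 1
  have e12 := hζ 1 2
  have e13 := hζ 1 3
  have e22 := hζ 2 2
  have e23 := hζ 2 3
  have e33 := hζ 3 3
  simp only [C.lower2, C.lower3, map_neg, C.cart_algebraMap_mul] at e02 e03 e12 e13 e22 e23 h7 h8
  -- The overall sign is there because `v₇` is `-∂_X`; `v₆` below is `∂_Y`.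
  obtain ⟨c6, h6⟩ := C.exists_const_of_cart (f := -(C.lower a ξ₁ ξ₂ ξ₃ ξ₄ 0
      + algebraMap ℝ R c0 * (C.r * C.sn) + algebraMap ℝ R c7 * C.y
      + algebraMap ℝ R (a ^ 2) * (algebraMap ℝ R 2 * (algebraMap ℝ R c10 * C.t))))
    (fun i => by
      simp only [map_add, map_neg, C.cart_algebraMap_mul, C.cart_Y, C.cart_y, C.cart_t]
      rw [map_ofNat]
      match i with
      | 0 => exact two_cancel (by simp [-map_pow]; linear_combination e00)
      | 1 => simp [-map_pow]; linear_combination -e01 + h0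
      | 2 => simp [-map_pow]; linear_combination -e02 + h7
      | 3 => simp [-map_pow]; linear_combination -e03 + algebraMap ℝ R (a ^ 2) * h10)
    (by
      simp only [map_add, map_neg, C.Du_algebraMap_mul, Derivation.leibniz, smul_eq_mul, hu1,
        C.Du_r, C.Du_sn, C.Du_y, C.Du_t]
      ring)
  obtain ⟨c5, h5⟩ := C.exists_const_of_cart (f := C.lower a ξ₁ ξ₂ ξ₃ ξ₄ 1
      - algebraMap ℝ R c0 * (C.r * C.cs) + algebraMap ℝ R c8 * C.y
      - algebraMap ℝ R (a ^ 2) * (algebraMap ℝ R 2 * (algebraMap ℝ R c9 * C.t)))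
    (fun i => by
      simp only [map_add, map_sub, C.cart_algebraMap_mul, C.cart_X, C.cart_y, C.cart_t]
      rw [map_ofNat]
      match i with
      | 0 => simp [-map_pow]; linear_combination h0
      | 1 => exact two_cancel (by simp [-map_pow]; linear_combination e11)
      | 2 => simp [-map_pow]; linear_combination e12 - h8
      | 3 => simp [-map_pow]; linear_combination e13 + algebraMap ℝ R (a ^ 2) * h9)
    (by
      simp only [map_add, map_sub, C.Du_algebraMap_mul, Derivation.leibniz, smul_eq_mul, hu2,
        C.Du_r, C.Du_cs, C.Du_y, C.Du_t]
      ring)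
  obtain ⟨c1, h1⟩ := C.exists_const_of_cart (f := ξ₃
      - algebraMap ℝ R c7 * (C.r * C.cs) - algebraMap ℝ R c8 * (C.r * C.sn)
      - algebraMap ℝ R (a ^ 2) * (algebraMap ℝ R 2 * (algebraMap ℝ R c4 * C.t)))
    (fun i => by
      simp only [map_sub, C.cart_algebraMap_mul, C.cart_X, C.cart_Y, C.cart_t]
      rw [map_ofNat]
      match i with
      | 0 => simp [-map_pow]; linear_combination h7
      | 1 => simp [-map_pow]; linear_combination h8
      | 2 => exact two_cancel (by simp [-map_pow]; linear_combination e22)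
      | 3 => simp [-map_pow]; linear_combination e23 + algebraMap ℝ R (a ^ 2) * h44)
    (by
      simp only [map_sub, C.Du_algebraMap_mul, Derivation.leibniz, smul_eq_mul, h.u3,
        C.Du_r, C.Du_cs, C.Du_sn, C.Du_t]
      ring)
  obtain ⟨c2, h2⟩ := C.exists_const_of_cart (f := ξ₄
      + algebraMap ℝ R 2 * (algebraMap ℝ R c10 * (C.r * C.cs))
      - algebraMap ℝ R 2 * (algebraMap ℝ R c9 * (C.r * C.sn))
      - algebraMap ℝ R 2 * (algebraMap ℝ R c4 * C.y))
    (fun i => by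
      simp only [map_sub, map_add, C.cart_algebraMap_mul, C.cart_X, C.cart_Y, C.cart_y]
      rw [map_ofNat]
      match i with
      | 0 => simp [-map_pow]; linear_combination -h10
      | 1 => simp [-map_pow]; linear_combination h9
      | 2 => simp [-map_pow]; linear_combination h44
      | 3 => simp [-map_pow]; exact h.d44)
    (by
      simp only [map_sub, map_add, C.Du_algebraMap_mul, Derivation.leibniz, smul_eq_mul, h.u4,
        C.Du_r, C.Du_cs, C.Du_sn, C.Du_y]
      ring)
  have h3' (i : Fin 4) :
      C.D i (algebraMap ℝ R 2 * C.Du η + algebraMap ℝ R k * ξ₄) = 0 := by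
    simp only [map_add, Derivation.leibniz, smul_eq_mul, Derivation.map_algebraMap]
    rw [map_ofNat]
    linear_combination h.e i
  obtain ⟨c3, h3⟩ := C.exists_two_mul_const_of_cart
    (f := algebraMap ℝ R 2 * C.Du η + algebraMap ℝ R k * ξ₄)
    (fun i => by
      match i with
      | 0 => simp only [C.cart0, h3', mul_zero, sub_zero]
      | 1 => simp only [C.cart1, h3', mul_zero, add_zero]
      | 2 => exact h3' 2
      | 3 => exact h3' 3)
    (by simp only [map_add, C.Du_algebraMap_mul, h.uu, h.u4, mul_zero, add_zero])
  have hη : C.Du η = algebraMap ℝ R c3 - algebraMap ℝ R k * (algebraMap ℝ R c4 * C.y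
      + C.r * (algebraMap ℝ R c9 * C.sn - algebraMap ℝ R c10 * C.cs)) - algebraMap ℝ R k
        * algebraMap ℝ R (c2 / 2) := by
    have hc2 : algebraMap ℝ R c2 = 2 * algebraMap ℝ R (c2 / 2) := by
      rw [← map_ofNat (algebraMap ℝ R), ← map_mul, mul_div_cancel₀ _ two_ne_zero]
    rw [map_ofNat] at h3 h2
    rw [hc2] at h2
    apply sub_eq_zero.1
    apply two_cancel
    linear_combination h3 - algebraMap ℝ R k * h2
  -- As `η` is affine in `u`, `η - u η_u` is its part free of `u`. The constant part `c2` of `ξ₄`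
  -- contributes `-k c2 / 2` to `η_u`, but `v₃ = ∂_t` has no `∂_u` component; hence the shift in the
  -- coefficient of `v₄ = u ∂_u`.
  refine ⟨![c0, c1, c2, c3 - k * (c2 / 2), c4, c5, c6, c7, c8, c9, c10], η - C.u * C.Du η, ?_, ?_,
    ?_, ?_, ?_, ?_, ?_⟩
  · simp only [map_sub, Derivation.leibniz, smul_eq_mul, h.uu, C.Du_u]
    ring
  · rw [sub_eq_add_neg, C.L_add, h.e5, ← neg_one_mul, ← map_one (algebraMap ℝ R), ← map_neg,
      C.L_algebraMap_mul, C.L_u_mul, ← C.Du_L, h.e5, map_zero]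
    ring
  all_goals
    simp only [C.lower0, C.lower1] at h5 h6
    rw [map_ofNat] at *
    simp [-map_pow]
  · linear_combination -ξ₁ * C.cs_sq_add_sn_sq - C.cs * h6 + C.sn * h5
  · linear_combination -ξ₂ * C.cs_sq_add_sn_sq + C.ri * (C.sn * h6 + C.cs * h5)
      + (algebraMap ℝ R c0 - ξ₂) * (C.cs ^ 2 + C.sn ^ 2) * C.r_mul_ri
      + algebraMap ℝ R c0 * C.cs_sq_add_sn_sq
  · linear_combination h1
  · linear_combination h2
  · linear_combination C.u * hη

lemma IsCombination.isKilling {c : Fin 11 → ℝ} {β : R} (hu : C.Du β = 0) (hL : C.L a k β = 0)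
    (h : IsCombination C a k ξ₁ ξ₂ ξ₃ ξ₄ η (fun i => algebraMap ℝ R (c i)) β) :
    IsKilling C a k ξ₁ ξ₂ ξ₃ ξ₄ η := by
  obtain ⟨rfl, rfl, rfl, rfl, rfl⟩ := h
  have hr := C.r_mul_ri
  have h2 (i : Fin 4) : C.D i (2 : R) = 0 := by
    rw [← map_ofNat (algebraMap ℝ R), Derivation.map_algebraMap]
  have hu2 : C.Du (2 : R) = 0 := by
    rw [← map_ofNat (algebraMap ℝ R), Derivation.map_algebraMap]
  simp only [PolarCalculus.L] at hL
  -- The separate cases are the indexed family `e`, the equations in which `r * ri = 1` has to be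
  -- used, and the one that needs the equation for `β`; the rest follow by normalisation.
  constructor
  case e =>
    intro i
    match i with
    | 0 | 1 | 2 | 3 =>
      simp only [map_add, map_sub, Derivation.leibniz, smul_eq_mul, Derivation.map_algebraMap,
        Derivation.map_one_eq_zero,
        C.D_r, C.D_cs, C.D_sn, C.D_y, C.D_t, C.D_u, C.D_ri, C.Du_r, C.Du_cs, C.Du_sn, C.Du_y,
        C.Du_t, C.Du_u, C.Du_ri, hu, h2, map_zero, mul_zero, zero_mul, add_zero, zero_add,
        sub_zero, Fin.isValue, Fin.reduceEq, if_true, if_false, one_ne_zero, zero_ne_one]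
      try ring
  case d22 =>
    simp only [map_add, map_sub, map_neg, Derivation.leibniz, smul_eq_mul,
      Derivation.map_one_eq_zero, Derivation.map_algebraMap, C.D_r, C.D_cs, C.D_sn, C.D_y, C.D_t,
      C.D_u, C.D_ri, h2, map_zero, mul_zero, zero_mul, add_zero, zero_add, sub_zero, Fin.isValue,
      Fin.reduceEq, if_true, if_false, one_ne_zero, zero_ne_one]
    linear_combination (-algebraMap ℝ R (c 5) * C.sn + algebraMap ℝ R (c 6) * C.cs + algebraMap ℝ R
        (c 7) * C.y * C.cs + algebraMap ℝ R (c 8) * C.y * C.sn + 2 * algebraMap ℝ R (a ^ 2) * C.t *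
        (algebraMap ℝ R (c 10) * C.cs - algebraMap ℝ R (c 9) * C.sn)) * hr
  case d12 =>
    simp only [map_add, map_sub, map_neg, Derivation.leibniz, smul_eq_mul,
      Derivation.map_one_eq_zero, Derivation.map_algebraMap, C.D_r, C.D_cs, C.D_sn, C.D_y, C.D_t,
      C.D_u, C.D_ri, h2, map_zero, mul_zero, zero_mul, add_zero, zero_add, sub_zero, Fin.isValue,
      Fin.reduceEq, if_true, if_false, one_ne_zero, zero_ne_one]
    linear_combination -(C.r * C.ri + 1) * (algebraMap ℝ R (c 5) * C.cs + algebraMap ℝ R (c 6) *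
        C.sn + algebraMap ℝ R (c 7) * C.y * C.sn - algebraMap ℝ R (c 8) * C.y * C.cs + 2 *
        algebraMap ℝ R (a ^ 2) * C.t * (algebraMap ℝ R (c 9) * C.cs + algebraMap ℝ R (c 10) * C.sn))
        * hr
  case d23 =>
    simp only [map_add, map_sub, map_neg, Derivation.leibniz, smul_eq_mul,
      Derivation.map_one_eq_zero, Derivation.map_algebraMap, C.D_r, C.D_cs, C.D_sn, C.D_y, C.D_t,
      C.D_u, C.D_ri, h2, map_zero, mul_zero, zero_mul, add_zero, zero_add, sub_zero, Fin.isValue,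
      Fin.reduceEq, if_true, if_false, one_ne_zero, zero_ne_one]
    linear_combination C.r * (algebraMap ℝ R (c 7) * C.sn - algebraMap ℝ R (c 8) * C.cs) * hr
  case d24 =>
    simp only [map_add, map_sub, map_neg, Derivation.leibniz, smul_eq_mul,
      Derivation.map_one_eq_zero, Derivation.map_algebraMap, C.D_r, C.D_cs, C.D_sn, C.D_y, C.D_t,
      C.D_u, C.D_ri, h2, map_zero, mul_zero, zero_mul, add_zero, zero_add, sub_zero, Fin.isValue,
      Fin.reduceEq, if_true, if_false, one_ne_zero, zero_ne_one]
    linear_combination 2 * algebraMap ℝ R (a ^ 2) * C.r * (algebraMap ℝ R (c 9) * C.cs + algebraMap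
        ℝ R (c 10) * C.sn) * hr
  case e5 =>
    rw [C.L_add, C.L_u_mul, PolarCalculus.L, PolarCalculus.L]
    simp only [map_add, map_sub, map_neg, Derivation.leibniz, smul_eq_mul,
      Derivation.map_one_eq_zero, Derivation.map_algebraMap, C.D_r, C.D_cs, C.D_sn, C.D_y, C.D_t,
      C.D_u, C.D_ri, h2, map_zero, mul_zero, zero_mul, add_zero, zero_add, sub_zero, Fin.isValue,
      Fin.reduceEq, if_true, if_false, one_ne_zero, zero_ne_one]
    linear_combination hL
  all_goals
    simp only [map_add, map_sub, map_neg, Derivation.leibniz, smul_eq_mul,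
      Derivation.map_one_eq_zero,
      Derivation.map_algebraMap,
      C.D_r, C.D_cs, C.D_sn, C.D_y, C.D_t, C.D_u, C.D_ri, C.Du_r, C.Du_cs, C.Du_sn, C.Du_y,
      C.Du_t, C.Du_u, C.Du_ri, hu, h2, hu2, map_zero, mul_zero, zero_mul, add_zero, zero_add,
      sub_zero, Fin.isValue, Fin.reduceEq, if_true, if_false, one_ne_zero, zero_ne_one]
    try ring
end systems
end Telegraph
end

/-! ### Smooth functions on `r > 0` as a model of the calculus -/

noncomputable section
namespace Telegraph

lemma isOpen_baseDomain : IsOpen baseDomain :=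
  isOpen_lt continuous_const (continuous_apply 0)

lemma isOpen_domain : IsOpen domain :=
  isOpen_lt continuous_const ((continuous_apply 0).comp continuous_fst)

lemma convex_domain : Convex ℝ domain := by
  intro p hp q hq s t hs ht hst
  simp only [domain, Set.mem_ofPred_eq, Prod.fst_add, Prod.smul_fst, Pi.add_apply, Pi.smul_apply,
    smul_eq_mul] at *
  rcases hs.eq_or_lt with rfl | hs
  · rw [zero_add] at hst
    simpa [hst] using hq
  · positivity

/-- The algebra of smooth functions on the domain. -/
def smoothSubalgebra : Subalgebra ℝ (domain → ℝ) where
  -- Elements are functions on the subtype, so equality in the algebra is equality on `r > 0`,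
  -- whatever the values of a representative `F` elsewhere.
  carrier := {f | ∃ F : Total → ℝ, ContDiffOn ℝ ∞ F domain ∧ ∀ p : domain, f p = F p}
  mul_mem' := by
    rintro f g ⟨F, hF, hf⟩ ⟨G, hG, hg⟩
    exact ⟨F * G, hF.mul hG, fun p => by simp [hf, hg]⟩
  add_mem' := by
    rintro f g ⟨F, hF, hf⟩ ⟨G, hG, hg⟩
    exact ⟨F + G, hF.add hG, fun p => by simp [hf, hg]⟩
  algebraMap_mem' c := ⟨fun _ => c, contDiffOn_const, fun p => rfl⟩

/-- The smooth functions on the domain. -/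
abbrev SmoothFun := smoothSubalgebra

namespace SmoothFun

/-- The element of the algebra given by a smooth function. -/
def mk (F : Total → ℝ) (hF : ContDiffOn ℝ ∞ F domain) : SmoothFun :=
  ⟨fun p => F p, F, hF, fun _ => rfl⟩

lemma exists_mk (f : SmoothFun) : ∃ F hF, f = mk F hF := by
  obtain ⟨f, F, hF, h⟩ := f
  exact ⟨F, hF, Subtype.ext (funext h)⟩

lemma mk_eq_mk {F G : Total → ℝ} {hF : ContDiffOn ℝ ∞ F domain} {hG : ContDiffOn ℝ ∞ G domain} :
    mk F hF = mk G hG ↔ Set.EqOn F G domain := by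
  constructor
  · intro h p hp
    exact congrFun (congrArg Subtype.val h) ⟨p, hp⟩
  · intro h
    exact Subtype.ext (funext fun p => h p.2)

lemma contDiffOn_fderiv_apply {F : Total → ℝ} (hF : ContDiffOn ℝ ∞ F domain) (v : Total) :
    ContDiffOn ℝ ∞ (fun p => fderiv ℝ F p v) domain :=
  (hF.fderiv_of_isOpen isOpen_domain (m := ∞) (by simp)).clm_apply contDiffOn_const

lemma differentiableAt {F : Total → ℝ} (hF : ContDiffOn ℝ ∞ F domain) {p : Total}
    (hp : p ∈ domain) : DifferentiableAt ℝ F p :=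
  (hF.contDiffAt (isOpen_domain.mem_nhds hp)).differentiableAt (by simp)

/-- A function representing an element of the algebra. -/
def rep (f : SmoothFun) : Total → ℝ := (exists_mk f).choose

lemma contDiffOn_rep (f : SmoothFun) : ContDiffOn ℝ ∞ (rep f) domain :=
  (exists_mk f).choose_spec.choose

lemma mk_rep (f : SmoothFun) : mk (rep f) (contDiffOn_rep f) = f :=
  (exists_mk f).choose_spec.choose_spec.symm

/-- The directional derivative. -/
def dirDeriv (v : Total) (f : SmoothFun) : SmoothFun :=
  mk (fun p => fderiv ℝ (rep f) p v) (contDiffOn_fderiv_apply (contDiffOn_rep f) v)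

/-- The domain is open, so derivatives there do not depend on the representative picked by `rep`. -/
lemma dirDeriv_mk (v : Total) {F : Total → ℝ} (hF : ContDiffOn ℝ ∞ F domain) :
    dirDeriv v (mk F hF) = mk (fun p => fderiv ℝ F p v) (contDiffOn_fderiv_apply hF v) := by
  have h : Set.EqOn (rep (mk F hF)) F domain := mk_eq_mk.1 (mk_rep (mk F hF))
  refine mk_eq_mk.2 fun p hp => ?_
  have : fderiv ℝ (rep (mk F hF)) p = fderiv ℝ F p :=
    (h.eventuallyEq_of_mem (isOpen_domain.mem_nhds hp)).fderiv_eq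
  exact congrArg (· v) this

lemma mk_add {F G : Total → ℝ} (hF : ContDiffOn ℝ ∞ F domain) (hG : ContDiffOn ℝ ∞ G domain) :
    mk F hF + mk G hG = mk (fun p => F p + G p) (hF.add hG) := rfl

lemma mk_mul {F G : Total → ℝ} (hF : ContDiffOn ℝ ∞ F domain) (hG : ContDiffOn ℝ ∞ G domain) :
    mk F hF * mk G hG = mk (fun p => F p * G p) (hF.mul hG) := rfl

lemma mk_neg {F : Total → ℝ} (hF : ContDiffOn ℝ ∞ F domain) :
    -mk F hF = mk (fun p => -F p) hF.neg := rfl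

lemma algebraMap_eq (c : ℝ) : algebraMap ℝ SmoothFun c = mk (fun _ => c) contDiffOn_const := rfl

lemma smul_mk (c : ℝ) {F : Total → ℝ} (hF : ContDiffOn ℝ ∞ F domain) :
    c • mk F hF = mk (fun p => c * F p) (contDiffOn_const.mul hF) := rfl

lemma zero_eq : (0 : SmoothFun) = mk (fun _ => 0) contDiffOn_const := rfl
lemma one_eq : (1 : SmoothFun) = mk (fun _ => 1) contDiffOn_const := rfl

/-- The directional derivative as a derivation. -/
def derivation (v : Total) : Derivation ℝ SmoothFun SmoothFun :=
  Derivation.mk'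
    { toFun := dirDeriv v
      map_add' := by
        intro f g
        obtain ⟨F, hF, rfl⟩ := exists_mk f
        obtain ⟨G, hG, rfl⟩ := exists_mk g
        rw [mk_add, dirDeriv_mk, dirDeriv_mk, dirDeriv_mk, mk_add]
        refine mk_eq_mk.2 fun p hp => ?_
        simp [fderiv_fun_add (differentiableAt hF hp) (differentiableAt hG hp)]
      map_smul' := by
        intro c f
        obtain ⟨F, hF, rfl⟩ := exists_mk f
        rw [smul_mk, dirDeriv_mk, dirDeriv_mk, RingHom.id_apply, smul_mk]
        refine mk_eq_mk.2 fun p hp => ?_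
        simp [fderiv_const_mul (differentiableAt hF hp)] }
    (by
      intro f g
      obtain ⟨F, hF, rfl⟩ := exists_mk f
      obtain ⟨G, hG, rfl⟩ := exists_mk g
      simp only [LinearMap.coe_mk, AddHom.coe_mk, smul_eq_mul]
      rw [mk_mul, dirDeriv_mk, dirDeriv_mk, dirDeriv_mk, mk_mul, mk_mul, mk_add]
      refine mk_eq_mk.2 fun p hp => ?_
      simp [fderiv_fun_mul (differentiableAt hF hp) (differentiableAt hG hp)])

lemma derivation_mk (v : Total) {F : Total → ℝ} (hF : ContDiffOn ℝ ∞ F domain) :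
    derivation v (mk F hF) = mk (fun p => fderiv ℝ F p v) (contDiffOn_fderiv_apply hF v) :=
  dirDeriv_mk v hF

lemma derivation_comm (v w : Total) (f : SmoothFun) :
    derivation v (derivation w f) = derivation w (derivation v f) := by
  obtain ⟨F, hF, rfl⟩ := exists_mk f
  rw [derivation_mk, derivation_mk, derivation_mk, derivation_mk]
  refine mk_eq_mk.2 fun p hp => ?_
  have hd : DifferentiableAt ℝ (fderiv ℝ F) p :=
    ((hF.fderiv_of_isOpen isOpen_domain (m := ∞) (by simp)).contDiffAt
      (isOpen_domain.mem_nhds hp)).differentiableAt (by simp)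
  have hs : IsSymmSndFDerivAt ℝ F p :=
    (hF.contDiffAt (isOpen_domain.mem_nhds hp)).isSymmSndFDerivAt
      (by simpa using WithTop.coe_le_coe.2 (le_top : (2 : ℕ∞) ≤ ⊤))
  rw [fderiv_clm_apply hd (differentiableAt_const _), fderiv_clm_apply hd (differentiableAt_const
      _)]
  simpa using hs.eq v w

lemma derivation_of_hasFDerivAt (v : Total) {F : Total → ℝ} {hF : ContDiffOn ℝ ∞ F domain}
    {F' : Total → Total →L[ℝ] ℝ} (h : ∀ p ∈ domain, HasFDerivAt F (F' p) p) {G : Total → ℝ}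
    {hG : ContDiffOn ℝ ∞ G domain} (e : ∀ p ∈ domain, F' p v = G p) :
    derivation v (mk F hF) = mk G hG := by
  rw [derivation_mk]
  refine mk_eq_mk.2 fun p hp => ?_
  simp only [(h p hp).fderiv, e p hp]

/-- The five directions form a basis, so the whole derivative vanishes, and the domain is convex,
hence connected. -/
lemma exists_const {f : SmoothFun} (h : ∀ i, derivation (Pi.single i 1, 0) f = 0)
    (hu : derivation (0, 1) f = 0) : ∃ c : ℝ, f = algebraMap ℝ SmoothFun c := by
  obtain ⟨F, hF, rfl⟩ := exists_mk f
  have hz : ∀ p ∈ domain, fderiv ℝ F p = 0 := by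
    intro p hp
    have h1 : ∀ i, fderiv ℝ F p (Pi.single i 1, 0) = 0 := fun i => by
      have := h i
      rw [derivation_mk, zero_eq] at this
      exact mk_eq_mk.1 this hp
    have h2 : fderiv ℝ F p (0, 1) = 0 := by
      rw [derivation_mk, zero_eq] at hu
      exact mk_eq_mk.1 hu hp
    refine ContinuousLinearMap.coe_injective (LinearMap.prod_ext
      (LinearMap.pi_ext' fun i => LinearMap.ext_ring ?_) (LinearMap.ext_ring ?_))
    · simpa using h1 i
    · simpa using h2
  obtain ⟨c, hc⟩ := isOpen_domain.exists_is_const_of_fderiv_eq_zero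
    convex_domain.isPreconnected
    (fun p hp => (differentiableAt hF hp).differentiableWithinAt) hz
  refine ⟨c, ?_⟩
  rw [algebraMap_eq]
  exact mk_eq_mk.2 hc

lemma contDiff_coord (i : Fin 4) : ContDiff ℝ ∞ fun p : Total => p.1 i := by fun_prop

lemma hasFDerivAt_coord (i : Fin 4) (p : Total) : HasFDerivAt (fun p : Total => p.1 i)
    ((ContinuousLinearMap.proj i).comp (ContinuousLinearMap.fst ℝ Base ℝ)) p :=
  ((ContinuousLinearMap.proj (R := ℝ) (φ := fun _ : Fin 4 => ℝ) i).comp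
    (ContinuousLinearMap.fst ℝ Base ℝ)).hasFDerivAt

lemma derivation_coord (v : Total) (i : Fin 4) :
    derivation v (mk (fun p => p.1 i) (contDiff_coord i).contDiffOn)
      = mk (fun _ => v.1 i) contDiffOn_const :=
  derivation_of_hasFDerivAt _ (fun p _ => hasFDerivAt_coord i p) (fun _ _ => rfl)

lemma derivation_cos (v : Total) (i : Fin 4) :
    derivation v (mk (fun p => Real.cos (p.1 i)) (contDiff_coord i).cos.contDiffOn)
      = mk (fun p => -Real.sin (p.1 i) * v.1 i)
        ((contDiff_coord i).sin.neg.mul contDiff_const).contDiffOn :=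
  derivation_of_hasFDerivAt _ (fun p _ => (hasFDerivAt_coord i p).cos) (fun _ _ => rfl)

lemma derivation_sin (v : Total) (i : Fin 4) :
    derivation v (mk (fun p => Real.sin (p.1 i)) (contDiff_coord i).sin.contDiffOn)
      = mk (fun p => Real.cos (p.1 i) * v.1 i)
        ((contDiff_coord i).cos.mul contDiff_const).contDiffOn :=
  derivation_of_hasFDerivAt _ (fun p _ => (hasFDerivAt_coord i p).sin) (fun _ _ => rfl)

/-- The differential algebra of smooth functions on the domain. -/
def polarCalculus : PolarCalculus SmoothFun where
  D i := derivation (Pi.single i 1, 0)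
  Du := derivation (0, 1)
  r := mk (fun p => p.1 0) (contDiff_coord 0).contDiffOn
  ri := mk (fun p => (p.1 0)⁻¹) ((contDiff_coord 0).contDiffOn.inv fun p hp => ne_of_gt hp)
  cs := mk (fun p => Real.cos (p.1 1)) (contDiff_coord 1).cos.contDiffOn
  sn := mk (fun p => Real.sin (p.1 1)) (contDiff_coord 1).sin.contDiffOn
  y := mk (fun p => p.1 2) (contDiff_coord 2).contDiffOn
  t := mk (fun p => p.1 3) (contDiff_coord 3).contDiffOn
  u := mk (fun p => p.2) contDiff_snd.contDiffOn
  comm i j f := derivation_comm _ _ _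
  comm_u i f := derivation_comm _ _ _
  D_r i := by
    rw [derivation_coord]; split_ifs <;> simp_all [one_eq, zero_eq]
  D_y i := by
    rw [derivation_coord]; split_ifs <;> simp_all [one_eq, zero_eq]
  D_t i := by
    rw [derivation_coord]; split_ifs <;> simp_all [one_eq, zero_eq]
  Du_r := derivation_coord _ _
  Du_y := derivation_coord _ _
  Du_t := derivation_coord _ _
  D_cs i := by
    rw [derivation_cos]
    split_ifs with h
    · subst h; simp [mk_neg]
    · simp [zero_eq, Ne.symm h]
  D_sn i := by
    rw [derivation_sin]
    split_ifs with h
    · subst h; simp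
    · simp [zero_eq, Ne.symm h]
  Du_cs := by rw [derivation_cos]; simp [zero_eq]
  Du_sn := by rw [derivation_sin]; simp [zero_eq]
  D_u i := derivation_of_hasFDerivAt (hG := contDiffOn_const) _ (fun p _ => hasFDerivAt_snd)
    (fun p _ => rfl)
  Du_u := derivation_of_hasFDerivAt (hG := contDiffOn_const) _ (fun p _ => hasFDerivAt_snd)
    (fun p _ => rfl)
  r_mul_ri := Subtype.ext (funext fun p => mul_inv_cancel₀ (ne_of_gt p.2))
  cs_sq_add_sn_sq := Subtype.ext (funext fun p => Real.cos_sq_add_sin_sq _)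
  exists_const f h hu := exists_const h hu

end SmoothFun
end Telegraph
end

/-! ### The determining equations for smooth coefficients -/

noncomputable section
namespace Telegraph
namespace SmoothFun

lemma ext_iff {f g : SmoothFun} :
    f = g ↔ ∀ p (hp : p ∈ domain), f.1 ⟨p, hp⟩ = g.1 ⟨p, hp⟩ :=
  ⟨fun h p hp => by rw [h], fun h => Subtype.ext (funext fun p => h p p.2)⟩

lemma contDiffOn_dz {F : Total → ℝ} (hF : ContDiffOn ℝ ∞ F domain) (i : Fin 4) :
    ContDiffOn ℝ ∞ (dz i F) domain := contDiffOn_fderiv_apply hF _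

lemma contDiffOn_du {F : Total → ℝ} (hF : ContDiffOn ℝ ∞ F domain) :
    ContDiffOn ℝ ∞ (du F) domain := contDiffOn_fderiv_apply hF _

lemma D_mk (i : Fin 4) {F : Total → ℝ} (hF : ContDiffOn ℝ ∞ F domain) :
    polarCalculus.D i (mk F hF) = mk (dz i F) (contDiffOn_dz hF i) := derivation_mk _ hF

lemma Du_mk {F : Total → ℝ} (hF : ContDiffOn ℝ ∞ F domain) :
    polarCalculus.Du (mk F hF) = mk (du F) (contDiffOn_du hF) := derivation_mk _ hF

lemma mk_apply {F : Total → ℝ} (hF : ContDiffOn ℝ ∞ F domain) {p : Total} (hp : p ∈ domain) :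
    (mk F hF).1 ⟨p, hp⟩ = F p := rfl

end SmoothFun
open SmoothFun

lemma contDiffOn_xi {V : Total → Total} (hV : ContDiffOn ℝ ∞ V domain) (i : Fin 4) :
    ContDiffOn ℝ ∞ (xi V i) domain := contDiffOn_pi.1 hV.fst i

lemma contDiffOn_eta {V : Total → Total} (hV : ContDiffOn ℝ ∞ V domain) :
    ContDiffOn ℝ ∞ (eta V) domain := hV.snd

variable {a k : ℝ}

lemma determining_iff {V : Total → Total} (hV : ContDiffOn ℝ ∞ V domain) :
    Determining polarCalculus a k (mk (xi V 0) (contDiffOn_xi hV 0))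
      (mk (xi V 1) (contDiffOn_xi hV 1)) (mk (xi V 2) (contDiffOn_xi hV 2))
      (mk (xi V 3) (contDiffOn_xi hV 3)) (mk (eta V) (contDiffOn_eta hV))
      ↔ DeterminingEquations a k V := by
  simp only [Determining, PolarCalculus.L, D_mk, Du_mk, SmoothFun.ext_iff, ← forall_and]
  refine forall_congr' fun p => forall_congr' fun hp => ?_
  simp only [DeterminingAt]
  repeat' refine and_congr ?_ ?_
  all_goals try exact Iff.rfl
  -- Only the last equation differs in form: its left side is `-L η`.
  refine Iff.trans ?_ neg_eq_zero
  refine Eq.congr ?_ rfl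
  exact (show (_ : ℝ) = _ by
    change p.1 0 ^ 2 * dz 3 (dz 3 (eta V)) p + k * p.1 0 ^ 2 * dz 3 (eta V) p
      - a ^ 2 * (p.1 0 ^ 2 * dz 0 (dz 0 (eta V)) p + p.1 0 * dz 0 (eta V) p
        + dz 1 (dz 1 (eta V)) p + p.1 0 ^ 2 * dz 2 (dz 2 (eta V)) p) = _
    ring)

end Telegraph
end

/-! ### Total derivatives on jet space -/

noncomputable section
namespace Telegraph

/-- `F` has the total derivative `v` at the jet `j` in the direction `i`, being of finite order
there. -/
def HasTotalD (i : Fin 4) (F : Jet → ℝ) (j : Jet) (v : ℝ) : Prop :=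
  ∃ (c : ℝ) (b : Multiset (Fin 4) →₀ ℝ),
    HasDerivAt (fun s => F (Function.update j.1 i s, j.2)) c (j.1 i) ∧
    (∀ J, HasDerivAt (fun s => F (j.1, Function.update j.2 J s)) (b J) (j.2 J)) ∧
    c + b.sum (fun J x => j.2 (i ::ₘ J) * x) = v

namespace HasTotalD

variable {i : Fin 4} {F G : Jet → ℝ} {j : Jet} {v w : ℝ}

lemma totalD_eq (h : HasTotalD i F j v) : totalD i F j = v := by
  obtain ⟨c, b, hc, hb, rfl⟩ := h
  have hb' : ∀ J, jetDu J F j = b J := fun J => (hb J).deriv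
  rw [totalD, jetDz, hc.deriv]
  simp only [hb']
  rw [finsum_eq_sum_of_support_subset (s := b.support), Finsupp.sum]
  intro J hJ
  simp only [Function.mem_support, ne_eq, mul_eq_zero, not_or] at hJ
  simpa using hJ.2

/-- Formulas for a first total derivative hold only over `r > 0`. This suffices to differentiate
again: the region is open, and varying a `u_J` does not move the base point. -/
lemma congr_of_eqOn (h : HasTotalD i G j v) (hj : j.1 ∈ baseDomain)
    (e : ∀ j' : Jet, j'.1 ∈ baseDomain → F j' = G j') : HasTotalD i F j v := by
  obtain ⟨c, b, hc, hb, rfl⟩ := h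
  refine ⟨c, b, hc.congr_of_eventuallyEq ?_, fun J => ?_, rfl⟩
  · have hcont : Continuous fun s => Function.update j.1 i s :=
      continuous_const.update i continuous_id
    have : ∀ᶠ s in nhds (j.1 i), Function.update j.1 i s ∈ baseDomain :=
      hcont.continuousAt.eventually_mem
        (isOpen_baseDomain.mem_nhds (by rwa [Function.update_eq_self]))
    filter_upwards [this] with s hs using e _ hs
  · exact (hb J).congr_of_eventuallyEq (Filter.Eventually.of_forall fun s => e _ hj)

lemma add (hF : HasTotalD i F j v) (hG : HasTotalD i G j w) :
    HasTotalD i (fun j => F j + G j) j (v + w) := by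
  obtain ⟨c, b, hc, hb, rfl⟩ := hF
  obtain ⟨c', b', hc', hb', rfl⟩ := hG
  refine ⟨c + c', b + b', hc.add hc', fun J => (hb J).add (hb' J), ?_⟩
  rw [Finsupp.sum_add_index' (by simp) (by intros; ring)]
  ring

lemma mul (hF : HasTotalD i F j v) (hG : HasTotalD i G j w) :
    HasTotalD i (fun j => F j * G j) j (v * G j + F j * w) := by
  obtain ⟨c, b, hc, hb, rfl⟩ := hF
  obtain ⟨c', b', hc', hb', rfl⟩ := hG
  refine ⟨c * G j + F j * c', G j • b + F j • b', ?_, fun J => ?_, ?_⟩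
  · simpa using hc.fun_mul hc'
  · simpa [mul_comm] using (hb J).fun_mul (hb' J)
  · rw [Finsupp.sum_add_index' (by simp) (by intros; ring), Finsupp.sum_smul_index' (by simp),
      Finsupp.sum_smul_index' (by simp)]
    simp only [smul_eq_mul, mul_left_comm, ← Finsupp.mul_sum]
    ring

lemma neg (hF : HasTotalD i F j v) : HasTotalD i (fun j => -F j) j (-v) := by
  obtain ⟨c, b, hc, hb, rfl⟩ := hF
  refine ⟨-c, -b, hc.neg, fun J => (hb J).neg, ?_⟩
  rw [Finsupp.sum_neg_index (by simp)]
  simp only [mul_neg, Finsupp.sum, Finset.sum_neg_distrib]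
  ring

lemma sub (hF : HasTotalD i F j v) (hG : HasTotalD i G j w) :
    HasTotalD i (fun j => F j - G j) j (v - w) := by
  simpa only [sub_eq_add_neg] using hF.add hG.neg

lemma sum {ι : Type*} (s : Finset ι) {F : ι → Jet → ℝ} {v : ι → ℝ}
    (h : ∀ l ∈ s, HasTotalD i (F l) j (v l)) :
    HasTotalD i (fun j => ∑ l ∈ s, F l j) j (∑ l ∈ s, v l) := by
  classical
  induction s using Finset.induction_on with
  | empty => exact ⟨0, 0, by simpa using hasDerivAt_const _ _, fun J => by
      simpa using hasDerivAt_const _ _, by simp⟩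
  | insert l s hl ih =>
    simp only [Finset.sum_insert hl]
    exact (h l (Finset.mem_insert_self _ _)).add
      (ih fun m hm => h m (Finset.mem_insert_of_mem hm))

end HasTotalD

lemma hasDerivAt_update_apply {ι : Type*} [DecidableEq ι] (U : ι → ℝ) (J J₀ : ι) (s : ℝ) :
    HasDerivAt (fun s => Function.update U J s J₀) (if J = J₀ then 1 else 0) s := by
  split_ifs with h
  · subst h
    simpa using hasDerivAt_id' s
  · simpa [Function.update_of_ne (Ne.symm h)] using hasDerivAt_const s (U J₀)

lemma hasTotalD_coord (i : Fin 4) (J : Multiset (Fin 4)) (j : Jet) :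
    HasTotalD i (fun j => j.2 J) j (j.2 (i ::ₘ J)) := by
  refine ⟨0, Finsupp.single J 1, hasDerivAt_const _ _, fun J' => ?_, by simp⟩
  simpa [Finsupp.single_apply, eq_comm] using hasDerivAt_update_apply j.2 J' J (j.2 J')

/-- The total derivative of a function on the total space. -/
def totalDZero (i : Fin 4) (f : Total → ℝ) (j : Jet) : ℝ :=
  dz i f (j.1, j.2 0) + j.2 {i} * du f (j.1, j.2 0)

lemma hasTotalD_comp {f : Total → ℝ} {j : Jet} (hf : DifferentiableAt ℝ f (j.1, j.2 0))
    (i : Fin 4) : HasTotalD i (fun j => f (j.1, j.2 0)) j (totalDZero i f j) := by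
  refine ⟨dz i f (j.1, j.2 0), Finsupp.single 0 (du f (j.1, j.2 0)), ?_, fun J => ?_, ?_⟩
  · have h1 : HasDerivAt (fun s => ((Function.update j.1 i s, j.2 0) : Total))
        (Pi.single i 1, 0) (j.1 i) :=
      (hasDerivAt_update j.1 i (j.1 i)).prodMk (hasDerivAt_const _ _)
    have h2 : HasFDerivAt f (fderiv ℝ f (j.1, j.2 0))
        (Function.update j.1 i (j.1 i), j.2 0) := by
      simpa using hf.hasFDerivAt
    exact h2.comp_hasDerivAt (j.1 i) h1
  · have h1 : HasDerivAt (fun s => ((j.1, Function.update j.2 J s 0) : Total))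
        (0, if J = 0 then 1 else 0) (j.2 J) :=
      (hasDerivAt_const _ _).prodMk (hasDerivAt_update_apply j.2 J 0 (j.2 J))
    have h2 : HasFDerivAt f (fderiv ℝ f (j.1, j.2 0))
        (j.1, Function.update j.2 J (j.2 J) 0) := by
      simpa using hf.hasFDerivAt
    refine (h2.comp_hasDerivAt (j.2 J) h1).congr_deriv ?_
    rw [Finsupp.single_apply]
    by_cases h : J = 0
    · simp [h, du]
    · rw [if_neg (Ne.symm h), if_neg h]
      exact (fderiv ℝ f _).map_zero
  · simp [totalDZero]

end Telegraph
end

/-! ### Second prolongation of a vector field -/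

noncomputable section
namespace Telegraph
open SmoothFun

/-- The second total derivative of a function on the total space. -/
def totalDZero₂ (i : Fin 4) (f : Total → ℝ) (j : Jet) : ℝ :=
  totalDZero i (dz i f) j + (j.2 {i, i} * du f (j.1, j.2 0) + j.2 {i} * totalDZero i (du f) j)

lemma hasTotalD_totalDZero {f : Total → ℝ} (hf : ContDiffOn ℝ ∞ f domain) {j : Jet}
    (hj : j.1 ∈ baseDomain) (i : Fin 4) :
    HasTotalD i (totalDZero i f) j (totalDZero₂ i f j) := by
  have hj' : (j.1, j.2 0) ∈ domain := hj
  exact (hasTotalD_comp (differentiableAt (contDiffOn_dz hf i) hj') i).add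
    ((hasTotalD_coord i {i} j).mul (hasTotalD_comp (differentiableAt (contDiffOn_du hf) hj') i))

variable {V : Total → Total}

/-- The total derivative of the characteristic. -/
def characteristicD (V : Total → Total) (i : Fin 4) (j : Jet) : ℝ :=
  totalDZero i (eta V) j
    - ∑ l, (totalDZero i (xi V l) j * j.2 {l} + xi V l (j.1, j.2 0) * j.2 (i ::ₘ {l}))

lemma hasTotalD_characteristic (hV : ContDiffOn ℝ ∞ V domain) {j : Jet} (hj : j.1 ∈ baseDomain)
    (i : Fin 4) : HasTotalD i (characteristic V) j (characteristicD V i j) := by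
  have hj' : (j.1, j.2 0) ∈ domain := hj
  exact (hasTotalD_comp (differentiableAt (contDiffOn_eta hV) hj') i).sub
    (HasTotalD.sum _ fun l _ => (hasTotalD_comp (differentiableAt (contDiffOn_xi hV l) hj') i).mul
      (hasTotalD_coord i {l} j))

lemma hasTotalD_characteristicD (hV : ContDiffOn ℝ ∞ V domain) {j : Jet} (hj : j.1 ∈ baseDomain)
    (i : Fin 4) : HasTotalD i (characteristicD V i) j (totalDZero₂ i (eta V) j
      - ∑ l, ((totalDZero₂ i (xi V l) j * j.2 {l} + totalDZero i (xi V l) j * j.2 (i ::ₘ {l}))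
        + (totalDZero i (xi V l) j * j.2 (i ::ₘ {l})
          + xi V l (j.1, j.2 0) * j.2 (i ::ₘ i ::ₘ {l})))) := by
  have hj' : (j.1, j.2 0) ∈ domain := hj
  exact (hasTotalD_totalDZero (contDiffOn_eta hV) hj i).sub
    (HasTotalD.sum _ fun l _ => ((hasTotalD_totalDZero (contDiffOn_xi hV l) hj i).mul
      (hasTotalD_coord i {l} j)).add ((hasTotalD_comp (differentiableAt (contDiffOn_xi hV l) hj')
        i).mul (hasTotalD_coord i (i ::ₘ {l}) j)))

lemma totalDMulti_singleton (i : Fin 4) (F : Jet → ℝ) : totalDMulti {i} F = totalD i F := by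
  fin_cases i <;> rfl

/-- Repeated indices suffice at second order, since the equation has no mixed derivatives. -/
lemma totalDMulti_pair (i : Fin 4) (F : Jet → ℝ) :
    totalDMulti {i, i} F = totalD i (totalD i F) := by
  fin_cases i <;> rfl

/-- The second-order terms `ξ_l u_{il}` of `D_i Q` cancel against the correction sum in `φ^J`. -/
lemma prolongCoeff_singleton (hV : ContDiffOn ℝ ∞ V domain) {j : Jet} (hj : j.1 ∈ baseDomain)
    (i : Fin 4) : prolongCoeff V {i} j
      = totalDZero i (eta V) j - ∑ l, totalDZero i (xi V l) j * j.2 {l} := by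
  rw [prolongCoeff, totalDMulti_singleton, (hasTotalD_characteristic hV hj i).totalD_eq,
    characteristicD, Finset.sum_add_distrib]
  have : ∀ l : Fin 4, l ::ₘ ({i} : Multiset (Fin 4)) = i ::ₘ {l} := fun l => Multiset.pair_comm l i
  simp only [this]
  ring

/-- Here the third-order jet coordinates cancel, so the prolonged condition involves jets of order
two only. -/
lemma prolongCoeff_pair (hV : ContDiffOn ℝ ∞ V domain) {j : Jet} (hj : j.1 ∈ baseDomain)
    (i : Fin 4) : prolongCoeff V {i, i} j = totalDZero₂ i (eta V) j
      - ∑ l, (totalDZero₂ i (xi V l) j * j.2 {l}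
        + 2 * (totalDZero i (xi V l) j * j.2 (i ::ₘ {l}))) := by
  rw [prolongCoeff, totalDMulti_pair,
    ((hasTotalD_characteristicD hV hj i).congr_of_eqOn hj fun j' hj' =>
      (hasTotalD_characteristic hV hj' i).totalD_eq).totalD_eq]
  have : ∀ l : Fin 4, l ::ₘ ({i, i} : Multiset (Fin 4)) = i ::ₘ i ::ₘ {l} := fun l => by
    rw [Multiset.insert_eq_cons, Multiset.cons_swap]
    exact congrArg _ (Multiset.pair_comm l i)
  simp only [this, Finset.sum_add_distrib, ← Finset.mul_sum]
  ring

lemma jetDz_telegraph (a k : ℝ) {j : Jet} (hj : j.1 ∈ baseDomain) (i : Fin 4) :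
    jetDz i (telegraph a k) j = if i = 0 then
      a ^ 2 * (1 / j.1 0 ^ 2 * j.2 {0} + 2 / j.1 0 ^ 3 * j.2 {1, 1}) else 0 := by
  have h0 : j.1 0 ≠ 0 := ne_of_gt hj
  split_ifs with h
  · subst h
    have h1 : HasDerivAt (fun s : ℝ => 1 / s) (-(j.1 0 ^ 2)⁻¹) (j.1 0) := by
      simpa using hasDerivAt_inv h0
    have h2 : HasDerivAt (fun s : ℝ => 1 / s ^ 2) (-(2 / j.1 0 ^ 3)) (j.1 0) := by
      have := (hasDerivAt_pow 2 (j.1 0)).fun_inv (pow_ne_zero 2 h0)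
      simp only [one_div]
      refine this.congr_deriv ?_
      field_simp
      norm_num [mul_comm]
    have := ((((h1.mul_const (j.2 {0})).const_add (j.2 {0, 0})).add
      (h2.mul_const (j.2 {1, 1}))).add_const (j.2 {2, 2})).const_mul (a ^ 2)
    have := this.const_sub (j.2 {3, 3} + k * j.2 {3})
    simp only [jetDz, telegraph, Function.update_self]
    refine this.deriv.trans ?_
    field_simp
    ring
  · simp only [jetDz, telegraph, Function.update_of_ne (Ne.symm h), deriv_const]

lemma jetDu_telegraph (a k : ℝ) (j : Jet) (J : Multiset (Fin 4)) :
    jetDu J (telegraph a k) j = (if J = {3, 3} then 1 else 0) + k * (if J = {3} then 1 else 0)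
      - a ^ 2 * ((if J = {0, 0} then 1 else 0) + 1 / j.1 0 * (if J = {0} then 1 else 0)
        + 1 / j.1 0 ^ 2 * (if J = {1, 1} then 1 else 0) + (if J = {2, 2} then 1 else 0)) := by
  have h (J₀) := hasDerivAt_update_apply j.2 J J₀ (j.2 J)
  exact (((h {3, 3}).add ((h {3}).const_mul k)).sub (((((h {0, 0}).add ((h {0}).const_mul
    (1 / j.1 0))).add ((h {1, 1}).const_mul (1 / j.1 0 ^ 2))).add (h {2, 2})).const_mul
      (a ^ 2))).deriv

lemma finsum_prolongCoeff_telegraph (a k : ℝ) (f : Multiset (Fin 4) → ℝ) (j : Jet) :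
    ∑ᶠ (J : Multiset (Fin 4)) (_ : J.card ≤ 2), f J * jetDu J (telegraph a k) j
      = f {3, 3} + k * f {3} - a ^ 2 * (f {0, 0} + 1 / j.1 0 * f {0} + 1 / j.1 0 ^ 2 * f {1, 1}
        + f {2, 2}) := by
  simp only [finsum_eq_if]
  rw [finsum_eq_sum_of_support_subset
    (s := {{3, 3}, {3}, {0, 0}, {0}, {1, 1}, {2, 2}})]
  · have hs : ∀ i l : Fin 4, ({i, i} : Multiset (Fin 4)) ≠ {l} := fun i l h => by
      simpa using congrArg Multiset.card h
    have hs' : ∀ i l : Fin 4, ({l} : Multiset (Fin 4)) ≠ {i, i} := fun i l h => (hs i l h.symm)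
    have hp : ∀ i l : Fin 4, ({i, i} : Multiset (Fin 4)) = {l, l} ↔ i = l := by decide
    have hc : ∀ i : Fin 4, ({i, i} : Multiset (Fin 4)).card = 2 := fun i => Multiset.card_pair i i
    rw [Finset.sum_insert, Finset.sum_insert, Finset.sum_insert, Finset.sum_insert,
      Finset.sum_insert, Finset.sum_singleton]
    · simp [-Multiset.insert_eq_cons, jetDu_telegraph, hs, hs', hp, hc]
      ring
    all_goals simp [-Multiset.insert_eq_cons, hs, hs', hp]
  · intro J hJ
    contrapose! hJ
    simp only [Finset.coe_insert, Finset.coe_singleton, Set.mem_insert_iff,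
      Set.mem_singleton_iff, not_or] at hJ
    simp [-Multiset.insert_eq_cons, jetDu_telegraph, hJ]

end Telegraph
end

/-! ### Comparison of coefficients in the symmetry condition -/

noncomputable section
namespace Telegraph
set_option linter.unusedVariables false

/-- The values at a point of the first component of a vector field `∑ ξ_l ∂_l + η ∂_u` and of the
derivatives of its components that enter the symmetry condition: `X l i`, `X₂ l i`, `Xᵢᵤ l i`,
`Xᵤ l`, `Xᵤᵤ l` are the derivatives of `ξ_l`, and `N i`, `N₂ i`, `Nᵢᵤ i`, `Nᵤ`, `Nᵤᵤ` those of
`η`. -/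
structure Symbols where
  x : ℝ
  X : Fin 4 → Fin 4 → ℝ
  X₂ : Fin 4 → Fin 4 → ℝ
  Xᵢᵤ : Fin 4 → Fin 4 → ℝ
  Xᵤ : Fin 4 → ℝ
  Xᵤᵤ : Fin 4 → ℝ
  N : Fin 4 → ℝ
  N₂ : Fin 4 → ℝ
  Nᵢᵤ : Fin 4 → ℝ
  Nᵤ : ℝ
  Nᵤᵤ : ℝ

namespace Symbols

variable (σ : Symbols)

/-- The prolongation coefficient of first order. -/
def phi (i : Fin 4) (p q0 q1 q2 q3 : ℝ) : ℝ :=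
  σ.N i + p * σ.Nᵤ - ((σ.X 0 i + p * σ.Xᵤ 0) * q0 + (σ.X 1 i + p * σ.Xᵤ 1) * q1
    + (σ.X 2 i + p * σ.Xᵤ 2) * q2 + (σ.X 3 i + p * σ.Xᵤ 3) * q3)

/-- A second-order total derivative. -/
def second (f₂ fᵢᵤ fᵤ fᵤᵤ p h : ℝ) : ℝ := f₂ + p * fᵢᵤ + (h * fᵤ + p * (fᵢᵤ + p * fᵤᵤ))

/-- The prolongation coefficient of second order. -/
def phi₂ (i : Fin 4) (p h q0 q1 q2 q3 h0 h1 h2 h3 : ℝ) : ℝ :=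
  second (σ.N₂ i) (σ.Nᵢᵤ i) σ.Nᵤ σ.Nᵤᵤ p h
    - ((second (σ.X₂ 0 i) (σ.Xᵢᵤ 0 i) (σ.Xᵤ 0) (σ.Xᵤᵤ 0) p h * q0
        + 2 * ((σ.X 0 i + p * σ.Xᵤ 0) * h0))
      + (second (σ.X₂ 1 i) (σ.Xᵢᵤ 1 i) (σ.Xᵤ 1) (σ.Xᵤᵤ 1) p h * q1
        + 2 * ((σ.X 1 i + p * σ.Xᵤ 1) * h1))
      + (second (σ.X₂ 2 i) (σ.Xᵢᵤ 2 i) (σ.Xᵤ 2) (σ.Xᵤᵤ 2) p h * q2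
        + 2 * ((σ.X 2 i + p * σ.Xᵤ 2) * h2))
      + (second (σ.X₂ 3 i) (σ.Xᵢᵤ 3 i) (σ.Xᵤ 3) (σ.Xᵤᵤ 3) p h * q3
        + 2 * ((σ.X 3 i + p * σ.Xᵤ 3) * h3)))

/-- The prolonged field applied to the equation, with `ρ = 1 / r`, as a polynomial in the
derivatives `qᵢ` and `hᵢₗ` of `u`. -/
def poly (a k ρ q0 q1 q2 q3 h00 h01 h02 h03 h11 h12 h13 h22 h23 h33 : ℝ) : ℝ :=
  σ.x * (a ^ 2 * (ρ ^ 2 * q0 + 2 * ρ ^ 3 * h11))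
    + (σ.phi₂ 3 q3 h33 q0 q1 q2 q3 h03 h13 h23 h33 + k * σ.phi 3 q3 q0 q1 q2 q3
      - a ^ 2 * (σ.phi₂ 0 q0 h00 q0 q1 q2 q3 h00 h01 h02 h03 + ρ * σ.phi 0 q0 q0 q1 q2 q3
        + ρ ^ 2 * σ.phi₂ 1 q1 h11 q0 q1 q2 q3 h01 h11 h12 h13
        + σ.phi₂ 2 q2 h22 q0 q1 q2 q3 h02 h12 h22 h23))

/-- The symmetry condition at a point. -/
def Condition (a k ρ : ℝ) : Prop :=
  ∀ q0 q1 q2 q3 h00 h01 h02 h03 h11 h12 h13 h22 h23 h33 : ℝ,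
    h33 + k * q3 - a ^ 2 * (h00 + ρ * q0 + ρ ^ 2 * h11 + h22) = 0 →
    σ.poly a k ρ q0 q1 q2 q3 h00 h01 h02 h03 h11 h12 h13 h22 h23 h33 = 0

/-- The telegraph operator applied to a component. -/
def wave (a k ρ : ℝ) (f f₂ : Fin 4 → ℝ) : ℝ :=
  f₂ 3 + k * f 3 - a ^ 2 * (f₂ 0 + ρ * f 0 + ρ ^ 2 * f₂ 1 + f₂ 2)

/-- The conformal equations at a point. -/
structure Conformal (a k ρ : ℝ) : Prop where
  d11 : σ.X 0 0 = σ.X 3 3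
  d22 : ρ * σ.x + σ.X 1 1 = σ.X 3 3
  d33 : σ.X 2 2 = σ.X 3 3
  d12 : σ.X 1 0 + ρ ^ 2 * σ.X 0 1 = 0
  d13 : σ.X 0 2 + σ.X 2 0 = 0
  d23 : σ.X 1 2 + ρ ^ 2 * σ.X 2 1 = 0
  d14 : σ.X 0 3 = a ^ 2 * σ.X 3 0
  d24 : σ.X 1 3 = a ^ 2 * ρ ^ 2 * σ.X 3 1
  d34 : σ.X 2 3 = a ^ 2 * σ.X 3 2
  uu : σ.Nᵤᵤ = 0
  e1 : a ^ 2 * (-2 * σ.Nᵢᵤ 0 + ρ ^ 2 * σ.x - 2 * ρ * σ.X 3 3) = wave a k ρ (σ.X 0) (σ.X₂ 0)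
  e2 : -2 * a ^ 2 * ρ ^ 2 * σ.Nᵢᵤ 1 = wave a k ρ (σ.X 1) (σ.X₂ 1)
  e3 : -2 * a ^ 2 * σ.Nᵢᵤ 2 = wave a k ρ (σ.X 2) (σ.X₂ 2)
  e4 : 2 * σ.Nᵢᵤ 3 + 2 * k * σ.X 3 3 = wave a k ρ (σ.X 3) (σ.X₂ 3)
  e5 : wave a k ρ σ.N σ.N₂ = 0

variable {σ} {a k ρ : ℝ}

/-- `∂_u ξ_l` is isolated by the monomial `q0 h0l` for `l ≠ 0` and by `q1 h01` for `l = 0`. A mixed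
second difference of four evaluations extracts its coefficient. -/
lemma Condition.Xᵤ_eq_zero (ha : a ≠ 0) (hρ : ρ ≠ 0) (H : σ.Condition a k ρ) (l : Fin 4) :
    σ.Xᵤ l = 0 := by
  have ha2 : a ^ 2 ≠ 0 := pow_ne_zero 2 ha
  have hρ2 : ρ ^ 2 ≠ 0 := pow_ne_zero 2 hρ
  simp only [Condition, poly, phi, phi₂, second] at H
  -- The last argument is always the value of `h33` that the equation forces on the other
  -- coordinates.
  have z := H 0 0 0 0 0 0 0 0 0 0 0 0 0 (-k * (0) + a ^ 2 * ((0) + ρ * (0) + ρ ^ 2 * (0) + (0))) (by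
      ring)
  have z1 := H 0 0 0 0 0 1 0 0 0 0 0 0 0 (-k * (0) + a ^ 2 * ((0) + ρ * (0) + ρ ^ 2 * (0) + (0)))
      (by ring)
  have z2 := H 0 0 0 0 0 0 1 0 0 0 0 0 0 (-k * (0) + a ^ 2 * ((0) + ρ * (0) + ρ ^ 2 * (0) + (0)))
      (by ring)
  have z3 := H 0 0 0 0 0 0 0 1 0 0 0 0 0 (-k * (0) + a ^ 2 * ((0) + ρ * (0) + ρ ^ 2 * (0) + (0)))
      (by ring)
  have a0 := H 1 0 0 0 0 0 0 0 0 0 0 0 0 (-k * (0) + a ^ 2 * ((0) + ρ * (1) + ρ ^ 2 * (0) + (0)))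
      (by ring)
  have a01 := H 1 0 0 0 0 1 0 0 0 0 0 0 0 (-k * (0) + a ^ 2 * ((0) + ρ * (1) + ρ ^ 2 * (0) + (0)))
      (by ring)
  have a02 := H 1 0 0 0 0 0 1 0 0 0 0 0 0 (-k * (0) + a ^ 2 * ((0) + ρ * (1) + ρ ^ 2 * (0) + (0)))
      (by ring)
  have a03 := H 1 0 0 0 0 0 0 1 0 0 0 0 0 (-k * (0) + a ^ 2 * ((0) + ρ * (1) + ρ ^ 2 * (0) + (0)))
      (by ring)
  have b1 := H 0 1 0 0 0 0 0 0 0 0 0 0 0 (-k * (0) + a ^ 2 * ((0) + ρ * (0) + ρ ^ 2 * (0) + (0)))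
      (by ring)
  have b01 := H 0 1 0 0 0 1 0 0 0 0 0 0 0 (-k * (0) + a ^ 2 * ((0) + ρ * (0) + ρ ^ 2 * (0) + (0)))
      (by ring)
  match l with
  | 0 =>
    apply (mul_right_inj' hρ2).1; apply (mul_right_inj' ha2).1
    linear_combination (1 / 2) * (b01 - b1 - z1 + z)
  | 1 =>
    apply (mul_right_inj' ha2).1
    linear_combination (1 / 2) * (a01 - a0 - z1 + z)
  | 2 =>
    apply (mul_right_inj' ha2).1
    linear_combination (1 / 2) * (a02 - a0 - z2 + z)
  | 3 =>
    apply (mul_right_inj' ha2).1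
    linear_combination (1 / 2) * (a03 - a0 - z3 + z)

/-- Once `ξ` does not depend on `u`, the condition is affine in the `h` and at most quadratic in the
`q`. The coefficients of the `h` give the conformal equations, the even part in `q0` gives `η_uu =
0`, the odd parts in the `q` give `e1`–`e4`, and the constant term gives `e5`. -/
lemma Condition.conformal (ha : a ≠ 0) (hρ : ρ ≠ 0) (H : σ.Condition a k ρ)
    (hu : ∀ l, σ.Xᵤ l = 0) (hiu : ∀ l i, σ.Xᵢᵤ l i = 0) (huu : ∀ l, σ.Xᵤᵤ l = 0) :
    σ.Conformal a k ρ := by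
  have ha2 : a ^ 2 ≠ 0 := pow_ne_zero 2 ha
  have hρ2 : ρ ^ 2 ≠ 0 := pow_ne_zero 2 hρ
  simp only [Condition, poly, phi, phi₂, second, hu, hiu, huu, mul_zero, add_zero] at H
  have z := H 0 0 0 0 0 0 0 0 0 0 0 0 0 (-k * (0) + a ^ 2 * ((0) + ρ * (0) + ρ ^ 2 * (0) + (0))) (by
      ring)
  have z00 := H 0 0 0 0 1 0 0 0 0 0 0 0 0 (-k * (0) + a ^ 2 * ((1) + ρ * (0) + ρ ^ 2 * (0) + (0)))
      (by ring)
  have z01 := H 0 0 0 0 0 1 0 0 0 0 0 0 0 (-k * (0) + a ^ 2 * ((0) + ρ * (0) + ρ ^ 2 * (0) + (0)))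
      (by ring)
  have z02 := H 0 0 0 0 0 0 1 0 0 0 0 0 0 (-k * (0) + a ^ 2 * ((0) + ρ * (0) + ρ ^ 2 * (0) + (0)))
      (by ring)
  have z03 := H 0 0 0 0 0 0 0 1 0 0 0 0 0 (-k * (0) + a ^ 2 * ((0) + ρ * (0) + ρ ^ 2 * (0) + (0)))
      (by ring)
  have z11 := H 0 0 0 0 0 0 0 0 1 0 0 0 0 (-k * (0) + a ^ 2 * ((0) + ρ * (0) + ρ ^ 2 * (1) + (0)))
      (by ring)
  have z12 := H 0 0 0 0 0 0 0 0 0 1 0 0 0 (-k * (0) + a ^ 2 * ((0) + ρ * (0) + ρ ^ 2 * (0) + (0)))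
      (by ring)
  have z13 := H 0 0 0 0 0 0 0 0 0 0 1 0 0 (-k * (0) + a ^ 2 * ((0) + ρ * (0) + ρ ^ 2 * (0) + (0)))
      (by ring)
  have z22 := H 0 0 0 0 0 0 0 0 0 0 0 1 0 (-k * (0) + a ^ 2 * ((0) + ρ * (0) + ρ ^ 2 * (0) + (1)))
      (by ring)
  have z23 := H 0 0 0 0 0 0 0 0 0 0 0 0 1 (-k * (0) + a ^ 2 * ((0) + ρ * (0) + ρ ^ 2 * (0) + (0)))
      (by ring)
  have p0 := H 1 0 0 0 0 0 0 0 0 0 0 0 0 (-k * (0) + a ^ 2 * ((0) + ρ * (1) + ρ ^ 2 * (0) + (0)))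
      (by ring)
  have n0 := H (-1) 0 0 0 0 0 0 0 0 0 0 0 0 (-k * (0) + a ^ 2 * ((0) + ρ * (-1) + ρ ^ 2 * (0) +
      (0))) (by ring)
  have p1 := H 0 1 0 0 0 0 0 0 0 0 0 0 0 (-k * (0) + a ^ 2 * ((0) + ρ * (0) + ρ ^ 2 * (0) + (0)))
      (by ring)
  have n1 := H 0 (-1) 0 0 0 0 0 0 0 0 0 0 0 (-k * (0) + a ^ 2 * ((0) + ρ * (0) + ρ ^ 2 * (0) + (0)))
      (by ring)
  have p2 := H 0 0 1 0 0 0 0 0 0 0 0 0 0 (-k * (0) + a ^ 2 * ((0) + ρ * (0) + ρ ^ 2 * (0) + (0)))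
      (by ring)
  have n2 := H 0 0 (-1) 0 0 0 0 0 0 0 0 0 0 (-k * (0) + a ^ 2 * ((0) + ρ * (0) + ρ ^ 2 * (0) + (0)))
      (by ring)
  have p3 := H 0 0 0 1 0 0 0 0 0 0 0 0 0 (-k * (1) + a ^ 2 * ((0) + ρ * (0) + ρ ^ 2 * (0) + (0)))
      (by ring)
  have n3 := H 0 0 0 (-1) 0 0 0 0 0 0 0 0 0 (-k * (-1) + a ^ 2 * ((0) + ρ * (0) + ρ ^ 2 * (0) +
      (0))) (by ring)
  refine ⟨?_, ?_, ?_, ?_, ?_, ?_, ?_, ?_, ?_, ?_, ?_, ?_, ?_, ?_, ?_⟩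
  · apply (mul_right_inj' ha2).1
    linear_combination (1 / 2) * (z00 - z)
  · apply (mul_right_inj' ha2).1; apply (mul_right_inj' hρ2).1
    linear_combination (1 / 2) * (z11 - z)
  · apply (mul_right_inj' ha2).1
    linear_combination (1 / 2) * (z22 - z)
  · apply (mul_right_inj' ha2).1
    linear_combination (1 / 2) * (z01 - z)
  · apply (mul_right_inj' ha2).1
    linear_combination (1 / 2) * (z02 - z)
  · apply (mul_right_inj' ha2).1
    linear_combination (1 / 2) * (z12 - z)
  · linear_combination (-1 / 2) * (z03 - z)
  · linear_combination (-1 / 2) * (z13 - z)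
  · linear_combination (-1 / 2) * (z23 - z)
  · apply (mul_right_inj' ha2).1
    linear_combination (-1 / 2) * (p0 + n0) + z
  · simp only [wave]
    linear_combination (1 / 2) * (p0 - n0)
  · simp only [wave]
    linear_combination (1 / 2) * (p1 - n1)
  · simp only [wave]
    linear_combination (1 / 2) * (p2 - n2)
  · simp only [wave]
    linear_combination (1 / 2) * (p3 - n3)
  · simp only [wave]
    linear_combination z

/-- Modulo the conformal equations, the prolonged field maps the equation to `η_u - 2 f` times
itself, where `f = ∂_t ξ₄`. -/
lemma Conformal.condition (h : σ.Conformal a k ρ) (hu : ∀ l, σ.Xᵤ l = 0)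
    (hiu : ∀ l i, σ.Xᵢᵤ l i = 0) (huu : ∀ l, σ.Xᵤᵤ l = 0) : σ.Condition a k ρ := by
  intro q0 q1 q2 q3 h00 h01 h02 h03 h11 h12 h13 h22 h23 h33 hq
  obtain ⟨d11, d22, d33, d12, d13, d23, d14, d24, d34, uu, e1, e2, e3, e4, e5⟩ := h
  simp only [wave] at e1 e2 e3 e4 e5
  simp only [poly, phi, phi₂, second, hu, hiu, huu, mul_zero, add_zero]
  linear_combination e5 + q0 * e1 + q1 * e2 + q2 * e3 + q3 * e4 + (σ.Nᵤ - 2 * σ.X 3 3) * hq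
    + 2 * a ^ 2 * (h00 * d11 + h11 * ρ ^ 2 * d22 + h22 * d33 + h01 * d12 + h02 * d13 + h12 * d23)
    - 2 * (h03 * d14 + h13 * d24 + h23 * d34)
    + (q3 ^ 2 - a ^ 2 * (q0 ^ 2 + ρ ^ 2 * q1 ^ 2 + q2 ^ 2)) * uu

end Symbols
end Telegraph
end

/-! ### From the jet condition to the conformal system -/

noncomputable section
namespace Telegraph
open SmoothFun

namespace SmoothFun

lemma mk_eq_zero {F : Total → ℝ} {hF : ContDiffOn ℝ ∞ F domain} :
    mk F hF = 0 ↔ ∀ p ∈ domain, F p = 0 := SmoothFun.ext_iff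

variable (f g : SmoothFun) (x : domain)

lemma val_add : (f + g).1 x = f.1 x + g.1 x := rfl
lemma val_sub : (f - g).1 x = f.1 x - g.1 x := rfl
lemma val_mul : (f * g).1 x = f.1 x * g.1 x := rfl
lemma val_neg : (-f).1 x = -f.1 x := rfl
lemma val_pow (n : ℕ) : (f ^ n).1 x = f.1 x ^ n := rfl
lemma val_zero : (0 : SmoothFun).1 x = 0 := rfl
lemma val_two : (2 : SmoothFun).1 x = 2 := rfl
lemma val_algebraMap (c : ℝ) : (algebraMap ℝ SmoothFun c).1 x = c := rfl
lemma val_r : polarCalculus.r.1 x = x.1.1 0 := rfl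

end SmoothFun

/-- The symbols of a vector field at a point. -/
def symbolsAt (V : Total → Total) (p : Total) : Symbols where
  x := xi V 0 p
  X l i := dz i (xi V l) p
  X₂ l i := dz i (dz i (xi V l)) p
  Xᵢᵤ l i := dz i (du (xi V l)) p
  Xᵤ l := du (xi V l) p
  Xᵤᵤ l := du (du (xi V l)) p
  N i := dz i (eta V) p
  N₂ i := dz i (dz i (eta V)) p
  Nᵢᵤ i := dz i (du (eta V)) p
  Nᵤ := du (eta V) p
  Nᵤᵤ := du (du (eta V)) p

lemma du_dz {f : Total → ℝ} (hf : ContDiffOn ℝ ∞ f domain) (i : Fin 4) {p : Total}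
    (hp : p ∈ domain) : du (dz i f) p = dz i (du f) p := by
  have h := polarCalculus.comm_u i (mk f hf)
  rw [D_mk, Du_mk, Du_mk, D_mk] at h
  exact mk_eq_mk.1 h hp

variable {V : Total → Total} {a k : ℝ}

lemma prolong_telegraph (hV : ContDiffOn ℝ ∞ V domain) {j : Jet} (hj : j.1 ∈ baseDomain) :
    prolong 2 V (telegraph a k) j = (symbolsAt V (j.1, j.2 0)).poly a k (1 / j.1 0)
      (j.2 {0}) (j.2 {1}) (j.2 {2}) (j.2 {3}) (j.2 {0, 0}) (j.2 {0, 1}) (j.2 {0, 2}) (j.2 {0, 3})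
      (j.2 {1, 1}) (j.2 {1, 2}) (j.2 {1, 3}) (j.2 {2, 2}) (j.2 {2, 3}) (j.2 {3, 3}) := by
  have hp : (j.1, j.2 0) ∈ domain := hj
  have hη i := du_dz (contDiffOn_eta hV) i hp
  have hξ l i := du_dz (contDiffOn_xi hV l) i hp
  have c (i l : Fin 4) : (i ::ₘ {l} : Multiset (Fin 4)) = {i, l} := rfl
  rw [prolong, finsum_prolongCoeff_telegraph]
  simp only [prolongCoeff_singleton hV hj, prolongCoeff_pair hV hj, jetDz_telegraph a k hj,
    Fin.sum_univ_four, c, Multiset.pair_comm (1 : Fin 4) 0, Multiset.pair_comm (2 : Fin 4) 0,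
    Multiset.pair_comm (3 : Fin 4) 0, Multiset.pair_comm (2 : Fin 4) 1, Multiset.pair_comm (3 : Fin
        4) 1, Multiset.pair_comm (3 : Fin 4) 2,
    totalDZero₂, totalDZero, hη, hξ]
  simp only [Symbols.poly, Symbols.phi, Symbols.phi₂, Symbols.second, symbolsAt, Fin.isValue,
    Fin.reduceEq, if_true, if_false, one_ne_zero]
  ring

lemma sym2_eq_of_pair_eq : ∀ b c i l : Fin 4, ({b, c} : Multiset (Fin 4)) = {i, l} →
    s(b, c) = s(i, l) := by decide

/-- Comparing coefficients requires jets with freely prescribed entries. Second-order values are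
indexed by unordered pairs, so the order chosen by `Multiset.toList` is immaterial. -/
lemma exists_jet (z : Base) (u : ℝ) (q : Fin 4 → ℝ) (h : Sym2 (Fin 4) → ℝ) :
    ∃ j : Jet, j.1 = z ∧ j.2 0 = u ∧ (∀ i, j.2 {i} = q i) ∧ ∀ i l, j.2 {i, l} = h s(i, l) := by
  refine ⟨(z, fun J => match J.toList with
    | [] => u
    | [i] => q i
    | [i, l] => h s(i, l)
    | _ => 0), rfl, by simp, fun i => by simp, fun i l => ?_⟩
  have hl : ({i, l} : Multiset (Fin 4)).toList.length = 2 := by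
    rw [Multiset.length_toList, Multiset.card_pair]
  obtain ⟨b, c, hbc⟩ := List.length_eq_two.1 hl
  have hm : ({b, c} : Multiset (Fin 4)) = {i, l} := by
    have := Multiset.coe_toList ({i, l} : Multiset (Fin 4))
    rw [hbc] at this
    exact this
  simp only [hbc]
  exact congrArg h (sym2_eq_of_pair_eq b c i l hm)

lemma isPointSymmetry_iff_condition (hV : ContDiffOn ℝ ∞ V domain) :
    IsPointSymmetry a k V ↔ ∀ p ∈ domain, (symbolsAt V p).Condition a k (1 / p.1 0) := by
  constructor
  · rintro ⟨-, h⟩ ⟨z, u⟩ hp q0 q1 q2 q3 h00 h01 h02 h03 h11 h12 h13 h22 h23 h33 hq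
    obtain ⟨j, rfl, rfl, hj1, hj2⟩ := exists_jet z u ![q0, q1, q2, q3] (Sym2.lift
      ⟨fun i l => ![![h00, h01, h02, h03], ![h01, h11, h12, h13], ![h02, h12, h22, h23],
        ![h03, h13, h23, h33]] i l, fun i l => by fin_cases i <;> fin_cases l <;> rfl⟩)
    have hj := h j hp
    rw [prolong_telegraph hV hp] at hj
    simp only [telegraph, hj1, hj2, ← one_div_pow] at hj
    exact hj hq
  · intro h
    refine ⟨hV, fun j hj hj0 => ?_⟩
    rw [prolong_telegraph hV hj]
    exact h (j.1, j.2 0) hj _ _ _ _ _ _ _ _ _ _ _ _ _ _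
      (by rwa [one_div_pow])

lemma isPointSymmetry_iff_isConformal (ha : a ≠ 0) (hV : ContDiffOn ℝ ∞ V domain) :
    IsPointSymmetry a k V ↔ IsConformal polarCalculus a k (mk (xi V 0) (contDiffOn_xi hV 0))
      (mk (xi V 1) (contDiffOn_xi hV 1)) (mk (xi V 2) (contDiffOn_xi hV 2))
      (mk (xi V 3) (contDiffOn_xi hV 3)) (mk (eta V) (contDiffOn_eta hV)) := by
  rw [isPointSymmetry_iff_condition hV]
  constructor
  · intro h
    -- `∂_u ξ_l = 0` has to be known on the whole domain first: differentiating it supplies the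
    -- vanishing of `∂_i ∂_u ξ_l` and `∂_u² ξ_l` that the pointwise comparison needs.
    have hu (l) : polarCalculus.Du (mk (xi V l) (contDiffOn_xi hV l)) = 0 := by
      rw [Du_mk]
      exact mk_eq_zero.2 fun p hp => (h p hp).Xᵤ_eq_zero ha (one_div_ne_zero (ne_of_gt hp)) l
    have hc : ∀ p ∈ domain, (symbolsAt V p).Conformal a k (1 / p.1 0) := by
      intro p hp
      refine (h p hp).conformal ha (one_div_ne_zero (ne_of_gt hp)) (fun l => ?_)
        (fun l i => ?_) fun l => ?_
      · have := hu l
        rw [Du_mk] at this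
        exact mk_eq_zero.1 this p hp
      · have := congrArg (polarCalculus.D i) (hu l)
        rw [Du_mk, D_mk, map_zero] at this
        exact mk_eq_zero.1 this p hp
      · have := congrArg polarCalculus.Du (hu l)
        rw [Du_mk, Du_mk, map_zero] at this
        exact mk_eq_zero.1 this p hp
    refine ⟨⟨hu 0, hu 1, hu 2, hu 3, ?_, ?_, ?_, ?_, ?_, ?_, ?_, ?_, ?_⟩, ?_, ?_, ?_, ?_, ?_, ?_⟩
    all_goals
      simp only [PolarCalculus.L, D_mk, Du_mk]
      refine SmoothFun.ext_iff.2 fun p hp => ?_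
      obtain ⟨d11, d22, d33, d12, d13, d23, d14, d24, d34, uu, e1, e2, e3, e4, e5⟩ := hc p hp
      -- The pointwise system is written with `ρ = 1 / r`, the algebraic one with denominators
      -- cleared; `hr` and `hr2` convert one into the other.
      have hr : p.1 0 * (1 / p.1 0) = 1 := mul_one_div_cancel (ne_of_gt hp)
      have hr2 : p.1 0 ^ 2 * (1 / p.1 0) ^ 2 = 1 := by rw [← mul_pow, hr, one_pow]
      simp only [Symbols.wave, symbolsAt, val_add, val_sub, val_mul, val_neg, val_pow, val_zero,
        val_two, val_algebraMap, val_r, mk_apply] at *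
      generalize 1 / p.1 0 = ρ at *
      generalize p.1 0 = r at *
    · linear_combination d11
    · linear_combination r * d22 - xi V 0 p * hr
    · linear_combination d33
    · linear_combination r ^ 2 * d12 - dz 1 (xi V 0) p * hr2
    · linear_combination d13
    · linear_combination r ^ 2 * d23 - dz 1 (xi V 2) p * hr2
    · linear_combination d14
    · linear_combination r ^ 2 * d24 + a ^ 2 * dz 1 (xi V 3) p * hr2
    · linear_combination d34
    · linear_combination uu
    · linear_combination r ^ 2 * e1 - a ^ 2 * xi V 0 p * hr2 + 2 * a ^ 2 * r * dz 3 (xi V 3) p *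
        hr - a ^ 2 * (r * dz 0 (xi V 0) p * hr + dz 1 (dz 1 (xi V 0)) p * hr2)
    · linear_combination r ^ 2 * e2 + 2 * a ^ 2 * dz 1 (du (eta V)) p * hr2 - a ^ 2 * (r * dz 0
        (xi V 1) p * hr + dz 1 (dz 1 (xi V 1)) p * hr2)
    · linear_combination r ^ 2 * e3 - a ^ 2 * (r * dz 0 (xi V 2) p * hr + dz 1 (dz 1 (xi V 2)) p *
        hr2)
    · linear_combination r ^ 2 * e4 - a ^ 2 * (r * dz 0 (xi V 3) p * hr + dz 1 (dz 1 (xi V 3)) p *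
        hr2)
    · linear_combination r ^ 2 * e5 + a ^ 2 * (r * dz 0 (eta V) p * hr + dz 1 (dz 1 (eta V)) p *
        hr2)
  · intro h p hp
    obtain ⟨⟨u1, u2, u3, u4, d11, d22, d33, d12, d13, d23, d14, d24, d34⟩, uu, e1, e2, e3, e4,
      e5⟩ := h
    have hu (l) : polarCalculus.Du (mk (xi V l) (contDiffOn_xi hV l)) = 0 := by
      match l with
      | 0 => exact u1
      | 1 => exact u2
      | 2 => exact u3
      | 3 => exact u4
    refine Symbols.Conformal.condition ?_ (fun l => ?_) (fun l i => ?_) fun l => ?_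
    · have hr : p.1 0 * (1 / p.1 0) = 1 := mul_one_div_cancel (ne_of_gt hp)
      have hr2 : p.1 0 ^ 2 * (1 / p.1 0) ^ 2 = 1 := by rw [← mul_pow, hr, one_pow]
      simp only [D_mk, Du_mk] at d11 d22 d33 d12 d13 d23 d14 d24 d34 uu
      simp only [PolarCalculus.L, D_mk, Du_mk] at e1 e2 e3 e4 e5
      replace d11 := SmoothFun.ext_iff.1 d11 p hp
      replace d22 := SmoothFun.ext_iff.1 d22 p hp
      replace d33 := SmoothFun.ext_iff.1 d33 p hp
      replace d12 := SmoothFun.ext_iff.1 d12 p hp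
      replace d13 := SmoothFun.ext_iff.1 d13 p hp
      replace d23 := SmoothFun.ext_iff.1 d23 p hp
      replace d14 := SmoothFun.ext_iff.1 d14 p hp
      replace d24 := SmoothFun.ext_iff.1 d24 p hp
      replace d34 := SmoothFun.ext_iff.1 d34 p hp
      replace uu := SmoothFun.ext_iff.1 uu p hp
      replace e1 := SmoothFun.ext_iff.1 e1 p hp
      replace e2 := SmoothFun.ext_iff.1 e2 p hp
      replace e3 := SmoothFun.ext_iff.1 e3 p hp
      replace e4 := SmoothFun.ext_iff.1 e4 p hp
      replace e5 := SmoothFun.ext_iff.1 e5 p hp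
      constructor
      all_goals
        simp only [Symbols.wave, symbolsAt, val_add, val_sub, val_mul, val_neg, val_pow, val_zero,
          val_two, val_algebraMap, val_r, mk_apply] at *
        generalize 1 / p.1 0 = ρ at *
        generalize p.1 0 = r at *
      · linear_combination d11
      · linear_combination ρ * d22 - (dz 1 (xi V 1) p - dz 3 (xi V 3) p) * hr
      · linear_combination d33
      · linear_combination ρ ^ 2 * d12 - dz 0 (xi V 1) p * hr2
      · linear_combination d13
      · linear_combination ρ ^ 2 * d23 - dz 2 (xi V 1) p * hr2
      · linear_combination d14
      · linear_combination ρ ^ 2 * d24 - dz 3 (xi V 1) p * hr2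
      · linear_combination d34
      · linear_combination uu
      · linear_combination ρ ^ 2 * e1 + a ^ 2 * (2 * dz 0 (du (eta V)) p * hr2 + 2 * ρ * dz 3 (xi
          V 3) p * hr) + (dz 3 (dz 3 (xi V 0)) p + k * dz 3 (xi V 0) p - a ^ 2 * (dz 0 (dz 0 (xi V
          0)) p + dz 2 (dz 2 (xi V 0)) p)) * hr2 - a ^ 2 * ρ * dz 0 (xi V 0) p * hr
      · linear_combination ρ ^ 2 * e2 + (dz 3 (dz 3 (xi V 1)) p + k * dz 3 (xi V 1) p - a ^ 2 *
          (dz 0 (dz 0 (xi V 1)) p + dz 2 (dz 2 (xi V 1)) p)) * hr2 - a ^ 2 * ρ * dz 0 (xi V 1) p *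
          hr
      · linear_combination ρ ^ 2 * e3 + 2 * a ^ 2 * dz 2 (du (eta V)) p * hr2 + (dz 3 (dz 3 (xi V
          2)) p + k * dz 3 (xi V 2) p - a ^ 2 * (dz 0 (dz 0 (xi V 2)) p + dz 2 (dz 2 (xi V 2)) p))
          * hr2 - a ^ 2 * ρ * dz 0 (xi V 2) p * hr
      · linear_combination ρ ^ 2 * e4 - (2 * dz 3 (du (eta V)) p + 2 * k * dz 3 (xi V 3) p) * hr2
          + (dz 3 (dz 3 (xi V 3)) p + k * dz 3 (xi V 3) p - a ^ 2 * (dz 0 (dz 0 (xi V 3)) p + dz 2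
          (dz 2 (xi V 3)) p)) * hr2 - a ^ 2 * ρ * dz 0 (xi V 3) p * hr
      · linear_combination ρ ^ 2 * e5 - (dz 3 (dz 3 (eta V)) p + k * dz 3 (eta V) p - a ^ 2 * (dz
          0 (dz 0 (eta V)) p + dz 2 (dz 2 (eta V)) p)) * hr2 + a ^ 2 * ρ * dz 0 (eta V) p * hr
    · have := hu l
      rw [Du_mk] at this
      exact mk_eq_zero.1 this p hp
    · have := congrArg (polarCalculus.D i) (hu l)
      rw [Du_mk, D_mk, map_zero] at this
      exact mk_eq_zero.1 this p hp
    · have := congrArg polarCalculus.Du (hu l)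
      rw [Du_mk, Du_mk, map_zero] at this
      exact mk_eq_zero.1 this p hp

end Telegraph
end

/-! ### Superposition fields and the symmetry algebra -/

noncomputable section
namespace Telegraph
open SmoothFun

section lift

lemma ContDiffOn.comp_fst {β : Base → ℝ} (hβ : ContDiffOn ℝ ∞ β baseDomain) :
    ContDiffOn ℝ ∞ (fun p : Total => β p.1) domain :=
  hβ.comp contDiffOn_fst fun _ hp => hp

/-- A smooth function of the independent variables as a function on the domain. -/
def lift (β : Base → ℝ) (hβ : ContDiffOn ℝ ∞ β baseDomain) : SmoothFun :=
  mk (fun p => β p.1) (ContDiffOn.comp_fst hβ)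

lemma contDiffOn_pd {β : Base → ℝ} (hβ : ContDiffOn ℝ ∞ β baseDomain) (i : Fin 4) :
    ContDiffOn ℝ ∞ (pd i β) baseDomain :=
  (hβ.fderiv_of_isOpen isOpen_baseDomain (m := ∞) (by simp)).clm_apply contDiffOn_const

lemma differentiableAt_of_contDiffOn {β : Base → ℝ} (hβ : ContDiffOn ℝ ∞ β baseDomain) {z : Base}
    (hz : z ∈ baseDomain) : DifferentiableAt ℝ β z :=
  (hβ.contDiffAt (isOpen_baseDomain.mem_nhds hz)).differentiableAt (by simp)

lemma fderiv_comp_fst {β : Base → ℝ} (hβ : ContDiffOn ℝ ∞ β baseDomain) {p : Total}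
    (hp : p ∈ domain) : fderiv ℝ (fun p : Total => β p.1) p
      = (fderiv ℝ β p.1).comp (ContinuousLinearMap.fst ℝ Base ℝ) :=
  ((differentiableAt_of_contDiffOn hβ (z := p.1) hp).hasFDerivAt.comp p hasFDerivAt_fst).fderiv

lemma D_lift {β : Base → ℝ} (hβ : ContDiffOn ℝ ∞ β baseDomain) (i : Fin 4) :
    polarCalculus.D i (lift β hβ) = lift (pd i β) (contDiffOn_pd hβ i) := by
  rw [lift, D_mk]
  refine mk_eq_mk.2 fun p hp => ?_
  simp only [dz, fderiv_comp_fst hβ hp]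
  rfl

lemma Du_lift {β : Base → ℝ} (hβ : ContDiffOn ℝ ∞ β baseDomain) :
    polarCalculus.Du (lift β hβ) = 0 := by
  rw [lift, Du_mk]
  refine mk_eq_zero.2 fun p hp => ?_
  simp only [du, fderiv_comp_fst hβ hp]
  exact map_zero (fderiv ℝ β p.1)

/-- The fibres of the domain over the base are whole lines, so a function with zero `u`-derivative
equals its restriction to `u = 0`. -/
lemma exists_lift {f : SmoothFun} (h : polarCalculus.Du f = 0) : ∃ β hβ, f = lift β hβ := by
  obtain ⟨F, hF, rfl⟩ := exists_mk f
  refine ⟨fun z => F (z, 0), hF.comp (contDiffOn_id.prodMk contDiffOn_const) fun _ hz => hz,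
    mk_eq_mk.2 ?_⟩
  rintro ⟨z, u⟩ hz
  rw [Du_mk] at h
  have hd (s : ℝ) : HasDerivAt (fun s => F (z, s)) 0 s := by
    have h1 : HasDerivAt (fun s : ℝ => (z, s)) ((0, 1) : Total) s :=
      (hasDerivAt_const s z).prodMk (hasDerivAt_id s)
    have h2 := (differentiableAt hF (p := (z, s)) hz).hasFDerivAt.comp_hasDerivAt s h1
    have h3 : fderiv ℝ F (z, s) (0, 1) = 0 := mk_eq_zero.1 h (z, s) hz
    rwa [h3] at h2
  exact is_const_of_deriv_eq_zero (fun s => (hd s).differentiableAt) (fun s => (hd s).deriv) u 0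

lemma pd_zero_mul {f : Base → ℝ} (hf : ContDiffOn ℝ ∞ f baseDomain) {z : Base}
    (hz : z ∈ baseDomain) : pd 0 (fun w => w 0 * f w) z = f z + z 0 * pd 0 f z := by
  have h1 : HasFDerivAt (fun w : Base => w 0) (ContinuousLinearMap.proj (R := ℝ) 0) z :=
    hasFDerivAt_apply 0 z
  have h2 := (differentiableAt_of_contDiffOn hf hz).hasFDerivAt
  rw [pd, (h1.fun_mul h2).fderiv]
  simp [pd]
  ring

lemma isSolution_iff {a k : ℝ} {β : Base → ℝ} (hβ : ContDiffOn ℝ ∞ β baseDomain) :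
    IsSolution a k β ↔ polarCalculus.L a k (lift β hβ) = 0 := by
  rw [IsSolution, and_iff_right hβ]
  simp only [PolarCalculus.L, D_lift, SmoothFun.ext_iff]
  have key (z : Base) (hz : z ∈ baseDomain) (u : ℝ) : (pd 3 (pd 3 β) z + k * pd 3 β z =
      a ^ 2 * (1 / z 0 * pd 0 (fun w => w 0 * pd 0 β w) z
        + 1 / z 0 ^ 2 * pd 1 (pd 1 β) z + pd 2 (pd 2 β) z)) ↔
      z 0 ^ 2 * pd 3 (pd 3 β) z + k * z 0 ^ 2 * pd 3 β z - a ^ 2 * (z 0 ^ 2 * pd 0 (pd 0 β) z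
        + z 0 * pd 0 β z + pd 1 (pd 1 β) z + z 0 ^ 2 * pd 2 (pd 2 β) z) = 0 := by
    have hr : z 0 ≠ 0 := ne_of_gt hz
    rw [pd_zero_mul (contDiffOn_pd hβ 0) hz]
    field_simp
    rw [← sub_eq_zero]
    refine Eq.congr ?_ rfl
    ring
  exact ⟨fun h p hp => (key p.1 hp p.2).1 (h p.1 hp), fun h z hz => (key z hz 0).2 (h (z, 0) hz)⟩

end lift

variable {a k : ℝ} {V : Total → Total}

lemma sum_gen (c : Fin 11 → ℝ) (p : Total) : ∑ i, c i • gen a k i p =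
    (![c 5 * Real.sin (p.1 1) - c 6 * Real.cos (p.1 1) - c 7 * p.1 2 * Real.cos (p.1 1)
        - c 8 * p.1 2 * Real.sin (p.1 1)
        + 2 * a ^ 2 * p.1 3 * (c 9 * Real.sin (p.1 1) - c 10 * Real.cos (p.1 1)),
      c 0 + (p.1 0)⁻¹ * (c 5 * Real.cos (p.1 1) + c 6 * Real.sin (p.1 1)
        + c 7 * p.1 2 * Real.sin (p.1 1) - c 8 * p.1 2 * Real.cos (p.1 1)
        + 2 * a ^ 2 * p.1 3 * (c 9 * Real.cos (p.1 1) + c 10 * Real.sin (p.1 1))),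
      c 1 + 2 * a ^ 2 * c 4 * p.1 3
        + p.1 0 * (c 7 * Real.cos (p.1 1) + c 8 * Real.sin (p.1 1)),
      c 2 + 2 * c 4 * p.1 2
        + 2 * p.1 0 * (c 9 * Real.sin (p.1 1) - c 10 * Real.cos (p.1 1))],
      p.2 * (c 3 - k * (c 4 * p.1 2
        + p.1 0 * (c 9 * Real.sin (p.1 1) - c 10 * Real.cos (p.1 1))))) := by
  simp only [Fin.sum_univ_succ]
  refine Prod.ext (funext fun i => ?_) ?_
  · fin_cases i <;> simp [gen, ofCoords] <;> ring
  · simp [gen, ofCoords]; ring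

lemma isCombination_iff (hV : ContDiffOn ℝ ∞ V domain) {β : Base → ℝ}
    (hβ : ContDiffOn ℝ ∞ β baseDomain) (c : Fin 11 → ℝ) :
    IsCombination polarCalculus a k (mk (xi V 0) (contDiffOn_xi hV 0))
      (mk (xi V 1) (contDiffOn_xi hV 1)) (mk (xi V 2) (contDiffOn_xi hV 2))
      (mk (xi V 3) (contDiffOn_xi hV 3)) (mk (eta V) (contDiffOn_eta hV))
      (fun i => algebraMap ℝ SmoothFun (c i)) (lift β hβ) ↔
    ∀ p ∈ domain, ∑ i, c i • gen a k i p = V p - superposition β p := by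
  simp only [IsCombination, SmoothFun.ext_iff, ← forall_and]
  refine forall_congr' fun p => forall_congr' fun hp => ?_
  rw [sum_gen, eq_comm (b := V p - _), sub_eq_iff_eq_add, Prod.ext_iff, funext_iff,
    Fin.forall_fin_succ, Fin.forall_fin_succ, Fin.forall_fin_succ, Fin.forall_fin_succ]
  simp only [superposition, Prod.fst_add, Prod.snd_add, add_zero, and_assoc, IsEmpty.forall_iff,
    true_and]
  exact Iff.rfl

lemma mem_span_iff (W : Total → Total) :
    domain.domRestrict W ∈
      Submodule.span ℝ (Set.range fun i => domain.domRestrict (gen a k i)) ↔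
    ∃ c : Fin 11 → ℝ, ∀ p ∈ domain, ∑ i, c i • gen a k i p = W p := by
  rw [Submodule.mem_span_range_iff_exists_fun]
  refine exists_congr fun c => ?_
  rw [funext_iff]
  simp [Set.domRestrict_apply]

lemma contDiffOn_gen (i : Fin 11) : ContDiffOn ℝ ∞ (gen a k i) domain := by
  have hc (j : Fin 4) : ContDiffOn ℝ ∞ (fun p : Total => p.1 j) domain :=
    (contDiff_coord j).contDiffOn
  have hs (j : Fin 4) : ContDiffOn ℝ ∞ (fun p : Total => Real.sin (p.1 j)) domain :=
    (contDiff_coord j).sin.contDiffOn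
  have hcs (j : Fin 4) : ContDiffOn ℝ ∞ (fun p : Total => Real.cos (p.1 j)) domain :=
    (contDiff_coord j).cos.contDiffOn
  have hi : ContDiffOn ℝ ∞ (fun p : Total => (p.1 0)⁻¹) domain :=
    (hc 0).inv fun p hp => ne_of_gt hp
  have hu : ContDiffOn ℝ ∞ (fun p : Total => p.2) domain := contDiffOn_snd
  fin_cases i <;> refine ContDiffOn.prodMk (contDiffOn_pi.2 fun j => ?_) ?_
  all_goals try fin_cases j
  all_goals try simp
  all_goals fun_prop

lemma contDiffOn_superposition {β : Base → ℝ} (hβ : ContDiffOn ℝ ∞ β baseDomain) :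
    ContDiffOn ℝ ∞ (superposition β) domain :=
  contDiffOn_const.prodMk (ContDiffOn.comp_fst hβ)

lemma isPointSymmetry_iff_isKilling (ha : a ≠ 0) (hk : k ≠ 0) (hV : ContDiffOn ℝ ∞ V domain) :
    IsPointSymmetry a k V ↔ IsKilling polarCalculus a k (mk (xi V 0) (contDiffOn_xi hV 0))
      (mk (xi V 1) (contDiffOn_xi hV 1)) (mk (xi V 2) (contDiffOn_xi hV 2))
      (mk (xi V 3) (contDiffOn_xi hV 3)) (mk (eta V) (contDiffOn_eta hV)) :=
  (isPointSymmetry_iff_isConformal ha hV).trans (isConformal_iff_isKilling ha hk)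

/-- Symmetries are the fields whose coefficients satisfy the determining equations. -/
theorem isPointSymmetry_iff_determiningEquations (ha : a ≠ 0) (hk : k ≠ 0)
    (hV : ContDiffOn ℝ ∞ V domain) : IsPointSymmetry a k V ↔ DeterminingEquations a k V :=
  ((isPointSymmetry_iff_isKilling ha hk hV).trans (isKilling_iff_determining ha)).trans
    (determining_iff hV)

/-- The symmetries are the combinations of the generators, up to superposition. -/
theorem isPointSymmetry_iff_mem_span (ha : a ≠ 0) (hk : k ≠ 0) :
    IsPointSymmetry a k V ↔ ∃ β : Base → ℝ, IsSolution a k β ∧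
      domain.domRestrict (V - superposition β) ∈
        Submodule.span ℝ (Set.range fun i => domain.domRestrict (gen a k i)) := by
  simp only [mem_span_iff, Pi.sub_apply]
  constructor
  · intro h
    have hV := h.1
    obtain ⟨c, f, hu, hL, hc⟩ :=
      ((isPointSymmetry_iff_isKilling ha hk hV).1 h).exists_isCombination ha
    obtain ⟨β, hβ, rfl⟩ := exists_lift hu
    exact ⟨β, (isSolution_iff hβ).2 hL, c, (isCombination_iff hV hβ c).1 hc⟩
  · rintro ⟨β, hβ, c, hc⟩
    -- Smoothness of `V` is part of being a symmetry; here it is inherited from the generators and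
    -- `β`.
    have hV : ContDiffOn ℝ ∞ V domain := by
      have hs : ContDiffOn ℝ ∞ (fun p => ∑ i, c i • gen a k i p) domain :=
        ContDiffOn.sum fun i _ => (contDiffOn_gen i).const_smul (c i)
      refine (hs.add (contDiffOn_superposition hβ.1)).congr fun p hp => ?_
      simp only [hc p hp]
      exact (sub_add_cancel _ _).symm
    exact (isPointSymmetry_iff_isKilling ha hk hV).2
      (((isCombination_iff hV hβ.1 c).2 hc).isKilling (Du_lift hβ.1) ((isSolution_iff hβ.1).1 hβ))

/-- A combination of the generators equal to a superposition field is trivial. -/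
lemma eq_zero_of_sum_gen_eq_superposition {c : Fin 11 → ℝ} {β : Base → ℝ}
    (h : ∀ p ∈ domain, ∑ i, c i • gen a k i p = superposition β p) : c = 0 := by
  have h (r x y t u : ℝ) (hr : 0 < r) := h (![r, x, y, t], u) hr
  simp only [sum_gen, superposition, Prod.ext_iff, funext_iff, Fin.forall_fin_succ] at h
  simp at h
  -- Five sample points suffice. `e1` and `e5` differ in `r` only and separate `c 10` from `c 2`;
  -- `e1` and `e6` differ in `u` only, so the value of `β` is the same in both and `e1` shows that
  -- it is zero.
  have e1 := h 1 0 0 0 0 one_pos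
  have e2 := h 1 (Real.pi / 2) 0 0 0 one_pos
  have e3 := h 1 0 1 0 0 one_pos
  have e5 := h 2 0 0 0 0 two_pos
  have e6 := h 1 0 0 0 1 one_pos
  simp at e1 e2 e3 e5 e6
  have h10 : c 10 = 0 := by linarith
  rw [h10, mul_zero] at e6
  refine funext fun i => ?_
  rw [Pi.zero_apply]
  fin_cases i
  all_goals
    simp only [Fin.reduceFinMk, Fin.zero_eta, Fin.mk_one, Fin.isValue]
    linarith

theorem linearIndependent_gen :
    LinearIndependent ℝ (fun i => domain.domRestrict (gen a k i)) := by
  rw [Fintype.linearIndependent_iff]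
  intro c hc
  refine congrFun (eq_zero_of_sum_gen_eq_superposition (a := a) (k := k) (β := 0) fun p hp => ?_)
  have h0 := congrFun hc ⟨p, hp⟩
  have h1 : ∑ i, c i • gen a k i p = 0 := by simpa [Set.domRestrict_apply] using h0
  exact h1

theorem eqOn_zero_of_superposition_mem_span {β : Base → ℝ}
    (h : domain.domRestrict (superposition β) ∈
      Submodule.span ℝ (Set.range fun i => domain.domRestrict (gen a k i))) :
    Set.EqOn β 0 baseDomain := by
  obtain ⟨c, hc⟩ := (mem_span_iff _).1 h
  intro z hz
  have h0 := hc (z, 0) hz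
  rw [eq_zero_of_sum_gen_eq_superposition hc] at h0
  simpa [superposition] using (congrArg Prod.snd h0).symm

end Telegraph
end

/-! ### Lie brackets of the generators -/

noncomputable section
namespace Telegraph

open Real in
/-- The derivative of the generators at a point in a direction. -/
def dgen (a k : ℝ) (i : Fin 11) (p v : Total) : Total :=
  match i with
  | 0 => (![0, 0, 0, 0], 0)
  | 1 => (![0, 0, 0, 0], 0)
  | 2 => (![0, 0, 0, 0], 0)
  | 3 => (![0, 0, 0, 0], v.2)
  | 4 => (![0, 0, 2 * a ^ 2 * v.1 3, 2 * v.1 2], -k * v.1 2 * p.2 + -k * p.1 2 * v.2)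
  | 5 => (![cos (p.1 1) * v.1 1,
      -v.1 0 / p.1 0 ^ 2 * cos (p.1 1) + (p.1 0)⁻¹ * (-sin (p.1 1) * v.1 1), 0, 0], 0)
  | 6 => (![-(-sin (p.1 1) * v.1 1),
      -v.1 0 / p.1 0 ^ 2 * sin (p.1 1) + (p.1 0)⁻¹ * (cos (p.1 1) * v.1 1), 0, 0], 0)
  | 7 => (![-v.1 2 * cos (p.1 1) + -p.1 2 * (-sin (p.1 1) * v.1 1),
      (-v.1 0 / p.1 0 ^ 2 * p.1 2 + (p.1 0)⁻¹ * v.1 2) * sin (p.1 1)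
        + (p.1 0)⁻¹ * p.1 2 * (cos (p.1 1) * v.1 1),
      v.1 0 * cos (p.1 1) + p.1 0 * (-sin (p.1 1) * v.1 1), 0], 0)
  | 8 => (![-v.1 2 * sin (p.1 1) + -p.1 2 * (cos (p.1 1) * v.1 1),
      (-(-v.1 0 / p.1 0 ^ 2) * p.1 2 + -(p.1 0)⁻¹ * v.1 2) * cos (p.1 1)
        + -(p.1 0)⁻¹ * p.1 2 * (-sin (p.1 1) * v.1 1),
      v.1 0 * sin (p.1 1) + p.1 0 * (cos (p.1 1) * v.1 1), 0], 0)
  | 9 => (![2 * a ^ 2 * v.1 3 * sin (p.1 1) + 2 * a ^ 2 * p.1 3 * (cos (p.1 1) * v.1 1),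
      (2 * a ^ 2 * v.1 3 * (p.1 0)⁻¹ + 2 * a ^ 2 * p.1 3 * (-v.1 0 / p.1 0 ^ 2)) * cos (p.1 1)
        + 2 * a ^ 2 * p.1 3 * (p.1 0)⁻¹ * (-sin (p.1 1) * v.1 1), 0,
      2 * v.1 0 * sin (p.1 1) + 2 * p.1 0 * (cos (p.1 1) * v.1 1)],
      (-k * v.1 0 * p.2 + -k * p.1 0 * v.2) * sin (p.1 1)
        + -k * p.1 0 * p.2 * (cos (p.1 1) * v.1 1))
  | 10 => (![-2 * a ^ 2 * v.1 3 * cos (p.1 1) + -2 * a ^ 2 * p.1 3 * (-sin (p.1 1) * v.1 1),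
      (2 * a ^ 2 * v.1 3 * (p.1 0)⁻¹ + 2 * a ^ 2 * p.1 3 * (-v.1 0 / p.1 0 ^ 2)) * sin (p.1 1)
        + 2 * a ^ 2 * p.1 3 * (p.1 0)⁻¹ * (cos (p.1 1) * v.1 1), 0,
      -2 * v.1 0 * cos (p.1 1) + -2 * p.1 0 * (-sin (p.1 1) * v.1 1)],
      (k * v.1 0 * p.2 + k * p.1 0 * v.2) * cos (p.1 1)
        + k * p.1 0 * p.2 * (-sin (p.1 1) * v.1 1))

open Real in
/-- The generators in coordinates. -/
lemma gen_apply (a k : ℝ) (i : Fin 11) (p : Total) : gen a k i p = match i with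
    | 0 => (![0, 1, 0, 0], 0)
    | 1 => (![0, 0, 1, 0], 0)
    | 2 => (![0, 0, 0, 1], 0)
    | 3 => (![0, 0, 0, 0], p.2)
    | 4 => (![0, 0, 2 * a ^ 2 * p.1 3, 2 * p.1 2], -k * p.1 2 * p.2)
    | 5 => (![sin (p.1 1), (p.1 0)⁻¹ * cos (p.1 1), 0, 0], 0)
    | 6 => (![-cos (p.1 1), (p.1 0)⁻¹ * sin (p.1 1), 0, 0], 0)
    | 7 => (![-p.1 2 * cos (p.1 1), (p.1 0)⁻¹ * p.1 2 * sin (p.1 1), p.1 0 * cos (p.1 1), 0], 0)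
    | 8 => (![-p.1 2 * sin (p.1 1), -(p.1 0)⁻¹ * p.1 2 * cos (p.1 1), p.1 0 * sin (p.1 1), 0], 0)
    | 9 => (![2 * a ^ 2 * p.1 3 * sin (p.1 1), 2 * a ^ 2 * p.1 3 * (p.1 0)⁻¹ * cos (p.1 1), 0,
        2 * p.1 0 * sin (p.1 1)], -k * p.1 0 * p.2 * sin (p.1 1))
    | 10 => (![-2 * a ^ 2 * p.1 3 * cos (p.1 1), 2 * a ^ 2 * p.1 3 * (p.1 0)⁻¹ * sin (p.1 1), 0,
        -2 * p.1 0 * cos (p.1 1)], k * p.1 0 * p.2 * cos (p.1 1)) := by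
  fin_cases i <;> rfl

variable {a k : ℝ}

/-- A vector in the total space from its five components. -/
lemma hasDerivAt_total {f₀ f₁ f₂ f₃ f₄ : ℝ → ℝ} {d₀ d₁ d₂ d₃ d₄ s : ℝ} (h₀ : HasDerivAt f₀ d₀ s)
    (h₁ : HasDerivAt f₁ d₁ s) (h₂ : HasDerivAt f₂ d₂ s) (h₃ : HasDerivAt f₃ d₃ s)
    (h₄ : HasDerivAt f₄ d₄ s) :
    HasDerivAt (fun s => ((![f₀ s, f₁ s, f₂ s, f₃ s], f₄ s) : Total))
      (![d₀, d₁, d₂, d₃], d₄) s := by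
  refine (hasDerivAt_pi.2 fun i => ?_).prodMk h₄
  fin_cases i <;> assumption

lemma hasDerivAt_gen (i : Fin 11) {γ : ℝ → Total} {v : Total} {s : ℝ} (h : HasDerivAt γ v s)
    (hs : γ s ∈ domain) : HasDerivAt (fun s => gen a k i (γ s)) (dgen a k i (γ s) v) s := by
  have hb (j : Fin 4) : HasDerivAt (fun s => (γ s).1 j) (v.1 j) s := hasDerivAt_pi.1 h.fst j
  have hr := hb 0
  have hy := hb 2
  have ht := hb 3
  have hu : HasDerivAt (fun s => (γ s).2) v.2 s := h.snd
  have hi := hr.fun_inv (ne_of_gt hs)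
  have hc := (hb 1).cos
  have hn := (hb 1).sin
  have z (c : ℝ) := hasDerivAt_const s c
  match i with
  | 0 => exact hasDerivAt_total (z _) (z _) (z _) (z _) (z _)
  | 1 => exact hasDerivAt_total (z _) (z _) (z _) (z _) (z _)
  | 2 => exact hasDerivAt_total (z _) (z _) (z _) (z _) (z _)
  | 3 => exact hasDerivAt_total (z _) (z _) (z _) (z _) hu
  | 4 =>
    exact hasDerivAt_total (z _) (z _) (ht.const_mul _) (hy.const_mul _)
      ((hy.const_mul _).fun_mul hu)
  | 5 =>
    exact hasDerivAt_total hn (hi.fun_mul hc) (z _) (z _) (z _)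
  | 6 =>
    exact hasDerivAt_total hc.fun_neg (hi.fun_mul hn) (z _) (z _) (z _)
  | 7 =>
    exact hasDerivAt_total (hy.fun_neg.fun_mul hc) ((hi.fun_mul hy).fun_mul hn)
      (hr.fun_mul hc) (z _) (z _)
  | 8 =>
    exact hasDerivAt_total (hy.fun_neg.fun_mul hn) ((hi.fun_neg.fun_mul hy).fun_mul hc)
      (hr.fun_mul hn) (z _) (z _)
  | 9 =>
    exact hasDerivAt_total ((ht.const_mul _).fun_mul hn)
      (((ht.const_mul _).fun_mul hi).fun_mul hc) (z _) ((hr.const_mul _).fun_mul hn)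
      (((hr.const_mul _).fun_mul hu).fun_mul hn)
  | 10 =>
    exact hasDerivAt_total ((ht.const_mul _).fun_mul hc)
      (((ht.const_mul _).fun_mul hi).fun_mul hn) (z _) ((hr.const_mul _).fun_mul hc)
      (((hr.const_mul _).fun_mul hu).fun_mul hc)

/-- Differentiating along the line `p + s v` reduces the derivative to one-variable product rules in
each component. -/
lemma fderiv_gen (i : Fin 11) {p : Total} (hp : p ∈ domain) (v : Total) :
    fderiv ℝ (gen a k i) p v = dgen a k i p v := by
  have hd : DifferentiableAt ℝ (gen a k i) p :=
    ((contDiffOn_gen i).contDiffAt (isOpen_domain.mem_nhds hp)).differentiableAt (by simp)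
  have hl : HasDerivAt (fun s : ℝ => p + s • v) v 0 := by
    simpa using ((hasDerivAt_id (0 : ℝ)).smul_const v).const_add p
  have e : p + (0 : ℝ) • v = p := by simp
  have h1 := hasDerivAt_gen (a := a) (k := k) i hl (by rwa [e])
  rw [← e] at hd
  have h2 := hd.hasFDerivAt.comp_hasDerivAt 0 hl
  rw [e] at h1 h2
  exact h2.unique h1

lemma lieBracket_gen (i j : Fin 11) {p : Total} (hp : p ∈ domain) :
    VectorField.lieBracket ℝ (gen a k i) (gen a k j) p
      = dgen a k j p (gen a k i p) - dgen a k i p (gen a k j p) := by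
  rw [VectorField.lieBracket, fderiv_gen _ hp, fderiv_gen _ hp]

lemma commutatorTable_swap {W : Type*} [AddCommGroup W] [Module ℝ W] (v : Fin 11 → W)
    (i j : Fin 11) : commutatorTable a k v j i = -commutatorTable a k v i j := by
  fin_cases i <;> fin_cases j <;> simp [commutatorTable]

end Telegraph
end

noncomputable section
namespace Telegraph
variable {a k : ℝ}

set_option maxHeartbeats 4000000 in
lemma dgen_sub_dgen {p : Total} (hp : p ∈ domain) (i j : Fin 11) (hij : i ≤ j) :
    dgen a k j p (gen a k i p) - dgen a k i p (gen a k j p)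
      = commutatorTable a k (gen a k) i j p := by
  obtain ⟨z, u⟩ := p
  have hr : z 0 ≠ 0 := ne_of_gt hp
  have hc := Real.cos_sq_add_sin_sq (z 1)
  clear hp
  fin_cases i <;> fin_cases j <;>
    first
    | exact absurd hij (by decide)
    | simp only [Fin.reduceFinMk, Fin.zero_eta, Fin.mk_one, Fin.isValue, commutatorTable, dgen,
        Matrix.cons_val, Pi.sub_apply, Pi.neg_apply, Pi.smul_apply, Pi.zero_apply,
        gen_apply]
      clear hij
      -- With `cos x`, `sin x`, `r` replaced by variables, each bracket is a rational identity
      -- modulo `C ^ 2 + S ^ 2 = 1`.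
      generalize Real.cos (z 1) = C at *
      generalize Real.sin (z 1) = S at *
      generalize z 0 = r at *
      refine Prod.ext (funext fun l => ?_) ?_
      · fin_cases l <;> simp <;> field_simp <;> grind
      · simp; try grind

theorem lieBracket_gen_eq_commutatorTable (i j : Fin 11) : Set.EqOn
    (VectorField.lieBracket ℝ (gen a k i) (gen a k j))
    (commutatorTable a k (gen a k) i j) domain := by
  intro p hp
  rw [lieBracket_gen i j hp]
  rcases le_total i j with h | h
  · exact dgen_sub_dgen hp i j h
  · rw [commutatorTable_swap, Pi.neg_apply, ← dgen_sub_dgen hp j i h, neg_sub]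

end Telegraph
end

/-! ### One-parameter groups in polar coordinates -/

noncomputable section
namespace Telegraph

section polar

variable (x X Y : ℝ)

/-- The point `(X, Y)` of the plane, rotated by `-x`. -/
def rotated : ℂ := (X + Y * Complex.I) * Complex.exp (-(x * Complex.I))

lemma exp_neg_mul_I : Complex.exp (-(x * Complex.I)) = ⟨Real.cos x, -Real.sin x⟩ := by
  rw [← neg_mul, ← Complex.ofReal_neg]
  apply Complex.ext
  · rw [Complex.exp_ofReal_mul_I_re, Real.cos_neg]
  · rw [Complex.exp_ofReal_mul_I_im, Real.sin_neg]

lemma rotated_re : (rotated x X Y).re = X * Real.cos x + Y * Real.sin x := by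
  simp [rotated, exp_neg_mul_I]

lemma rotated_im : (rotated x X Y).im = Y * Real.cos x - X * Real.sin x := by
  simp [rotated, exp_neg_mul_I]; ring

lemma norm_rotated : ‖rotated x X Y‖ = √(X ^ 2 + Y ^ 2) := by
  rw [Complex.norm_eq_sqrt_sq_add_sq, rotated_re, rotated_im]
  congr 1
  linear_combination (X ^ 2 + Y ^ 2) * Real.sin_sq_add_cos_sq x

lemma polar_eq (y t u : ℝ) : polar x X Y y t u
    = (![√(X ^ 2 + Y ^ 2), x + (rotated x X Y).arg, y, t], u) := rfl

lemma sqrt_mul_exp_arg : (√(X ^ 2 + Y ^ 2) : ℂ) *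
    Complex.exp ((x + (rotated x X Y).arg : ℝ) * Complex.I) = X + Y * Complex.I := by
  have h := Complex.norm_mul_exp_arg_mul_I (rotated x X Y)
  rw [norm_rotated] at h
  rw [Complex.ofReal_add, add_mul, Complex.exp_add, mul_left_comm, h, rotated, mul_left_comm,
    ← Complex.exp_add, add_neg_cancel, Complex.exp_zero, mul_one]

lemma sqrt_mul_cos_arg :
    √(X ^ 2 + Y ^ 2) * Real.cos (x + (rotated x X Y).arg) = X := by
  have h := congrArg Complex.re (sqrt_mul_exp_arg x X Y)
  rwa [Complex.re_ofReal_mul, Complex.exp_ofReal_mul_I_re, Complex.add_re, Complex.ofReal_re,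
    Complex.re_ofReal_mul, Complex.I_re, mul_zero, add_zero] at h

lemma sqrt_mul_sin_arg :
    √(X ^ 2 + Y ^ 2) * Real.sin (x + (rotated x X Y).arg) = Y := by
  have h := congrArg Complex.im (sqrt_mul_exp_arg x X Y)
  rwa [Complex.im_ofReal_mul, Complex.exp_ofReal_mul_I_im, Complex.add_im, Complex.ofReal_im,
    Complex.im_ofReal_mul, Complex.I_im, mul_one, zero_add] at h

lemma polar_self {r : ℝ} (hr : 0 < r) (y t u : ℝ) :
    polar x (r * Real.cos x) (r * Real.sin x) y t u = (![r, x, y, t], u) := by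
  have h1 : (r * Real.cos x) ^ 2 + (r * Real.sin x) ^ 2 = r ^ 2 := by
    linear_combination r ^ 2 * Real.cos_sq_add_sin_sq x
  have h2 : rotated x (r * Real.cos x) (r * Real.sin x) = r := by
    apply Complex.ext
    · rw [rotated_re, Complex.ofReal_re]
      linear_combination r * Real.cos_sq_add_sin_sq x
    · rw [rotated_im, Complex.ofReal_im]
      ring
  rw [polar_eq, h1, h2, Real.sqrt_sq hr.le, Complex.arg_ofReal_of_nonneg hr.le, add_zero]

variable {x X Y}

lemma polar_mem_domain {y t u : ℝ} : polar x X Y y t u ∈ domain ↔ 0 < X ^ 2 + Y ^ 2 :=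
  Real.sqrt_pos

/-- The angle is differentiated as the imaginary part of the logarithm, which is smooth on the slit
plane. The constant rotation by `-x` drops out of the logarithmic derivative. -/
lemma hasDerivAt_polar {X Y y t u : ℝ → ℝ} {X' Y' y' t' u' s : ℝ} (hX : HasDerivAt X X' s)
    (hY : HasDerivAt Y Y' s) (hy : HasDerivAt y y' s) (ht : HasDerivAt t t' s)
    (hu : HasDerivAt u u' s) (hw : rotated x (X s) (Y s) ∈ Complex.slitPlane) :
    HasDerivAt (fun τ => polar x (X τ) (Y τ) (y τ) (t τ) (u τ))
      (![X' * Real.cos (x + (rotated x (X s) (Y s)).arg)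
          + Y' * Real.sin (x + (rotated x (X s) (Y s)).arg),
        (√(X s ^ 2 + Y s ^ 2))⁻¹ * (Y' * Real.cos (x + (rotated x (X s) (Y s)).arg)
          - X' * Real.sin (x + (rotated x (X s) (Y s)).arg)), y', t'], u') s := by
  have hR : 0 < √(X s ^ 2 + Y s ^ 2) := by
    rw [← norm_rotated x, norm_pos_iff]
    exact Complex.slitPlane_ne_zero hw
  have hR2 : √(X s ^ 2 + Y s ^ 2) ^ 2 = X s ^ 2 + Y s ^ 2 := Real.sq_sqrt (by positivity)
  have hc := sqrt_mul_cos_arg x (X s) (Y s)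
  have hs := sqrt_mul_sin_arg x (X s) (Y s)
  have h1 : HasDerivAt (fun τ => rotated x (X τ) (Y τ))
      ((X' + Y' * Complex.I) * Complex.exp (-(x * Complex.I))) s :=
    (hX.ofReal_comp.fun_add (hY.ofReal_comp.mul_const _)).mul_const _
  have h2 := Complex.imCLM.hasFDerivAt.comp_hasDerivAt s (h1.clog_real hw)
  have h3 : (((X' + Y' * Complex.I) * Complex.exp (-(x * Complex.I))) / rotated x (X s) (Y s)).im
      = (Y' * X s - X' * Y s) / (X s ^ 2 + Y s ^ 2) := by
    rw [rotated, mul_div_mul_right _ _ (Complex.exp_ne_zero _), Complex.div_im]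
    simp [Complex.normSq_apply, ← sq, sub_div]
  have h4 : HasDerivAt (fun τ => (rotated x (X τ) (Y τ)).arg)
      ((Y' * X s - X' * Y s) / (X s ^ 2 + Y s ^ 2)) s := by
    rw [← h3]
    simpa only [Function.comp_def, Complex.imCLM_apply, Complex.log_im] using h2
  have h5 := ((hX.fun_pow 2).fun_add (hY.fun_pow 2)).sqrt (by rw [← hR2]; positivity)
  have h6 := hasDerivAt_total h5 (h4.const_add x) hy ht hu
  simp only [polar_eq]
  convert h6 using 4
  · generalize √(X s ^ 2 + Y s ^ 2) = R at *
    generalize x + (rotated x (X s) (Y s)).arg = θ at *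
    rw [← hc, ← hs]
    field_simp
    push_cast
    ring
  · generalize √(X s ^ 2 + Y s ^ 2) = R at *
    generalize x + (rotated x (X s) (Y s)).arg = θ at *
    rw [← hR2, ← hc, ← hs]
    field_simp

/-- A path on a vertical or horizontal line that avoids the origin does not meet the ray opposite
to its starting point. -/
lemma rotated_mem_slitPlane {r : ℝ} (hr : 0 < r) {X Y : ℝ → ℝ} (hX : Continuous X)
    (hY : Continuous Y) (hX0 : X 0 = r * Real.cos x) (hY0 : Y 0 = r * Real.sin x)
    (hl : (∀ τ, X τ = r * Real.cos x) ∨ ∀ τ, Y τ = r * Real.sin x) {s : ℝ}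
    (h0 : ∀ τ ∈ Set.uIcc 0 s, 0 < X τ ^ 2 + Y τ ^ 2) :
    rotated x (X s) (Y s) ∈ Complex.slitPlane := by
  by_contra hs
  rw [Complex.mem_slitPlane_iff, not_or, not_lt, not_not, rotated_re, rotated_im] at hs
  obtain ⟨hre, him⟩ := hs
  have hcs := Real.cos_sq_add_sin_sq x
  -- At parameter `s` the point lies on the line through the origin and the starting point. Either
  -- it is the starting point, contradicting `hre`, or the path runs along that line.
  have key : ∀ τ, Y τ * Real.cos x - X τ * Real.sin x = 0 := by
    rcases hl with hl | hl
    · rw [hl] at him hre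
      have : (Y s - r * Real.sin x) * Real.cos x = 0 := by linear_combination him
      rcases mul_eq_zero.1 this with h | h
      · rw [sub_eq_zero.1 h] at hre
        nlinarith
      · intro τ
        rw [hl, h]
        ring
    · rw [hl] at him hre
      have : (X s - r * Real.cos x) * Real.sin x = 0 := by linear_combination -him
      rcases mul_eq_zero.1 this with h | h
      · rw [sub_eq_zero.1 h] at hre
        nlinarith
      · intro τ
        rw [hl, h]
        ring
  have hcont : ContinuousOn (fun τ => X τ * Real.cos x + Y τ * Real.sin x) (Set.uIcc 0 s) := by
    fun_prop
  -- The coordinate along the line starts at `r > 0` and ends at a value at most `0`, so it vanishes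
  -- in between, where the path meets the origin.
  have h1 : (0 : ℝ) ∈ Set.uIcc (X 0 * Real.cos x + Y 0 * Real.sin x)
      (X s * Real.cos x + Y s * Real.sin x) := by
    refine Set.mem_uIcc_of_ge hre ?_
    rw [hX0, hY0]
    nlinarith
  obtain ⟨τ, hτ, h2⟩ := intermediate_value_uIcc hcont h1
  have h3 := h0 τ hτ
  have h4 : X τ ^ 2 + Y τ ^ 2 = (X τ * Real.cos x + Y τ * Real.sin x) ^ 2
      + (Y τ * Real.cos x - X τ * Real.sin x) ^ 2 := by
    linear_combination -(X τ ^ 2 + Y τ ^ 2) * hcs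
  simp only at h2
  rw [h4, h2, key] at h3
  simp at h3

/-- Reduces the flow equation to `hW`, an identity at arbitrary polar coordinates `(R, θ)` of the
current point, in which neither `arg` nor the square root occurs. -/
lemma hasDerivAt_polar_of_line {r : ℝ} (hr : 0 < r) {X Y y t u X' Y' y' t' u' : ℝ → ℝ}
    (hX : ∀ s, HasDerivAt X (X' s) s) (hY : ∀ s, HasDerivAt Y (Y' s) s)
    (hy : ∀ s, HasDerivAt y (y' s) s) (ht : ∀ s, HasDerivAt t (t' s) s)
    (hu : ∀ s, HasDerivAt u (u' s) s) (hX0 : X 0 = r * Real.cos x) (hY0 : Y 0 = r * Real.sin x)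
    (hl : (∀ τ, X τ = r * Real.cos x) ∨ ∀ τ, Y τ = r * Real.sin x) {s : ℝ}
    (h0 : ∀ τ ∈ Set.uIcc 0 s, polar x (X τ) (Y τ) (y τ) (t τ) (u τ) ∈ domain)
    {W : Total → Total}
    (hW : ∀ R θ, 0 < R → R * Real.cos θ = X s → R * Real.sin θ = Y s →
      W (![R, θ, y s, t s], u s) = (![X' s * Real.cos θ + Y' s * Real.sin θ,
        R⁻¹ * (Y' s * Real.cos θ - X' s * Real.sin θ), y' s, t' s], u' s)) :
    HasDerivAt (fun τ => polar x (X τ) (Y τ) (y τ) (t τ) (u τ))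
      (W (polar x (X s) (Y s) (y s) (t s) (u s))) s := by
  have hw := rotated_mem_slitPlane hr (continuous_iff_continuousAt.2 fun s => (hX s).continuousAt)
    (continuous_iff_continuousAt.2 fun s => (hY s).continuousAt) hX0 hY0 hl
    fun τ hτ => polar_mem_domain.1 (h0 τ hτ)
  rw [polar_eq, hW _ _ (Real.sqrt_pos.2 (polar_mem_domain.1 (h0 s Set.right_mem_uIcc)))
    (sqrt_mul_cos_arg _ _ _) (sqrt_mul_sin_arg _ _ _)]
  exact hasDerivAt_polar (hX s) (hY s) (hy s) (ht s) (hu s) hw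

end polar

lemma total_congr {a₀ a₁ a₂ a₃ a₄ b₀ b₁ b₂ b₃ b₄ : ℝ} (h₀ : a₀ = b₀) (h₁ : a₁ = b₁)
    (h₂ : a₂ = b₂) (h₃ : a₃ = b₃) (h₄ : a₄ = b₄) :
    ((![a₀, a₁, a₂, a₃], a₄) : Total) = (![b₀, b₁, b₂, b₃], b₄) := by
  rw [h₀, h₁, h₂, h₃, h₄]

variable {a k : ℝ}

lemma flow_zero (i : Fin 11) {p : Total} (hp : p ∈ domain) : flow a k i 0 p = p := by
  obtain ⟨z, u⟩ := p
  have hz : (![z 0, z 1, z 2, z 3] : Base) = z := by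
    ext i; fin_cases i <;> rfl
  have hr : 0 < z 0 := hp
  match i with
  | 0 | 1 | 2 | 3 | 4 => simp [flow, ofCoords, hz]
  | 5 | 6 | 7 | 8 | 9 | 10 => simp [flow, ofCoords, polar_self _ hr, hz]

theorem hasDerivAt_flow (ha : a ≠ 0) (i : Fin 11) {p : Total} (hp : p ∈ domain) (s : ℝ)
    (h0 : ∀ τ ∈ Set.uIcc 0 s, flow a k i τ p ∈ domain) :
    HasDerivAt (fun τ => flow a k i τ p) (gen a k i (flow a k i s p)) s := by
  obtain ⟨z, u⟩ := p
  have hr : 0 < z 0 := hp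
  have z' (c s : ℝ) := hasDerivAt_const s c
  have hid (s : ℝ) := hasDerivAt_id' s
  have hC (s : ℝ) : HasDerivAt (fun s => Real.cosh (2 * a * s))
      (Real.sinh (2 * a * s) * (2 * a * 1)) s := ((hid s).const_mul (2 * a)).cosh
  have hS (s : ℝ) : HasDerivAt (fun s => Real.sinh (2 * a * s))
      (Real.cosh (2 * a * s) * (2 * a * 1)) s := ((hid s).const_mul (2 * a)).sinh
  have hc (s : ℝ) := Real.hasDerivAt_cos s
  have hs (s : ℝ) := Real.hasDerivAt_sin s
  match i with
  | 0 => exact hasDerivAt_total (z' _ _) ((hid s).const_add _) (z' _ _) (z' _ _) (z' _ _)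
  | 1 => exact hasDerivAt_total (z' _ _) (z' _ _) ((hid s).const_add _) (z' _ _) (z' _ _)
  | 2 => exact hasDerivAt_total (z' _ _) (z' _ _) (z' _ _) ((hid s).const_add _) (z' _ _)
  | 3 =>
    have h := hasDerivAt_total (z' (z 0) s) (z' (z 1) s) (z' (z 2) s) (z' (z 3) s)
      ((Real.hasDerivAt_exp s).mul_const u)
    exact h
  | 4 =>
    have ht := ((hC s).const_mul (z 3)).fun_add ((hS s).const_mul (z 2 / a))
    have h := hasDerivAt_total (z' (z 0) s) (z' (z 1) s)
      (((hC s).const_mul (z 2)).fun_add ((hS s).const_mul (a * z 3))) ht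
      (((ht.sub_const (z 3)).const_mul (-(k / 2))).exp.mul_const u)
    refine h.congr_deriv (Prod.ext (funext fun j => ?_) ?_)
    · fin_cases j <;> simp [gen, flow, ofCoords] <;> field_simp <;> ring
    · simp [gen, flow, ofCoords]
      field_simp
      ring
  -- From here on the flow moves only one of `X`, `Y`; `Or.inl` records that `X` is fixed, `Or.inr`
  -- that `Y` is.
  | 5 =>
    refine hasDerivAt_polar_of_line hr (z' _) (fun s => (hid s).const_add _) (z' _) (z' _) (z' _)
      (by simp) (by simp) (Or.inl fun _ => rfl) h0 fun R θ hR hX hY => ?_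
    simp [gen_apply]
  | 6 =>
    refine hasDerivAt_polar_of_line hr (fun s => (hid s).const_sub _) (z' _) (z' _) (z' _) (z' _)
      (by simp) (by simp) (Or.inr fun _ => rfl) h0 fun R θ hR hX hY => ?_
    simp [gen_apply]
  | 7 =>
    refine hasDerivAt_polar_of_line hr
      (fun s => ((hc s).const_mul (z 0 * Real.cos (z 1))).fun_sub ((hs s).const_mul (z 2)))
      (z' _) (fun s => ((hc s).const_mul (z 2)).fun_add
        ((hs s).const_mul (z 0 * Real.cos (z 1)))) (z' _) (z' _)
      (by simp) (by simp) (Or.inr fun _ => rfl) h0 fun R θ hR hX hY => ?_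
    simp [gen_apply, hX]
    refine ⟨Or.inl ?_, ?_, ?_⟩ <;> ring
  | 8 =>
    refine hasDerivAt_polar_of_line hr (z' _)
      (fun s => ((hc s).const_mul (z 0 * Real.sin (z 1))).fun_sub ((hs s).const_mul (z 2)))
      (fun s => ((hc s).const_mul (z 2)).fun_add
        ((hs s).const_mul (z 0 * Real.sin (z 1)))) (z' _) (z' _)
      (by simp) (by simp) (Or.inl fun _ => rfl) h0 fun R θ hR hX hY => ?_
    simp [gen_apply, hY]
    refine ⟨Or.inl ?_, ?_, ?_⟩ <;> ring
  | 9 =>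
    -- `t'` contains the initial `Y` divided by `a`, whereas the field contains `a ^ 2 * t'`; `hq`
    -- removes the quotient.
    have hq := div_mul_cancel₀ (z 0 * Real.sin (z 1)) ha
    have ht (s) := ((hC s).const_mul (z 3)).fun_add ((hS s).const_mul (z 0 * Real.sin (z 1) / a))
    refine hasDerivAt_polar_of_line hr (z' _)
      (fun s => ((hC s).const_mul (z 0 * Real.sin (z 1))).fun_add ((hS s).const_mul (a * z 3)))
      (z' _) ht (fun s => (((ht s).sub_const (z 3)).const_mul (-(k / 2))).exp.mul_const u)
      (by simp) (by simp) (Or.inl fun _ => rfl) h0 fun R θ hR hX hY => ?_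
    simp only [gen_apply]
    refine total_congr ?_ ?_ ?_ ?_ ?_
    all_goals simp
    · exact Or.inl (by linear_combination 2 * a * Real.sinh (2 * a * s) * hq)
    · linear_combination 2 * a * Real.sinh (2 * a * s) * R⁻¹ * Real.cos θ * hq
    · linear_combination 2 * hY - 2 * Real.cosh (2 * a * s) * hq
    · generalize Real.exp _ = E
      linear_combination k * E * u * (hY - Real.cosh (2 * a * s) * hq)
  | 10 =>
    have hq := div_mul_cancel₀ (z 0 * Real.cos (z 1)) ha
    have ht (s) := ((hC s).const_mul (z 3)).fun_sub ((hS s).const_mul (z 0 * Real.cos (z 1) / a))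
    refine hasDerivAt_polar_of_line hr
      (fun s => ((hC s).const_mul (z 0 * Real.cos (z 1))).fun_sub ((hS s).const_mul (a * z 3)))
      (z' _) (z' _) ht
      (fun s => (((ht s).sub_const (z 3)).const_mul (-(k / 2))).exp.mul_const u)
      (by simp) (by simp) (Or.inr fun _ => rfl) h0 fun R θ hR hX hY => ?_
    simp only [gen_apply]
    refine total_congr ?_ ?_ ?_ ?_ ?_
    all_goals simp
    · linear_combination 2 * a * Real.sinh (2 * a * s) * Real.cos θ * hq
    · linear_combination -2 * a * Real.sinh (2 * a * s) * R⁻¹ * Real.sin θ * hq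
    · linear_combination -2 * hX + 2 * Real.cosh (2 * a * s) * hq
    · generalize Real.exp _ = E
      linear_combination k * E * u * (hX - Real.cosh (2 * a * s) * hq)

end Telegraph
end

theorem mainTheorem1 (a k : ℝ) (ha : a ≠ 0) (hk : k ≠ 0) :
    -- the symmetry condition is equivalent to the 27 determining equations
    (∀ V : Telegraph.Total → Telegraph.Total, ContDiffOn ℝ ∞ V Telegraph.domain →
      (Telegraph.IsPointSymmetry a k V ↔ Telegraph.DeterminingEquations a k V)) ∧
    -- up to the fields `β ∂_u`, with `β` a solution, the symmetries are the linear span of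
    -- the eleven generators
    (∀ V : Telegraph.Total → Telegraph.Total,
      Telegraph.IsPointSymmetry a k V ↔
        ∃ β : Telegraph.Base → ℝ, Telegraph.IsSolution a k β ∧
          Telegraph.domain.domRestrict (V - Telegraph.superposition β) ∈
            Submodule.span ℝ
              (Set.range fun i => Telegraph.domain.domRestrict (Telegraph.gen a k i))) ∧
    -- the eleven generators are linearly independent, and their span meets the space of the
    -- fields `β ∂_u` only in zero
    LinearIndependent ℝ (fun i => Telegraph.domain.domRestrict (Telegraph.gen a k i)) ∧
    (∀ β : Telegraph.Base → ℝ, Telegraph.IsSolution a k β →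
      Telegraph.domain.domRestrict (Telegraph.superposition β) ∈
        Submodule.span ℝ (Set.range fun i => Telegraph.domain.domRestrict (Telegraph.gen a k i)) →
      Set.EqOn β 0 Telegraph.baseDomain) ∧
    -- the commutator table
    (∀ i j : Fin 11,
      Set.EqOn (VectorField.lieBracket ℝ (Telegraph.gen a k i) (Telegraph.gen a k j))
        (Telegraph.commutatorTable a k (Telegraph.gen a k) i j) Telegraph.domain) ∧
    -- the one-parameter groups
    (∀ i : Fin 11, ∀ p ∈ Telegraph.domain,
      Telegraph.flow a k i 0 p = p ∧
      ∀ s : ℝ, (∀ τ ∈ Set.uIcc 0 s, Telegraph.flow a k i τ p ∈ Telegraph.domain) →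
        HasDerivAt (fun τ => Telegraph.flow a k i τ p)
          (Telegraph.gen a k i (Telegraph.flow a k i s p)) s) := by
  refine ⟨fun V hV => Telegraph.isPointSymmetry_iff_determiningEquations ha hk hV,
    fun V => Telegraph.isPointSymmetry_iff_mem_span ha hk, Telegraph.linearIndependent_gen,
    fun β _ h => Telegraph.eqOn_zero_of_superposition_mem_span h,
    Telegraph.lieBracket_gen_eq_commutatorTable, fun i p hp => ⟨Telegraph.flow_zero i hp,
        Telegraph.hasDerivAt_flow ha i hp⟩⟩
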